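/- Let $p$ be a prime and $K$ a complete, discretely valued field extension of $\mathbb{Q}_p$. **Setting.** A triangular decomposition $(A,B,H,\partial)$ of a (two-sided) noetherian $\mathbb{Z}$-graded $K$-algebra $R$ consists of graded subalgebras $A,B,H\subset R$ and an element $\partial\in R_0$ such that: multiplication gives an isomorphism of vector spaces $A\otimes_K H\otimes_K B\cong R$; $BH=HB$ and $HA=AH$; $A=\bigoplus_{n\ge 0}A_n$, $B=\bigoplus_{n\le 0}B_n$ with $A_0=B_0=K$, all $A_n$, $B_n$ finite-dimensional, and $H\subset R_0$; $H$ is a finite-dimensional split semi-simple $K$-algebra; and $R_n=\{x\in R : [\partial,x]=nx\}$ for all $n$. For a vector space $V$ with an endomorphism $D$ and $\lambda\in K$, let $V^\lambda=\{v : (D-\lambda)^m v=0 \text{ for } m\gg 0\}$ and $V^{\mathrm{ws}}=\bigoplus_\lambda V^\lambda$. A normed space $V$ has a semi-simple weight space decomposition for $D$ if there is a set $I$ of weights (scalars $\lambda$ with $V^\lambda\ne 0$) such that every $v\in V$ is a convergent sum $\sum_{\lambda\in I}v_\lambda$ with $v_\lambda\in V^\lambda$, and $D$ acts on $V^\lambda$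 as multiplication by $\lambda$ for each $\lambda\in I$. Let $\mathscr{R}$ be a (two-sided) noetherian Banach $K$-algebra with a triangular decomposition $(R,A,B,H,\partial)$: that is, $R\subset\mathscr{R}$ is a dense subalgebra with a grading, $(A,B,H,\partial)$ is a triangular decomposition of $R$, and, writing $\mathscr{A},\mathscr{B}$ for the closures of $A,B$ in $\mathscr{R}$, multiplication induces an isomorphism of Banach spaces $\mathscr{A}\widehat{\otimes}_K H\widehat{\otimes}_K\mathscr{B}\cong\mathscr{R}$, and $\mathscr{A}$ and $\mathscr{B}$ have semi-simple weight space decompositions for $[\partial,-]$ with $\mathscr{A}^{\mathrm{ws}}=A$ and $\mathscr{B}^{\mathrm{ws}}=B$. Assume also that $\mathscr{A}$ and $\mathscr{B}$ are (two-sided) noetherian. Let $BH\subset R$ and $\mathscr{B}H\subset\mathscr{R}$ be the subalgebras generated by $B$, respectively $\mathscr{B}$, and $H$; let $BH^{>0}\subset BH$ and $\mathscr{B}H^{>0}\subset\mathscr{B}H$ be the two-sided ideals generated by the products $bh$ with $h\in H$ and $b\in B$ homogeneous of negative degree. For a simple $H$-module $W$ (with its canonical topology as a finite-dimensional $K$-space)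 the Verma module and the analytic Verma module are $$\Delta(W)=R\otimes_{BH}\left(BH/BH^{>0}\otimes_H W\right),\qquad \widehat{\Delta}(W)=\mathscr{R}\widehat{\otimes}_{\mathscr{B}H}\left(\mathscr{B}H/\mathscr{B}H^{>0}\widehat{\otimes}_H W\right).$$ **Proposition.** Let $W$ be a simple $H$-module. 1. The map $a\otimes w\mapsto a\cdot(1\otimes(1\otimes w))$ extends to an isomorphism of Banach spaces $\mathscr{A}\widehat{\otimes}_K W\cong\widehat{\Delta}(W)$. 2. $\Delta(W)$ has a unique maximal $R$-submodule $M(W)$; put $L(W)=\Delta(W)/M(W)$. 3. $\widehat{\Delta}(W)$ has a unique maximal $\mathscr{R}$-submodule $\widehat{M}(W)$, hence a unique simple quotient $\widehat{L}(W)=\widehat{\Delta}(W)/\widehat{M}(W)$. 4. There is an isomorphism of $\mathscr{R}$-modules $\mathscr{R}\otimes_R L(W)\cong\widehat{L}(W)$ which sends $1\otimes[1\otimes(1\otimes w)]$ to $[1\otimes(1\otimes w)]$ for all $w\in W$. 5. The induced $R$-linear map $L(W)\to\widehat{L}(W)$, $x\mapsto 1\otimes x$, is injective with image $\widehat{L}(W)^{\mathrm{ws}}$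 (weight spaces for the action of $\partial$); that is, $\widehat{L}(W)^{\mathrm{ws}}=L(W)$. -/

import Mathlib

open scoped TensorProduct

noncomputable section

/-! ## Non-archimedean projective tensor products -/

section ProjectiveTensor

variable {K : Type*} [NontriviallyNormedField K]
  {V : Type*} [SeminormedAddCommGroup V] [NormedSpace K V]
  {W : Type*} [SeminormedAddCommGroup W] [NormedSpace K W]

/-- The finite sums of elementary tensors `v ⊗ w` with `‖v‖ * ‖w‖ ≤ c`. -/
def projBall (K V W : Type*) [NontriviallyNormedField K] [SeminormedAddCommGroup V]
    [NormedSpace K V] [SeminormedAddCommGroup W] [NormedSpace K W] (c : ℝ) :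
    AddSubgroup (V ⊗[K] W) :=
  AddSubgroup.closure {x | ∃ (v : V) (w : W), ‖v‖ * ‖w‖ ≤ c ∧ v ⊗ₜ[K] w = x}

lemma projBall_mono {c d : ℝ} (h : c ≤ d) : projBall K V W c ≤ projBall K V W d :=
  AddSubgroup.closure_mono fun _ ⟨v, w, hc, hx⟩ => ⟨v, w, hc.trans h, hx⟩

/-- The projective seminorm of non-archimedean functional analysis:
`‖x‖` is the infimum of `max_i ‖v_i‖ * ‖w_i‖` over all expressions `x = ∑_i v_i ⊗ w_i`. -/
def projNorm (x : V ⊗[K] W) : ℝ := sInf {c : ℝ | 0 ≤ c ∧ x ∈ projBall K V W c}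

lemma projNorm_set_nonempty (x : V ⊗[K] W) : {c : ℝ | 0 ≤ c ∧ x ∈ projBall K V W c}.Nonempty := by
  induction x using TensorProduct.induction_on with
  | zero => exact ⟨0, le_rfl, zero_mem _⟩
  | tmul v w =>
    exact ⟨‖v‖ * ‖w‖, by positivity, AddSubgroup.subset_closure ⟨v, w, le_rfl, rfl⟩⟩
  | add x y hx hy =>
    obtain ⟨c, hc, hx⟩ := hx
    obtain ⟨d, hd, hy⟩ := hy
    exact ⟨max c d, hc.trans (le_max_left _ _),
      add_mem (projBall_mono (le_max_left _ _) hx) (projBall_mono (le_max_right _ _) hy)⟩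

lemma projNorm_bddBelow (x : V ⊗[K] W) : BddBelow {c : ℝ | 0 ≤ c ∧ x ∈ projBall K V W c} :=
  ⟨0, fun _ h => h.1⟩

lemma projNorm_le {x : V ⊗[K] W} {c : ℝ} (hc : 0 ≤ c) (hx : x ∈ projBall K V W c) :
    projNorm x ≤ c :=
  csInf_le (projNorm_bddBelow x) ⟨hc, hx⟩

lemma mem_projBall_of_lt {x : V ⊗[K] W} {c : ℝ} (h : projNorm x < c) :
    0 ≤ c ∧ x ∈ projBall K V W c := by
  obtain ⟨d, ⟨hd, hx⟩, hdc⟩ := exists_lt_of_csInf_lt (projNorm_set_nonempty x) h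
  exact ⟨hd.trans hdc.le, projBall_mono hdc.le hx⟩

lemma projNorm_nonneg (x : V ⊗[K] W) : 0 ≤ projNorm x :=
  Real.sInf_nonneg fun _ h => h.1

instance instSeminormedAddCommGroupProjTensor : SeminormedAddCommGroup (V ⊗[K] W) :=
  AddGroupSeminorm.toSeminormedAddCommGroup
    { toFun := projNorm
      map_zero' := le_antisymm (projNorm_le le_rfl (zero_mem _)) (projNorm_nonneg _)
      add_le' := fun x y => le_of_forall_pos_lt_add fun ε hε => by
        obtain ⟨hc, hx⟩ := mem_projBall_of_lt (lt_add_of_pos_right (projNorm x) (half_pos hε))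
        obtain ⟨hd, hy⟩ := mem_projBall_of_lt (lt_add_of_pos_right (projNorm y) (half_pos hε))
        have h := projNorm_le (hc.trans (le_max_left _ _))
          (add_mem (projBall_mono (le_max_left _ (projNorm y + ε / 2)) hx)
            (projBall_mono (le_max_right (projNorm x + ε / 2) _) hy))
        have h1 := projNorm_nonneg x
        have h2 := projNorm_nonneg y
        rcases max_cases (projNorm x + ε / 2) (projNorm y + ε / 2) with ⟨h3, -⟩ | ⟨h3, -⟩ <;>
          rw [h3] at h <;> linarith
      neg' := fun x => by simp only [projNorm, neg_mem_iff] }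

lemma norm_tensor_eq (x : V ⊗[K] W) : ‖x‖ = projNorm x := rfl

/-- A ring acting boundedly on `V` acts boundedly on `V ⊗ W` through the left factor. -/
instance instIsBoundedSMulProjTensor {T : Type*} [SeminormedRing T] [Module T V]
    [IsBoundedSMul T V] [SMulCommClass K T V] : IsBoundedSMul T (V ⊗[K] W) :=
  .of_norm_smul_le fun t x => by
    have key : ∀ c : ℝ, x ∈ projBall K V W c → t • x ∈ projBall K V W (‖t‖ * c) := by
      intro c hx
      induction hx using AddSubgroup.closure_induction with
      | mem y hy =>
        obtain ⟨v, w, h, rfl⟩ := hy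
        refine AddSubgroup.subset_closure ⟨t • v, w, ?_, by rw [TensorProduct.smul_tmul']⟩
        calc ‖t • v‖ * ‖w‖ ≤ ‖t‖ * ‖v‖ * ‖w‖ := by gcongr; exact norm_smul_le t v
          _ = ‖t‖ * (‖v‖ * ‖w‖) := by ring
          _ ≤ ‖t‖ * c := by gcongr
      | zero => simp
      | add y z _ _ hy hz => rw [smul_add]; exact add_mem hy hz
      | neg y _ hy => rw [smul_neg]; exact neg_mem hy
    rw [norm_tensor_eq, norm_tensor_eq]
    refine le_of_forall_gt_imp_ge_of_dense fun d hd => ?_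
    by_contra! hlt
    have hd0 : 0 < d := lt_of_le_of_lt (by have := projNorm_nonneg x; positivity) hd
    have hlt' : ∃ c, projNorm x < c ∧ ‖t‖ * c ≤ d := by
      rcases (norm_nonneg t).eq_or_lt with h0 | h0
      · exact ⟨projNorm x + 1, by linarith, by rw [← h0]; linarith⟩
      · exact ⟨d / ‖t‖, by rw [lt_div_iff₀ h0]; linarith, by field_simp; exact le_rfl⟩
    obtain ⟨c, hc, hcd⟩ := hlt'
    obtain ⟨hc0, hxc⟩ := mem_projBall_of_lt hc
    have := projNorm_le (by positivity) (key c hxc)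
    linarith

instance instNormedSpaceProjTensor : NormedSpace K (V ⊗[K] W) where
  norm_smul_le k x := norm_smul_le k x

/-- The completed tensor product `V ⊗̂_K W`. -/
def CompletedTensor (K V W : Type*) [NontriviallyNormedField K] [SeminormedAddCommGroup V]
    [NormedSpace K V] [SeminormedAddCommGroup W] [NormedSpace K W] : Type _ :=
  UniformSpace.Completion (V ⊗[K] W)

instance : NormedAddCommGroup (CompletedTensor K V W) :=
  inferInstanceAs (NormedAddCommGroup (UniformSpace.Completion (V ⊗[K] W)))

instance : NormedSpace K (CompletedTensor K V W) :=
  inferInstanceAs (NormedSpace K (UniformSpace.Completion (V ⊗[K] W)))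

instance : CompleteSpace (CompletedTensor K V W) :=
  inferInstanceAs (CompleteSpace (UniformSpace.Completion (V ⊗[K] W)))

/-- The elementary tensor `v ⊗ w` in `V ⊗̂_K W`. -/
def CompletedTensor.tmul (K : Type*) {V W : Type*} [NontriviallyNormedField K]
    [SeminormedAddCommGroup V] [NormedSpace K V] [SeminormedAddCommGroup W] [NormedSpace K W]
    (v : V) (w : W) : CompletedTensor K V W :=
  ((v ⊗ₜ[K] w : V ⊗[K] W) : UniformSpace.Completion (V ⊗[K] W))

end ProjectiveTensor

/-! ## Quotients of non-commutative seminormed rings and modules -/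

section Quotients

instance instIsBoundedSMulQuot {T M : Type*} [SeminormedRing T]
    [SeminormedAddCommGroup M] [Module T M] [IsBoundedSMul T M] (U : Submodule T M) :
    IsBoundedSMul T (M ⧸ U) :=
  .of_norm_smul_le fun t x => by
    refine le_of_forall_pos_le_add fun ε hε => ?_
    obtain ⟨m, rfl, hm⟩ := Submodule.Quotient.norm_mk_lt x
      (show 0 < ε / (‖t‖ + 1) by positivity)
    calc ‖t • (Submodule.Quotient.mk m : M ⧸ U)‖
        = ‖(Submodule.Quotient.mk (t • m) : M ⧸ U)‖ := rfl
      _ ≤ ‖t‖ * ‖m‖ := (Submodule.Quotient.norm_mk_le _ _).trans (norm_smul_le t m)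
      _ ≤ ‖t‖ * (‖(Submodule.Quotient.mk m : M ⧸ U)‖ + ε / (‖t‖ + 1)) := by gcongr
      _ = ‖t‖ * ‖(Submodule.Quotient.mk m : M ⧸ U)‖ + ε * (‖t‖ / (‖t‖ + 1)) := by ring
      _ ≤ ‖t‖ * ‖(Submodule.Quotient.mk m : M ⧸ U)‖ + ε * 1 := by
        gcongr
        rw [div_le_one (by positivity)]
        linarith
      _ = _ := by ring

variable {S : Type*} [SeminormedRing S] (I : Ideal S) [I.IsTwoSided]

/-- The quotient seminorm on the quotient of a seminormed ring by a two-sided ideal. -/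
instance instSeminormedRingQuot : SeminormedRing (S ⧸ I) :=
  { Submodule.Quotient.seminormedAddCommGroup I, Ideal.Quotient.ring I with
    norm_mul_le := fun x y => by
      have hy : ∀ a b : S, ‖(Ideal.Quotient.mk I a * Ideal.Quotient.mk I b : S ⧸ I)‖
          ≤ ‖a‖ * ‖b‖ := fun a b =>
        (Submodule.Quotient.norm_mk_le I (a * b)).trans (norm_mul_le a b)
      have hx : ∀ ε > 0, ‖x * y‖ ≤ (‖x‖ + ε) * (‖y‖ + ε) := fun ε hε => by
        obtain ⟨a, rfl, ha⟩ := Submodule.Quotient.norm_mk_lt x hε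
        obtain ⟨b, rfl, hb⟩ := Submodule.Quotient.norm_mk_lt y hε
        exact (hy a b).trans (by gcongr)
      have hlim : Filter.Tendsto (fun ε : ℝ => (‖x‖ + ε) * (‖y‖ + ε))
          (nhdsWithin 0 (Set.Ioi 0)) (nhds (‖x‖ * ‖y‖)) := by
        have hc : Continuous fun ε : ℝ => (‖x‖ + ε) * (‖y‖ + ε) := by fun_prop
        simpa using (hc.tendsto 0).mono_left nhdsWithin_le_nhds
      exact ge_of_tendsto hlim (Filter.eventually_of_mem self_mem_nhdsWithin hx) }

instance instNormedAlgebraQuot {K : Type*} [NormedField K] [NormedAlgebra K S] :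
    NormedAlgebra K (S ⧸ I) where
  norm_smul_le k x := (Submodule.Quotient.normedSpace I K).norm_smul_le k x

instance instIsBoundedSMulQuotRing : IsBoundedSMul S (S ⧸ I) :=
  instIsBoundedSMulQuot I

end Quotients

/-! ## Tensor products over non-commutative algebras -/

section RelativeTensor

/-- Let `P` be a ring with a left action of `T`, regarded as a right `S`-module through
`f : S →+* P`, and let `N` be a left `S`-module. This is the `T`-submodule of `P ⊗_K N` generated
by the relations `p f(s) ⊗ n = p ⊗ s n`. -/
def balancedRelations (K T : Type*) {S P : Type*} (N : Type*) [Field K] [Ring T] [Ring S] [Ring P]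
    [Algebra K P] [Module T P] [SMulCommClass K T P] [AddCommGroup N] [Module K N] [Module S N]
    (f : S →+* P) : Submodule T (P ⊗[K] N) :=
  Submodule.span T {x | ∃ (p : P) (s : S) (n : N), x = (p * f s) ⊗ₜ[K] n - p ⊗ₜ[K] (s • n)}

section Algebraic

variable (K T : Type*) {S P : Type*} (N : Type*) [Field K] [Ring T] [Ring S] [Ring P]
    [Algebra K P] [Module T P] [SMulCommClass K T P] [AddCommGroup N] [Module K N] [Module S N]
    (f : S →+* P)

/-- The left `T`-module `P ⊗_S N`. -/
def RelTensor : Type _ := (P ⊗[K] N) ⧸ balancedRelations K T N f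

instance : AddCommGroup (RelTensor K T N f) :=
  inferInstanceAs (AddCommGroup ((P ⊗[K] N) ⧸ balancedRelations K T N f))

instance : Module T (RelTensor K T N f) :=
  inferInstanceAs (Module T ((P ⊗[K] N) ⧸ balancedRelations K T N f))

instance [Algebra K T] [IsScalarTower K T P] : Module K (RelTensor K T N f) :=
  inferInstanceAs (Module K ((P ⊗[K] N) ⧸ balancedRelations K T N f))

instance [Algebra K T] [IsScalarTower K T P] : IsScalarTower K T (RelTensor K T N f) :=
  inferInstanceAs (IsScalarTower K T ((P ⊗[K] N) ⧸ balancedRelations K T N f))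

variable {N}

/-- The elementary tensor `p ⊗ n` in `P ⊗_S N`. -/
def RelTensor.tmul (p : P) (n : N) : RelTensor K T N f :=
  (Submodule.Quotient.mk (p ⊗ₜ[K] n) : (P ⊗[K] N) ⧸ balancedRelations K T N f)

end Algebraic

section Completed

variable (K T : Type*) {S P : Type*} (N : Type*) [NontriviallyNormedField K]
    [SeminormedRing T] [NormedAlgebra K T] [Ring S] [SeminormedRing P] [NormedAlgebra K P]
    [Module T P] [SMulCommClass K T P] [IsScalarTower K T P] [IsBoundedSMul T P]
    [SeminormedAddCommGroup N] [NormedSpace K N] [Module S N] (f : S →+* P)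

/-- The completed tensor product `P ⊗̂_S N`: the Hausdorff completion of `P ⊗_S N` for the quotient
of the projective tensor seminorm on `P ⊗_K N`. -/
def CompletedRelTensor : Type _ :=
  UniformSpace.Completion ((P ⊗[K] N) ⧸ balancedRelations K T N f)

instance : NormedAddCommGroup (CompletedRelTensor K T N f) :=
  inferInstanceAs
    (NormedAddCommGroup (UniformSpace.Completion ((P ⊗[K] N) ⧸ balancedRelations K T N f)))

instance : NormedSpace K (CompletedRelTensor K T N f) :=
  inferInstanceAs
    (NormedSpace K (UniformSpace.Completion ((P ⊗[K] N) ⧸ balancedRelations K T N f)))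

instance : CompleteSpace (CompletedRelTensor K T N f) :=
  inferInstanceAs
    (CompleteSpace (UniformSpace.Completion ((P ⊗[K] N) ⧸ balancedRelations K T N f)))

instance : Module T (CompletedRelTensor K T N f) :=
  inferInstanceAs
    (Module T (UniformSpace.Completion ((P ⊗[K] N) ⧸ balancedRelations K T N f)))

instance : IsScalarTower K T (CompletedRelTensor K T N f) :=
  inferInstanceAs
    (IsScalarTower K T (UniformSpace.Completion ((P ⊗[K] N) ⧸ balancedRelations K T N f)))

variable {N}

/-- The elementary tensor `p ⊗ n` in `P ⊗̂_S N`. -/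
def CompletedRelTensor.tmul (p : P) (n : N) : CompletedRelTensor K T N f :=
  (((Submodule.Quotient.mk (p ⊗ₜ[K] n) : (P ⊗[K] N) ⧸ balancedRelations K T N f)) :
    UniformSpace.Completion ((P ⊗[K] N) ⧸ balancedRelations K T N f))

end Completed

end RelativeTensor

/-! ## Generalized weight spaces -/

section Weights

variable {K : Type*} [NontriviallyNormedField K]

/-- The set `Λ(V)` of weights of an endomorphism. The generalized weight space `V^l` is
`D.maxGenEigenspace l`. -/
def weightSet {V : Type*} [AddCommGroup V] [Module K V] (D : Module.End K V) : Set K :=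
  {l | D.maxGenEigenspace l ≠ ⊥}

/-- The subspace `V^ws`, the sum of all generalized weight spaces. -/
def weightSum {V : Type*} [AddCommGroup V] [Module K V] (D : Module.End K V) : Submodule K V :=
  ⨆ l : K, D.maxGenEigenspace l

/-- `V` admits a semi-simple weight space decomposition for `D`: for some set `I` of weights, every
vector is a convergent sum of vectors in the weight spaces `V^l`, `l ∈ I`, and `D` acts on each of
these weight spaces as multiplication by `l`. -/
def HasSemisimpleWeightDecomposition {V : Type*} [SeminormedAddCommGroup V] [NormedSpace K V]
    (D : Module.End K V) : Prop :=
  ∃ I : Set K, I ⊆ weightSet D ∧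
    (∀ v : V, ∃ c : I → V, (∀ l : I, c l ∈ D.maxGenEigenspace (l : K)) ∧ HasSum c v) ∧
    ∀ l ∈ I, ∀ v ∈ D.maxGenEigenspace l, D v = l • v

/-- The subspace `M^ws` of a module over a `K`-algebra, for the action of an element `d`. -/
def moduleWeightSum (K : Type*) {T : Type*} (M : Type*) [NontriviallyNormedField K] [Ring T]
    [Algebra K T] [AddCommGroup M] [Module K M] [Module T M] [IsScalarTower K T M] (d : T) :
    Submodule K M :=
  weightSum (Algebra.lsmul K K M d)

end Weights

/-! ## Triangular decompositions of graded algebras -/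

/-- Left and right noetherian. -/
def IsTwoSidedNoetherian (R : Type*) [Ring R] : Prop :=
  IsNoetherianRing R ∧ IsNoetherianRing Rᵐᵒᵖ

/-- A finite-dimensional split semi-simple algebra: a finite product of matrix algebras over `K`. -/
def IsSplitSemisimple (K H : Type*) [Field K] [Ring H] [Algebra K H] : Prop :=
  ∃ (n : ℕ) (d : Fin n → ℕ), Nonempty (H ≃ₐ[K] ((i : Fin n) → Matrix (Fin (d i)) (Fin (d i)) K))

/-- A triangular decomposition `(A, B, H, ∂)` of a noetherian `ℤ`-graded `K`-algebra `R`. -/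
structure TriangularDecomposition (K R : Type*) [Field K] [Ring R] [Algebra K R] where
  /-- the homogeneous components `R_n` -/
  grading : ℤ → Submodule K R
  [gradedAlgebra : GradedAlgebra grading]
  noetherian : IsTwoSidedNoetherian R
  A : Subalgebra K R
  B : Subalgebra K R
  H : Subalgebra K R
  A_homogeneous : A.toSubmodule.IsHomogeneous grading
  B_homogeneous : B.toSubmodule.IsHomogeneous grading
  /-- `R = A ⊗ H ⊗ B` through multiplication -/
  decomposition : ∃ e : ((A ⊗[K] H) ⊗[K] B) ≃ₗ[K] R,
    ∀ (a : A) (h : H) (b : B), e ((a ⊗ₜ h) ⊗ₜ b) = (a : R) * h * b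
  B_mul_H : B.toSubmodule * H.toSubmodule = H.toSubmodule * B.toSubmodule
  H_mul_A : H.toSubmodule * A.toSubmodule = A.toSubmodule * H.toSubmodule
  A_nonneg : ∀ n < 0, A.toSubmodule ⊓ grading n = ⊥
  B_nonpos : ∀ n > 0, B.toSubmodule ⊓ grading n = ⊥
  A_zero : A.toSubmodule ⊓ grading 0 = 1
  B_zero : B.toSubmodule ⊓ grading 0 = 1
  H_le : H.toSubmodule ≤ grading 0
  A_finite : ∀ n, FiniteDimensional K ↥(A.toSubmodule ⊓ grading n)
  B_finite : ∀ n, FiniteDimensional K ↥(B.toSubmodule ⊓ grading n)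
  H_split : IsSplitSemisimple K H
  /-- the grading element `∂` -/
  del : R
  del_mem : del ∈ grading 0
  /-- the grading is inner -/
  mem_grading_iff : ∀ (n : ℤ) (x : R), x ∈ grading n ↔ del * x - x * del = n • x

namespace TriangularDecomposition

variable {K R : Type*} [Field K] [Ring R] [Algebra K R] (τ : TriangularDecomposition K R)

attribute [instance] gradedAlgebra

lemma ad_mem_of_homogeneous {S : Subalgebra K R} (hS : S.toSubmodule.IsHomogeneous τ.grading)
    {x : R} (hx : x ∈ S) : τ.del * x - x * τ.del ∈ S := by
  classical
  have key : ∀ n, τ.del * (DirectSum.decompose τ.grading x n : R)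
      - (DirectSum.decompose τ.grading x n : R) * τ.del ∈ S := fun n => by
    rw [(τ.mem_grading_iff n _).1 (DirectSum.decompose τ.grading x n).2]
    exact zsmul_mem (hS n hx) n
  rw [← DirectSum.sum_support_decompose τ.grading x, Finset.mul_sum, Finset.sum_mul,
    ← Finset.sum_sub_distrib]
  exact sum_mem fun n _ => key n

/-- The subalgebra `BH` of `R`. -/
def BH : Subalgebra K R := τ.B ⊔ τ.H

/-- The homogeneous elements of `B^{>0}`. -/
def BPos : Set R := {b | b ∈ τ.B ∧ ∃ n < 0, b ∈ τ.grading n}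

/-- The two-sided ideal `BH^{>0}` of `BH`. -/
def BHPos : Ideal τ.BH :=
  (TwoSidedIdeal.span {x : τ.BH | ∃ b ∈ τ.BPos, ∃ h ∈ τ.H, (x : R) = b * h}).asIdeal

instance : τ.BHPos.IsTwoSided := by unfold BHPos; infer_instance

/-- The algebra map `H → BH → BH / BH^{>0}`. -/
def HToQuot : τ.H →+* (τ.BH ⧸ τ.BHPos) :=
  (Ideal.Quotient.mk τ.BHPos).comp (Subalgebra.inclusion (le_sup_right : τ.H ≤ τ.BH)).toRingHom

variable (W : Type*) [AddCommGroup W] [Module K W] [Module τ.H W]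

/-- The `BH`-module `BH / BH^{>0} ⊗_H W`. -/
abbrev Inflation : Type _ := RelTensor K τ.BH W τ.HToQuot

/-- The Verma module `Δ(W) = R ⊗_{BH} (BH / BH^{>0} ⊗_H W)`. -/
abbrev Verma : Type _ := RelTensor K R (τ.Inflation W) τ.BH.val.toRingHom

variable {W}

/-- The element `1 ⊗ (1 ⊗ w)` of `Δ(W)`. -/
def vermaGen (w : W) : τ.Verma W :=
  RelTensor.tmul K R τ.BH.val.toRingHom 1 (RelTensor.tmul K τ.BH τ.HToQuot 1 w)

end TriangularDecomposition

/-! ## Triangular decompositions of Banach algebras -/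

section Closure

variable {K 𝓡 : Type*} [NontriviallyNormedField K] [NormedRing 𝓡] [NormedAlgebra K 𝓡]
  {R : Subalgebra K 𝓡}

/-- The completion in `𝓡` of a subalgebra of `R ⊆ 𝓡`. -/
def completionIn (S : Subalgebra K R) : Subalgebra K 𝓡 := (S.map R.val).topologicalClosure

/-- The operator `ad d = [d, -]` on `𝓡`. -/
def adOp (K : Type*) {𝓡 : Type*} [NontriviallyNormedField K] [NormedRing 𝓡] [NormedAlgebra K 𝓡]
    (d : 𝓡) : Module.End K 𝓡 :=
  LinearMap.mulLeft K d - LinearMap.mulRight K d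

lemma adOp_mem_completionIn {S : Subalgebra K R} {d : R} (h : ∀ x ∈ S, d * x - x * d ∈ S) :
    ∀ x ∈ (completionIn S).toSubmodule, adOp K (d : 𝓡) x ∈ (completionIn S).toSubmodule := by
  intro x hx
  have hm : Set.MapsTo (fun y : 𝓡 => (d : 𝓡) * y - y * d) (S.map R.val : Set 𝓡)
      (S.map R.val : Set 𝓡) := by
    rintro _ ⟨y, hy, rfl⟩
    exact ⟨d * y - y * d, h y hy, by simp⟩
  exact hm.closure (by fun_prop) hx

/-- The operator `ad ∂` on the completion of a homogeneous subalgebra. -/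
def adOnCompletion (τ : TriangularDecomposition K R) {S : Subalgebra K R}
    (hS : S.toSubmodule.IsHomogeneous τ.grading) : Module.End K (completionIn S) :=
  (adOp K (τ.del : 𝓡)).restrict
    (adOp_mem_completionIn fun _ hx => τ.ad_mem_of_homogeneous hS hx)

end Closure

/-- A triangular decomposition `(R, A, B, H, ∂)` of a noetherian Banach `K`-algebra `𝓡`. -/
structure BanachTriangularDecomposition (K 𝓡 : Type*) [NontriviallyNormedField K] [NormedRing 𝓡]
    [NormedAlgebra K 𝓡] where
  noetherian : IsTwoSidedNoetherian 𝓡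
  /-- the dense graded subalgebra -/
  R : Subalgebra K 𝓡
  dense : Dense (R : Set 𝓡)
  tri : TriangularDecomposition K R
  /-- `𝓡 = 𝓐 ⊗̂ H ⊗̂ 𝓑` as Banach spaces, through multiplication -/
  decomposition : ∃ e : CompletedTensor K (CompletedTensor K (completionIn tri.A) tri.H)
        (completionIn tri.B) ≃L[K] 𝓡,
      ∀ (a : completionIn tri.A) (h : tri.H) (b : completionIn tri.B),
        e (CompletedTensor.tmul K (CompletedTensor.tmul K a h) b) = (a : 𝓡) * ((h : R) : 𝓡) * b
  A_weights : HasSemisimpleWeightDecomposition (adOnCompletion tri tri.A_homogeneous)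
  B_weights : HasSemisimpleWeightDecomposition (adOnCompletion tri tri.B_homogeneous)
  /-- `𝓐^ws = A` -/
  A_weightSum : (weightSum (adOnCompletion tri tri.A_homogeneous)).map
    (completionIn tri.A).toSubmodule.subtype = (tri.A.map R.val).toSubmodule
  /-- `𝓑^ws = B` -/
  B_weightSum : (weightSum (adOnCompletion tri tri.B_homogeneous)).map
    (completionIn tri.B).toSubmodule.subtype = (tri.B.map R.val).toSubmodule

namespace BanachTriangularDecomposition

variable {K 𝓡 : Type*} [NontriviallyNormedField K] [NormedRing 𝓡] [NormedAlgebra K 𝓡]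
  (τ : BanachTriangularDecomposition K 𝓡)

/-- The Banach algebra `𝓐`. -/
abbrev 𝓐 : Subalgebra K 𝓡 := completionIn τ.tri.A

/-- The Banach algebra `𝓑`. -/
abbrev 𝓑 : Subalgebra K 𝓡 := completionIn τ.tri.B

/-- The grading element `∂`, as an element of `𝓡`. -/
def del : 𝓡 := (τ.tri.del : 𝓡)

/-- The Banach algebra `𝓑H`, as the subalgebra of `𝓡` generated by `𝓑` and `H`. -/
def 𝓑H : Subalgebra K 𝓡 := τ.𝓑 ⊔ τ.tri.H.map τ.R.val

/-- The two-sided ideal `𝓑H^{>0}` of `𝓑H` generated by `BH^{>0}`. -/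
def 𝓑HPos : Ideal τ.𝓑H :=
  (TwoSidedIdeal.span {x : τ.𝓑H | ∃ b ∈ τ.tri.BPos, ∃ h ∈ τ.tri.H, (x : 𝓡) = b * h}).asIdeal

instance : τ.𝓑HPos.IsTwoSided := by unfold 𝓑HPos; infer_instance

/-- The inclusion `H → 𝓑H`. -/
def HTo𝓑H : τ.tri.H →ₐ[K] τ.𝓑H :=
  (τ.R.val.comp τ.tri.H.val).codRestrict τ.𝓑H fun h =>
    (le_sup_right : τ.tri.H.map τ.R.val ≤ τ.𝓑H) ⟨(h : τ.R), h.2, rfl⟩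

/-- The algebra map `H → 𝓑H → 𝓑H / 𝓑H^{>0}`. -/
def HToQuot : τ.tri.H →+* (τ.𝓑H ⧸ τ.𝓑HPos) :=
  (Ideal.Quotient.mk τ.𝓑HPos).comp τ.HTo𝓑H.toRingHom

variable (W : Type*) [NormedAddCommGroup W] [NormedSpace K W] [Module τ.tri.H W]

/-- The `𝓑H`-module `𝓑H / 𝓑H^{>0} ⊗̂_H W`. -/
abbrev Inflation : Type _ := CompletedRelTensor K τ.𝓑H W τ.HToQuot

/-- The analytic Verma module `Δ̂(W) = 𝓡 ⊗̂_{𝓑H} (𝓑H / 𝓑H^{>0} ⊗̂_H W)`. -/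
abbrev Verma : Type _ := CompletedRelTensor K 𝓡 (τ.Inflation W) τ.𝓑H.val.toRingHom

variable {W}

/-- The element `1 ⊗ (1 ⊗ w)` of `Δ̂(W)`. -/
def vermaGen (w : W) : τ.Verma W :=
  CompletedRelTensor.tmul K 𝓡 τ.𝓑H.val.toRingHom 1
    (CompletedRelTensor.tmul K τ.𝓑H τ.HToQuot 1 w)

end BanachTriangularDecomposition

end

noncomputable section

open Filter Topology

/-! ## Ultrametricity of tensor products, quotients and completions -/

section Ultrametric

variable {K : Type*} [NontriviallyNormedField K]

/-! Since A_0 = B_0 = K, the weight-zero coordinates of 𝓐 and 𝓑 are continuous functionals ε_A and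
ε_B, and ν = ε_A ⊗ id ⊗ ε_B is a continuous Harish-Chandra projection 𝓡 → H (`exists_projectionH`).
On BH it is the projection to degree zero, hence multiplicative for degree reasons; by density it is
multiplicative on 𝓑H. So 𝓑H acts on W through ν, and the maps a h b ↦ ε_B(b) a ⊗ hw descend to an
inverse of 𝓐 ⊗̂ W → Δ̂(W) (`exists_vermaEquiv`).

By Schur's lemma ∂ acts on 1 ⊗ W by a scalar l, so every vector of Δ̂(W) is a convergent sum of
eigenvectors with eigenvalues l + n, n ≥ 0, and the eigenvectors in degree 0 form W. Two facts
control submodules. First, left ideals of a noetherian Banach algebra are closed, by the open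
mapping theorem, and so are submodules of Δ̂(W) (`isClosed_submodule`). Second, the weight
projections P_n are pointwise limits of polynomials in ∂: interpolation polynomials with integer
values stay bounded because integers have norm at most 1 (`exists_weightProjection`). Hence a
submodule contains the weight components of its elements. A nonzero vector of W generates
everything, so every proper submodule lies in {x : P_0(𝓡x) = 0}, which is therefore the unique
maximal one (`le_kernelSubmodule`). The preimage of this submodule in Δ(W) is M(W), by the same
argument, with polynomials in ∂ that are exact on each algebraic vector
(`exists_smul_eq_projection`).

For the base change, fix w₀ ≠ 0 in W. Both modules are cyclic on the class of w₀, and a continuous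
section of r ↦ r w₀ shows that any left ideal of 𝓡 containing the elements of R that annihilate this
class in the analytic quotient contains all elements of 𝓡 that do (`mem_ideal_of_smul_mem`).
Finally, a generalized weight vector of the analytic quotient is the class of a single component P_n
x, which comes from Δ(W) (`range_quotientMap`). -/

instance instIsUltrametricDistProjTensor {V W : Type*} [SeminormedAddCommGroup V]
    [NormedSpace K V] [SeminormedAddCommGroup W] [NormedSpace K W] :
    IsUltrametricDist (V ⊗[K] W) := by
  refine IsUltrametricDist.isUltrametricDist_of_isNonarchimedean_norm fun x y => ?_
  refine le_of_forall_gt_imp_ge_of_dense fun c hc => ?_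
  rw [max_lt_iff] at hc
  obtain ⟨h0, hx⟩ := mem_projBall_of_lt hc.1
  exact projNorm_le h0 (add_mem hx (mem_projBall_of_lt hc.2).2)

instance instIsUltrametricDistQuot {T M : Type*} [Ring T] [SeminormedAddCommGroup M] [Module T M]
    [IsUltrametricDist M] (U : Submodule T M) : IsUltrametricDist (M ⧸ U) := by
  refine IsUltrametricDist.isUltrametricDist_of_isNonarchimedean_norm fun x y => ?_
  refine le_of_forall_pos_le_add fun ε hε => ?_
  obtain ⟨a, rfl, ha⟩ := Submodule.Quotient.norm_mk_lt x hε
  obtain ⟨b, rfl, hb⟩ := Submodule.Quotient.norm_mk_lt y hε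
  calc ‖(Submodule.Quotient.mk (a + b) : M ⧸ U)‖ ≤ ‖a + b‖ := Submodule.Quotient.norm_mk_le _ _
    _ ≤ max ‖a‖ ‖b‖ := IsUltrametricDist.norm_add_le_max a b
    _ ≤ _ := by rw [← max_add_add_right]; exact max_le_max ha.le hb.le

instance instIsUltrametricDistCompletion {M : Type*} [SeminormedAddCommGroup M]
    [IsUltrametricDist M] : IsUltrametricDist (UniformSpace.Completion M) := by
  refine IsUltrametricDist.isUltrametricDist_of_isNonarchimedean_norm fun x y => ?_
  induction x, y using UniformSpace.Completion.induction_on₂ with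
  | hp => exact isClosed_le (by fun_prop) (by fun_prop)
  | ih a b =>
    rw [← UniformSpace.Completion.coe_add]
    simp only [UniformSpace.Completion.norm_coe]
    exact IsUltrametricDist.norm_add_le_max a b

end Ultrametric

/-! ## Mapping out of completed tensor products -/

section Lift

variable {K : Type*} [NontriviallyNormedField K]

theorem exists_completion_extension {M Z : Type*} [SeminormedAddCommGroup M] [NormedSpace K M]
    [NormedAddCommGroup Z] [NormedSpace K Z] [CompleteSpace Z] (f : M →L[K] Z) :
    ∃ g : UniformSpace.Completion M →L[K] Z, ∀ x : M, g x = f x :=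
  ⟨f.extend UniformSpace.Completion.toComplL, fun x =>
    ContinuousLinearMap.extend_eq f UniformSpace.Completion.denseRange_coe
      (UniformSpace.Completion.isUniformInducing_coe M) x⟩

/-- The projective norm is a maximum over the terms of a sum, so a bound on elementary tensors
passes to sums exactly because the target is ultrametric. -/
theorem norm_tensorLift_le {V W Z : Type*} [SeminormedAddCommGroup V] [NormedSpace K V]
    [SeminormedAddCommGroup W] [NormedSpace K W] [SeminormedAddCommGroup Z] [NormedSpace K Z]
    [IsUltrametricDist Z] (β : V →ₗ[K] W →ₗ[K] Z) {C : ℝ} (hC : 0 ≤ C)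
    (h : ∀ v w, ‖β v w‖ ≤ C * (‖v‖ * ‖w‖)) (x : V ⊗[K] W) :
    ‖TensorProduct.lift β x‖ ≤ C * ‖x‖ := by
  have key : ∀ c : ℝ, 0 ≤ c → x ∈ projBall K V W c → ‖TensorProduct.lift β x‖ ≤ C * c := by
    intro c hc hx
    induction hx using AddSubgroup.closure_induction with
    | mem y hy =>
      obtain ⟨v, w, hvw, rfl⟩ := hy
      rw [TensorProduct.lift.tmul]
      exact (h v w).trans (by gcongr)
    | zero => simp; positivity
    | add y z _ _ hy hz =>
      rw [map_add]
      exact (IsUltrametricDist.norm_add_le_max _ _).trans (max_le hy hz)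
    | neg y _ hy => rwa [map_neg, norm_neg]
  -- The infimum defining the norm need not be attained, so the bound is proved for each c > ‖x‖ and
  -- c tends to ‖x‖.
  have hlim : Tendsto (fun c : ℝ => C * c) (𝓝[>] ‖x‖) (𝓝 (C * ‖x‖)) :=
    ((continuous_const.mul continuous_id).tendsto _).mono_left nhdsWithin_le_nhds
  refine ge_of_tendsto hlim (eventually_of_mem self_mem_nhdsWithin fun c hc => ?_)
  obtain ⟨h0, hx⟩ := mem_projBall_of_lt hc
  exact key c h0 hx

namespace CompletedTensor

variable {V W Z : Type*} [SeminormedAddCommGroup V] [NormedSpace K V]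
    [SeminormedAddCommGroup W] [NormedSpace K W] [NormedAddCommGroup Z] [NormedSpace K Z]

instance : IsUltrametricDist (CompletedTensor K V W) :=
  inferInstanceAs (IsUltrametricDist (UniformSpace.Completion (V ⊗[K] W)))

theorem exists_lift [IsUltrametricDist Z] [CompleteSpace Z] (β : V →ₗ[K] W →ₗ[K] Z) {C : ℝ}
    (hC : 0 ≤ C) (h : ∀ v w, ‖β v w‖ ≤ C * (‖v‖ * ‖w‖)) :
    ∃ f : CompletedTensor K V W →L[K] Z, ∀ v w, f (tmul K v w) = β v w := by
  obtain ⟨g, hg⟩ := exists_completion_extension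
    ((TensorProduct.lift β).mkContinuous C (norm_tensorLift_le β hC h))
  exact ⟨g, fun v w => (hg _).trans (by simp)⟩

theorem induction_on {p : CompletedTensor K V W → Prop} (x : CompletedTensor K V W)
    (hp : IsClosed {x | p x}) (h0 : p 0) (ht : ∀ v w, p (tmul K v w))
    (ha : ∀ x y, p x → p y → p (x + y)) : p x := by
  refine UniformSpace.Completion.induction_on (α := V ⊗[K] W) (p := p) x hp fun a => ?_
  induction a using TensorProduct.induction_on with
  | zero => exact h0
  | tmul v w => exact ht v w
  | add y z hy hz =>
    rw [UniformSpace.Completion.coe_add]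
    exact ha _ _ hy hz

theorem hom_ext {f g : CompletedTensor K V W →L[K] Z}
    (h : ∀ v w, f (tmul K v w) = g (tmul K v w)) : f = g := by
  ext x
  refine induction_on x (isClosed_eq f.continuous g.continuous) (by simp) h fun x y hx hy => ?_
  rw [map_add, map_add, hx, hy]

variable (K V W) in
theorem exists_tmul : ∃ t : V →ₗ[K] W →ₗ[K] CompletedTensor K V W, ∀ v w, t v w = tmul K v w :=
  ⟨(TensorProduct.mk K V W).compr₂
    (UniformSpace.Completion.toComplL :
      V ⊗[K] W →L[K] UniformSpace.Completion (V ⊗[K] W)).toLinearMap, fun _ _ => rfl⟩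

theorem norm_tmul_le (v : V) (w : W) : ‖tmul K v w‖ ≤ ‖v‖ * ‖w‖ :=
  (UniformSpace.Completion.norm_coe (v ⊗ₜ[K] w)).trans_le
    (projNorm_le (by positivity) (AddSubgroup.subset_closure ⟨v, w, le_rfl, rfl⟩))

end CompletedTensor

end Lift

section RelativeLift

variable {K : Type*} [Field K]

theorem balancedRelations_le_ker {T S P N Z : Type*} [Ring T] [Ring S] [Ring P]
    [Algebra K P] [Module T P] [SMulCommClass K T P] [IsScalarTower T P P] [AddCommGroup N]
    [Module K N] [Module S N] (f : S →+* P) [AddCommGroup Z] [Module K Z]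
    (β : P →ₗ[K] N →ₗ[K] Z) (h : ∀ p s n, β (p * f s) n = β p (s • n)) {x : P ⊗[K] N}
    (hx : x ∈ balancedRelations K T N f) : TensorProduct.lift β x = 0 := by
  -- The relations span a `T`-submodule while the lift is only `K`-linear; killing all
  -- `T`-translates is the statement that survives the span induction.
  suffices H : ∀ t : T, TensorProduct.lift β (t • x) = 0 by simpa using H 1
  induction hx using Submodule.span_induction with
  | mem x hx =>
    obtain ⟨p, s, n, rfl⟩ := hx
    intro t
    rw [smul_sub, TensorProduct.smul_tmul', TensorProduct.smul_tmul', map_sub,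
      TensorProduct.lift.tmul, TensorProduct.lift.tmul, ← smul_mul_assoc, h, sub_self]
  | zero => simp
  | add x y _ _ hx hy => intro t; rw [smul_add, map_add, hx, hy, add_zero]
  | smul a x _ hx => intro t; rw [smul_smul]; exact hx _

theorem RelTensor.exists_lift {T S P N Z : Type*} [Ring T] [Ring S] [Ring P]
    [Algebra K P] [Module T P] [SMulCommClass K T P] [IsScalarTower T P P] [AddCommGroup N]
    [Module K N] [Module S N] (f : S →+* P) [AddCommGroup Z] [Module K Z] [Module T Z]
    (β : P →ₗ[K] N →ₗ[K] Z) (h : ∀ p s n, β (p * f s) n = β p (s • n))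
    (hT : ∀ (t : T) p n, β (t • p) n = t • β p n) :
    ∃ g : RelTensor K T N f →ₗ[T] Z, ∀ p n, g (RelTensor.tmul K T f p n) = β p n := by
  let g₀ : P ⊗[K] N →ₗ[T] Z :=
    { toFun := TensorProduct.lift β
      map_add' := map_add _
      map_smul' := fun t x => by
        induction x using TensorProduct.induction_on with
        | zero => simp
        | tmul p n => simp [TensorProduct.smul_tmul', hT]
        | add x y hx hy => rw [smul_add, map_add, hx, hy, map_add, smul_add] }
  refine ⟨(balancedRelations K T N f).liftQ g₀ fun x hx => balancedRelations_le_ker f β h hx,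
    fun p n => ?_⟩
  exact TensorProduct.lift.tmul p n

theorem RelTensor.induction_on {T S P N : Type*} [Ring T] [Ring S] [Ring P]
    [Algebra K P] [Module T P] [SMulCommClass K T P] [AddCommGroup N]
    [Module K N] [Module S N] {f : S →+* P} {p : RelTensor K T N f → Prop}
    (x : RelTensor K T N f) (h0 : p 0) (ht : ∀ a n, p (RelTensor.tmul K T f a n))
    (ha : ∀ x y, p x → p y → p (x + y)) : p x := by
  obtain ⟨y, rfl⟩ := Submodule.Quotient.mk_surjective _ x
  induction y using TensorProduct.induction_on with
  | zero => exact h0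
  | tmul v w => exact ht v w
  | add y z hy hz => exact ha _ _ hy hz

section

variable {T S P N : Type*} [Ring T] [Ring S] [Ring P]
    [Algebra K P] [Module T P] [SMulCommClass K T P] [AddCommGroup N]
    [Module K N] [Module S N] {f : S →+* P}

theorem RelTensor.tmul_add (p : P) (m n : N) :
    RelTensor.tmul K T f p (m + n) = RelTensor.tmul K T f p m + RelTensor.tmul K T f p n :=
  congrArg Submodule.Quotient.mk (TensorProduct.tmul_add p m n)

theorem RelTensor.tmul_zero (p : P) : RelTensor.tmul K T f p (0 : N) = 0 :=
  congrArg Submodule.Quotient.mk (TensorProduct.tmul_zero N p)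

theorem RelTensor.smul_tmul (t : T) (p : P) (n : N) :
    t • RelTensor.tmul K T f p n = RelTensor.tmul K T f (t • p) n :=
  rfl

theorem RelTensor.tmul_smul' (c : K) (p : P) (n : N) :
    RelTensor.tmul K T f p (c • n) = RelTensor.tmul K T f (c • p) n :=
  congrArg Submodule.Quotient.mk (by rw [TensorProduct.tmul_smul, TensorProduct.smul_tmul'])

theorem RelTensor.mul_tmul (p : P) (s : S) (n : N) :
    RelTensor.tmul K T f (p * f s) n = RelTensor.tmul K T f p (s • n) :=
  (Submodule.Quotient.eq _).2 (Submodule.subset_span ⟨p, s, n, rfl⟩)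

end

end RelativeLift

section CompletedLift

set_option linter.unusedSectionVars false

variable {K : Type*} [NontriviallyNormedField K]

instance Ideal.Quotient.isScalarTower_self {S : Type*} [Ring S] (I : Ideal S) [I.IsTwoSided] :
    IsScalarTower S (S ⧸ I) (S ⧸ I) where
  smul_assoc s x y := by
    obtain ⟨x, rfl⟩ := Ideal.Quotient.mk_surjective x
    obtain ⟨y, rfl⟩ := Ideal.Quotient.mk_surjective y
    exact congrArg (Ideal.Quotient.mk I) (mul_assoc s x y)

namespace CompletedRelTensor

variable {T S P N Z : Type*}
    [SeminormedRing T] [NormedAlgebra K T] [Ring S] [SeminormedRing P] [NormedAlgebra K P]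
    [Module T P] [SMulCommClass K T P] [IsScalarTower K T P] [IsBoundedSMul T P]
    [SeminormedAddCommGroup N] [NormedSpace K N] [Module S N] (f : S →+* P)
    [NormedAddCommGroup Z] [NormedSpace K Z]

instance : IsUltrametricDist (CompletedRelTensor K T N f) :=
  inferInstanceAs (IsUltrametricDist
    (UniformSpace.Completion ((P ⊗[K] N) ⧸ balancedRelations K T N f)))

theorem exists_lift [IsScalarTower T P P] [IsUltrametricDist Z] [CompleteSpace Z]
    (β : P →ₗ[K] N →ₗ[K] Z) {C : ℝ}
    (hC : 0 ≤ C) (hb : ∀ v w, ‖β v w‖ ≤ C * (‖v‖ * ‖w‖))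
    (h : ∀ p s n, β (p * f s) n = β p (s • n)) :
    ∃ g : CompletedRelTensor K T N f →L[K] Z, ∀ p n, g (tmul K T f p n) = β p n := by
  let g₀ : ((P ⊗[K] N) ⧸ balancedRelations K T N f) →ₗ[K] Z :=
    { toFun := (QuotientAddGroup.lift (balancedRelations K T N f).toAddSubgroup
        (TensorProduct.lift β).toAddMonoidHom fun x hx => balancedRelations_le_ker f β h hx)
      map_add' := map_add _
      map_smul' := fun k x => by
        obtain ⟨x, rfl⟩ := Submodule.Quotient.mk_surjective _ x
        exact map_smul (TensorProduct.lift β) k x }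
  have hg₀ : ∀ x, ‖g₀ x‖ ≤ C * ‖x‖ := fun x => by
    refine le_of_forall_pos_le_add fun ε hε => ?_
    -- A near-optimal representative bounds the value by the quotient norm; C + 1 replaces C in the
    -- denominator because C may be 0.
    obtain ⟨y, hyx, hy⟩ := Submodule.Quotient.norm_mk_lt x
      (show 0 < ε / (C + 1) by positivity)
    calc ‖g₀ x‖ = ‖TensorProduct.lift β y‖ := by rw [← hyx]; rfl
      _ ≤ C * ‖y‖ := norm_tensorLift_le β hC hb y
      _ ≤ C * (‖x‖ + ε / (C + 1)) := by gcongr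
      _ = C * ‖x‖ + ε * (C / (C + 1)) := by ring
      _ ≤ C * ‖x‖ + ε * 1 := by
        gcongr
        rw [div_le_one (by positivity)]
        linarith
      _ = _ := by rw [mul_one]
  obtain ⟨g, hg⟩ := exists_completion_extension
    (K := K) (Z := Z) (M := (P ⊗[K] N) ⧸ balancedRelations K T N f)
    (LinearMap.mkContinuous (E := (P ⊗[K] N) ⧸ balancedRelations K T N f) (σ := RingHom.id K)
      g₀ C hg₀)
  exact ⟨g, fun p n => (hg (Submodule.Quotient.mk (p ⊗ₜ n))).trans
    (TensorProduct.lift.tmul (f' := β) p n)⟩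

variable {f}

theorem induction_on {p : CompletedRelTensor K T N f → Prop} (x : CompletedRelTensor K T N f)
    (hp : IsClosed {x | p x}) (h0 : p 0) (ht : ∀ v w, p (tmul K T f v w))
    (ha : ∀ x y, p x → p y → p (x + y)) : p x := by
  refine UniformSpace.Completion.induction_on
    (α := (P ⊗[K] N) ⧸ balancedRelations K T N f) (p := p) x hp fun a => ?_
  obtain ⟨a, rfl⟩ := Submodule.Quotient.mk_surjective _ a
  induction a using TensorProduct.induction_on with
  | zero => exact h0
  | tmul v w => exact ht v w
  | add y z hy hz =>
    rw [Submodule.Quotient.mk_add, UniformSpace.Completion.coe_add]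
    exact ha _ _ hy hz

theorem smul_tmul (t : T) (p : P) (n : N) : t • tmul K T f p n = tmul K T f (t • p) n :=
  (UniformSpace.Completion.coe_smul (M := T) t
    (Submodule.Quotient.mk (p ⊗ₜ[K] n) : (P ⊗[K] N) ⧸ balancedRelations K T N f)).symm

theorem mul_tmul (p : P) (s : S) (n : N) : tmul K T f (p * f s) n = tmul K T f p (s • n) :=
  congrArg (fun x : (P ⊗[K] N) ⧸ balancedRelations K T N f =>
      (x : UniformSpace.Completion ((P ⊗[K] N) ⧸ balancedRelations K T N f)))
    ((Submodule.Quotient.eq _).2 (Submodule.subset_span ⟨p, s, n, rfl⟩))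

theorem norm_tmul_le (p : P) (n : N) : ‖tmul K T f p n‖ ≤ ‖p‖ * ‖n‖ :=
  (UniformSpace.Completion.norm_coe
    (Submodule.Quotient.mk (p ⊗ₜ[K] n) : (P ⊗[K] N) ⧸ balancedRelations K T N f)).trans_le
    ((Submodule.Quotient.norm_mk_le _ _).trans
      (projNorm_le (by positivity) (AddSubgroup.subset_closure ⟨p, n, le_rfl, rfl⟩)))

theorem norm_smul_le' (t : T) (x : CompletedRelTensor K T N f) : ‖t • x‖ ≤ ‖t‖ * ‖x‖ :=
  norm_smul_le (α := T)
    (β := UniformSpace.Completion ((P ⊗[K] N) ⧸ balancedRelations K T N f)) t x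

variable (K T N f) in
theorem exists_tmul :
    ∃ t : P →ₗ[K] N →ₗ[K] CompletedRelTensor K T N f, ∀ v w, t v w = tmul K T f v w :=
  let q : P ⊗[K] N →ₗ[K] ((P ⊗[K] N) ⧸ balancedRelations K T N f) :=
    { toFun := Submodule.Quotient.mk
      map_add' := fun _ _ => rfl
      map_smul' := fun _ _ => rfl }
  ⟨(TensorProduct.mk K P N).compr₂
    ((UniformSpace.Completion.toComplL (𝕜 := K)
      (E := (P ⊗[K] N) ⧸ balancedRelations K T N f)).toLinearMap.comp q), fun _ _ => rfl⟩

end CompletedRelTensor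

end CompletedLift

end

noncomputable section

open Filter Topology

/-! ## Left ideals of noetherian Banach algebras -/

/-- Surjectivity onto a Banach space survives a small perturbation. The closure J of I is finitely
generated, so S^n → J is onto and has a bounded right inverse by the open mapping theorem. Moving
the generators slightly into I keeps the map onto, and then J ⊆ I. -/
theorem Ideal.isClosed_of_noetherian_banachAlgebra (K : Type*) [NontriviallyNormedField K]
    {S : Type*} [NormedRing S] [NormedAlgebra K S] [CompleteSpace S] [IsNoetherianRing S]
    (I : Ideal S) : IsClosed (I : Set S) := by
  let J : Submodule S S := Submodule.topologicalClosure I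
  have hIJ : I ≤ J := Submodule.le_topologicalClosure I
  let J' : Submodule K S := J.restrictScalars K
  have hJc : IsClosed (J' : Set S) := Submodule.isClosed_topologicalClosure I
  have : CompleteSpace J' := hJc.completeSpace_coe
  obtain ⟨n, x, hx⟩ := Submodule.fg_iff_exists_fin_generating_family.1 (IsNoetherian.noetherian J)
  have hxJ : ∀ i, x i ∈ J := fun i => hx ▸ Submodule.subset_span ⟨i, rfl⟩
  have hmem : ∀ (y : Fin n → S), (∀ i, y i ∈ J) → ∀ c : Fin n → S, ∑ i, c i * y i ∈ J' :=
    fun y hy c => J.sum_mem fun i _ => J.smul_mem (c i) (hy i)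
  let φ : (y : Fin n → S) → (∀ i, y i ∈ J) → ((Fin n → S) →L[K] J') := fun y hy =>
    ContinuousLinearMap.codRestrict
      (∑ i, ((ContinuousLinearMap.mul K S).flip (y i)).comp (ContinuousLinearMap.proj i)) J'
      fun c => by simpa using hmem y hy c
  have hφ : ∀ y hy c, (φ y hy c : S) = ∑ i, c i * y i := fun y hy c => by simp [φ]
  have hsurj : (φ x hxJ : (Fin n → S) →ₗ[K] J').range = ⊤ := by
    rw [LinearMap.range_eq_top]
    rintro ⟨z, hz⟩
    have hz' : z ∈ Submodule.span S (Set.range x) := hx ▸ hz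
    obtain ⟨c, hc⟩ := (Submodule.mem_span_range_iff_exists_fun S).1 hz'
    exact ⟨c, Subtype.ext ((hφ x hxJ c).trans (by simpa using hc))⟩
  let ψ := (φ x hxJ).nonlinearRightInverseOfSurjective hsurj
  have hψ : 0 < ψ.nnnorm := (φ x hxJ).nonlinearRightInverseOfSurjective_nnnorm_pos hsurj
  -- Moving each of the n generators by less than δ changes the map by at most nδ in operator norm,
  -- which must stay below the inverse norm of the right inverse.
  obtain ⟨δ, hδ, hδ'⟩ : ∃ δ : NNReal, 0 < δ ∧ n * δ < ψ.nnnorm⁻¹ := by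
    refine ⟨ψ.nnnorm⁻¹ / (n + 1), by positivity, ?_⟩
    rw [← mul_div_assoc, div_lt_iff₀ (by positivity), mul_comm]
    exact mul_lt_mul_of_pos_left (by exact_mod_cast Nat.lt_succ_self n) (by positivity)
  have happ : ∀ i, ∃ y ∈ I, ‖x i - y‖ < δ := fun i => by
    obtain ⟨y, hy, h⟩ := Metric.mem_closure_iff.1
      (show x i ∈ closure (I : Set S) from hxJ i) δ hδ
    exact ⟨y, hy, by rwa [← dist_eq_norm]⟩
  choose y hyI hy using happ
  have hyJ : ∀ i, y i ∈ J := fun i => hIJ (hyI i)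
  have hlin : ApproximatesLinearOn (φ y hyJ) (φ x hxJ) Set.univ (n * δ) := by
    intro a _ b _
    rw [← (φ y hyJ).map_sub]
    change ‖((φ y hyJ (a - b) - φ x hxJ (a - b) : J') : S)‖ ≤ _
    rw [Submodule.coe_sub, hφ y hyJ, hφ x hxJ, ← Finset.sum_sub_distrib]
    refine (norm_sum_le _ _).trans ?_
    calc ∑ i, ‖(a - b) i * y i - (a - b) i * x i‖ ≤ ∑ _i : Fin n, ‖a - b‖ * δ := by
          refine Finset.sum_le_sum fun i _ => ?_
          rw [← mul_sub]
          refine (norm_mul_le _ _).trans ?_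
          gcongr
          · exact norm_le_pi_norm (a - b) i
          · rw [norm_sub_rev]; exact (hy i).le
      _ = _ := by simp; ring
  refine isClosed_of_closure_subset fun z hz => ?_
  have hc : (0 : ℝ) < (ψ.nnnorm : ℝ)⁻¹ - (n * δ : NNReal) := by
    rw [sub_pos]; exact_mod_cast hδ'
  -- The radius is chosen so that the image of the ball around 0 contains the closed ball of radius
  -- ‖z‖.
  obtain ⟨a, -, ha⟩ := hlin.surjOn_closedBall_of_nonlinearRightInverse ψ
    (ε := ‖z‖ / ((ψ.nnnorm : ℝ)⁻¹ - (n * δ : NNReal))) (b := 0) (by positivity)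
    (Set.subset_univ _) (show (⟨z, hz⟩ : J') ∈ _ by
      rw [map_zero, mem_closedBall_zero_iff, mul_div_cancel₀ _ hc.ne']
      exact le_rfl)
  have : z = ∑ i, a i * y i := by rw [← hφ y hyJ, ha]
  rw [this]
  exact I.sum_mem fun i _ => I.mul_mem_left _ (hyI i)

/-! ## Projections onto weight spaces -/

section WeightProjection

open Polynomial

variable {K : Type*} [NontriviallyNormedField K]

theorem eval_descPochhammer_intCast (k : ℕ) (z : ℤ) :
    (descPochhammer K k).eval (z : K) = k.factorial * (Ring.choose z k : ℤ) := by
  have h := Ring.descPochhammer_eq_factorial_smul_choose z k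
  rw [← Polynomial.eval_eq_smeval] at h
  rw [← descPochhammer_map (Int.castRingHom K), Polynomial.eval_intCast_map, Int.cast_id, h]
  simp

/-- An integer-valued polynomial with value `1` at `m` and `0` at the other natural numbers up to
`m + k`. -/
theorem exists_integerValued_polynomial [CharZero K] (m k : ℕ) :
    ∃ f : K[X], f.eval (m : K) = 1 ∧ (∀ n : ℕ, n ≤ m + k → n ≠ m → f.eval (n : K) = 0) ∧
      ∀ n : ℕ, ∃ z : ℤ, f.eval (n : K) = z := by
  have hm : (m.factorial : K) ≠ 0 := Nat.cast_ne_zero.2 m.factorial_ne_zero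
  have hk : (k.factorial : K) ≠ 0 := Nat.cast_ne_zero.2 k.factorial_ne_zero
  -- This is (-1)^k binom(X, m) binom(X - m - 1, k). The first binomial vanishes for n < m, the
  -- second for m < n ≤ m + k, and binom(-1, k) = (-1)^k normalizes the value at m.
  let f : K[X] := C ((-1) ^ k * (m.factorial : K)⁻¹ * (k.factorial : K)⁻¹) * descPochhammer K m *
    (descPochhammer K k).comp (X - C ((m : K) + 1))
  have hf : ∀ n : ℕ, f.eval (n : K) =
      ((-1) ^ k * (n.choose m : ℤ) * Ring.choose ((n : ℤ) - (m + 1)) k : ℤ) := fun n => by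
    have h1 := eval_descPochhammer_intCast (K := K) m n
    have h2 := eval_descPochhammer_intCast (K := K) k ((n : ℤ) - (m + 1))
    rw [Ring.choose_natCast] at h1
    push_cast at h1 h2
    simp only [f, eval_mul, eval_C, eval_comp, eval_sub, eval_X, h1, h2]
    push_cast
    field_simp
  refine ⟨f, ?_, fun n hn hnm => ?_, fun n => ⟨_, hf n⟩⟩
  · have : Ring.choose (-1 : ℤ) k = (-1) ^ k := by
      have := Ring.choose_neg (1 : ℤ) k
      rw [this, add_sub_cancel_left, Ring.choose_natCast, Nat.choose_self]
      simp [Int.negOnePow_def, Units.smul_def]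
    rw [hf, Nat.choose_self, show (m : ℤ) - (m + 1) = -1 by ring, this]
    push_cast
    rw [mul_one, ← mul_pow]
    simp
  · rw [hf]
    rcases lt_or_gt_of_ne hnm with h | h
    · rw [Nat.choose_eq_zero_of_lt h]; simp
    · obtain ⟨j, rfl⟩ := Nat.exists_eq_add_of_lt h
      rw [show ((m + j + 1 : ℕ) : ℤ) - (m + 1) = (j : ℕ) by push_cast; ring, Ring.choose_natCast,
        Nat.choose_eq_zero_of_lt (show j < k by omega)]
      simp

variable {V : Type*} [NormedAddCommGroup V] [NormedSpace K V]

theorem aeval_apply_of_eigenvector (D : V →L[K] V) {μ : K} {v : V} (h : D v = μ • v) (f : K[X]) :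
    aeval D f v = f.eval μ • v := by
  induction f using Polynomial.induction_on' with
  | add p q hp hq => simp [hp, hq, add_smul]
  | monomial n a =>
    have : ∀ n : ℕ, (D ^ n) v = μ ^ n • v := fun n => by
      induction n with
      | zero => simp
      | succ n ih => rw [pow_succ', mul_apply_eq_comp, ih, map_smul, h, smul_smul,
          ← pow_succ]
    rw [aeval_monomial, mul_apply_eq_comp, this, eval_monomial,
      Algebra.algebraMap_eq_smul_one]
    simp [smul_smul, mul_comm]

theorem aeval_apply_mem (D : V →L[K] V) {N : Submodule K V} (hN : ∀ v ∈ N, D v ∈ N) (f : K[X])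
    {v : V} (hv : v ∈ N) : aeval D f v ∈ N := by
  induction f using Polynomial.induction_on' with
  | add p q hp hq => simpa using N.add_mem hp hq
  | monomial n a =>
    have : ∀ n : ℕ, (D ^ n) v ∈ N := fun n => by
      induction n with
      | zero => simpa
      | succ n ih => rw [pow_succ', mul_apply_eq_comp]; exact hN _ ih
    rw [aeval_monomial, mul_apply_eq_comp, Algebra.algebraMap_eq_smul_one]
    simpa using N.smul_mem a (this n)

/-- If every vector is a convergent sum of eigenvectors with eigenvalues in `l + ℕ`, then the
components are continuous linear functions, and limits of polynomials in the operator. -/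
theorem exists_weightProjection [CharZero K] [IsUltrametricDist K] [CompleteSpace V]
    [IsUltrametricDist V] (D : V →L[K] V) (l : K)
    (hD : ∀ v, ∃ c : ℕ → V, (∀ n : ℕ, D (c n) = (l + n) • c n) ∧ HasSum c v) (m : ℕ) :
    ∃ (P : V →L[K] V) (f : ℕ → K[X]),
      (∀ c v, (∀ n : ℕ, D (c n) = (l + n) • c n) → HasSum c v → P v = c m) ∧
      (∀ v, Tendsto (fun k => aeval D (f k) v) atTop (𝓝 (P v))) := by
  choose g hg1 hg0 hgz using fun k => exists_integerValued_polynomial (K := K) m k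
  let f : ℕ → K[X] := fun k => (g k).comp (X - C l)
  have hfe : ∀ k (n : ℕ), (f k).eval (l + n) = (g k).eval (n : K) := fun k n => by
    simp [f, eval_comp]
  have hlim : ∀ c v, (∀ n : ℕ, D (c n) = (l + n) • c n) → HasSum c v →
      Tendsto (fun k => aeval D (f k) v) atTop (𝓝 (c m)) := by
    intro c v hc hv
    have hsum : ∀ k, HasSum (fun n : ℕ => (g k).eval (n : K) • c n) (aeval D (f k) v) := by
      intro k
      have := (aeval D (f k)).hasSum hv
      simp only [aeval_apply_of_eigenvector D (hc _), hfe] at this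
      exact this
    rw [tendsto_iff_norm_sub_tendsto_zero, Metric.tendsto_atTop]
    intro ε hε
    have hc0 : Tendsto c atTop (𝓝 0) := by
      rw [← Nat.cofinite_eq_atTop]; exact hv.summable.tendsto_cofinite_zero
    obtain ⟨N, hN⟩ := (Metric.tendsto_atTop.1 hc0) (ε / 2) (half_pos hε)
    refine ⟨N, fun k hk => ?_⟩
    -- The terms with n ≤ m + k all vanish, and the others are integer multiples of c n, hence no
    -- larger than c n. So the error is bounded by the tail of a null sequence.
    have h2 : HasSum (fun n : ℕ => (g k).eval (n : K) • c n - if n = m then c m else 0)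
        (aeval D (f k) v - c m) := (hsum k).sub (hasSum_ite_eq m (c m))
    have h3 : ‖aeval D (f k) v - c m‖ ≤ ε / 2 := by
      rw [← h2.tsum_eq]
      refine IsUltrametricDist.norm_tsum_le_of_forall_le_of_nonneg (half_pos hε).le fun n => ?_
      by_cases hnm : n = m
      · subst hnm; simpa [hg1] using (half_pos hε).le
      · rw [if_neg hnm, sub_zero]
        by_cases hn : n ≤ m + k
        · rw [hg0 k n hn hnm]; simpa using (half_pos hε).le
        · obtain ⟨z, hz⟩ := hgz k n
          have h4 := hN n (by omega)
          rw [dist_zero_right] at h4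
          rw [hz, norm_smul]
          calc ‖(z : K)‖ * ‖c n‖ ≤ 1 * ‖c n‖ := by
                gcongr; exact IsUltrametricDist.norm_intCast_le_one K z
            _ ≤ ε / 2 := by rw [one_mul]; exact h4.le
    rw [dist_zero_right, norm_norm]
    linarith
  choose c hc hcs using hD
  have hT : Tendsto (fun k v => aeval D (f k) v) atTop (𝓝 fun v => c v m) :=
    tendsto_pi_nhds.2 fun v => hlim _ v (hc v) (hcs v)
  -- Continuity of the pointwise limit is the Banach–Steinhaus theorem; uniqueness of limits then
  -- makes the components independent of the chosen expansion.
  refine ⟨continuousLinearMapOfTendsto (fun k => aeval D (f k)) hT, f, fun d v hd hv => ?_,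
    fun v => hlim _ v (hc v) (hcs v)⟩
  exact tendsto_nhds_unique (hlim _ v (hc v) (hcs v)) (hlim d v hd hv)

end WeightProjection

/-! ## Simple modules over split semi-simple algebras -/

section SplitSemisimple

variable {K H W : Type*} [Field K] [Ring H] [Algebra K H]

theorem IsSplitSemisimple.finiteDimensional (h : IsSplitSemisimple K H) :
    FiniteDimensional K H := by
  obtain ⟨n, d, ⟨e⟩⟩ := h
  exact Module.Finite.equiv e.symm.toLinearEquiv

variable [AddCommGroup W] [Module K W] [Module H W] [IsScalarTower K H W] [IsSimpleModule H W]

theorem IsSplitSemisimple.finiteDimensional_of_isSimpleModule (h : IsSplitSemisimple K H) :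
    FiniteDimensional K W := by
  have := h.finiteDimensional
  have : Module.Finite H W := inferInstance
  exact Module.Finite.trans H W

/-- Schur's lemma over a field that need not be algebraically closed: splitness supplies an
idempotent x with xHx = Kx. If v = x w₀ ≠ 0, then δ v lies in xHv = Kv, and v generates W. -/
theorem IsSplitSemisimple.exists_eq_smul (h : IsSplitSemisimple K H) (δ : W →ₗ[H] W) :
    ∃ c : K, ∀ w, δ w = c • w := by
  classical
  have : Nontrivial W := IsSimpleModule.nontrivial H W
  obtain ⟨n, d, ⟨e⟩⟩ := h
  let E : (Σ i, Fin (d i)) → ((i : Fin n) → Matrix (Fin (d i)) (Fin (d i)) K) :=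
    fun p => Pi.single p.1 (Matrix.single p.2 p.2 1)
  have hE : ∑ p, E p = 1 := by
    rw [Fintype.sum_sigma]
    ext i a b
    simp only [E, Finset.sum_apply, Matrix.sum_apply, Pi.one_apply]
    rw [Finset.sum_eq_single i]
    · rw [Finset.sum_eq_single a]
      · simp [Matrix.single_apply, Matrix.one_apply]
      · intro x _ hx; simp [hx]
      · simp
    · intro j _ hj; simp [Pi.single_eq_of_ne hj.symm]
    · simp
  obtain ⟨w₀, hw₀⟩ := exists_ne (0 : W)
  -- The diagonal matrix units sum to 1, so they cannot all kill w₀.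
  obtain ⟨p, hp⟩ : ∃ p, e.symm (E p) • w₀ ≠ 0 := by
    by_contra! hcon
    apply hw₀
    rw [← one_smul H w₀, ← map_one e.symm, ← hE, map_sum, Finset.sum_smul]
    exact Finset.sum_eq_zero fun p _ => hcon p
  set x := e.symm (E p) with hx
  have hxx : x * x = x := by
    rw [hx, ← map_mul]; congr 1; simp [E, ← Pi.single_mul]
  have hxh : ∀ y : H, ∃ c : K, x * y * x = c • x := fun y => by
    refine ⟨(e y) p.1 p.2 p.2, e.injective ?_⟩
    rw [map_mul, map_mul, map_smul, hx, e.apply_symm_apply]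
    funext i
    by_cases hi : i = p.1
    · subst hi
      simp [E]
    · simp [E, Pi.single_eq_of_ne hi]
  set v := x • w₀
  have hxv : x • v = v := by rw [smul_smul, hxx]
  obtain ⟨y, hy⟩ := IsSimpleModule.toSpanSingleton_surjective H hp (δ v)
  obtain ⟨c, hc⟩ := hxh y
  have hδv : δ v = c • v := by
    calc δ v = x • δ v := by rw [← map_smul, hxv]
      _ = (x * y * x) • v := by rw [mul_smul, hxv, mul_smul]; congr 1; exact hy.symm
      _ = c • v := by rw [hc, smul_assoc, hxv]
  refine ⟨c, fun w => ?_⟩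
  obtain ⟨z, rfl⟩ := IsSimpleModule.toSpanSingleton_surjective H hp w
  change δ (z • v) = c • z • v
  rw [map_smul, hδv]
  clear_value v
  rw [← algebraMap_smul H c v, ← algebraMap_smul H c (z • v), ← mul_smul, ← mul_smul,
    Algebra.commutes c z]

end SplitSemisimple

/-! ## Unique maximal submodules -/

theorem Submodule.isCoatom_iff_eq {R X : Type*} [Ring R] [AddCommGroup X] [Module R X]
    {M : Submodule R X} (hM : M ≠ ⊤) (h : ∀ N : Submodule R X, N ≠ ⊤ → N ≤ M)
    (N : Submodule R X) : IsCoatom N ↔ N = M := by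
  have hc : IsCoatom M := ⟨hM, fun N hN => by_contra fun hN' => (h N hN').not_gt hN⟩
  refine ⟨fun hN => ?_, fun hN => hN ▸ hc⟩
  exact (hN.le_iff.1 (h N hN.1)).resolve_left hM |>.symm

end

/-! ### Algebraic triangular decompositions and Verma modules. -/

noncomputable section

open Filter Topology

namespace TriangularDecomposition

variable {K R : Type*} [Field K] [Ring R] [Algebra K R] (τ : TriangularDecomposition K R)

/-- The projection of `R` onto its component of degree `n`. -/
def proj (n : ℤ) : R →ₗ[K] R := GradedAlgebra.proj τ.grading n

lemma proj_same {n : ℤ} {x : R} (hx : x ∈ τ.grading n) : τ.proj n x = x := by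
  classical
  exact DirectSum.decompose_of_mem_same τ.grading hx

lemma proj_ne {m n : ℤ} {x : R} (hx : x ∈ τ.grading m) (h : m ≠ n) : τ.proj n x = 0 := by
  classical
  exact DirectSum.decompose_of_mem_ne τ.grading hx h

lemma mul_mem_grading {m n : ℤ} {x y : R} (hx : x ∈ τ.grading m) (hy : y ∈ τ.grading n) :
    x * y ∈ τ.grading (m + n) :=
  SetLike.mul_mem_graded hx hy

/-- Two nonpositive degrees add up to zero only if both are zero. -/
lemma proj_zero_mul {m n : ℤ} {x y : R} (hx : x ∈ τ.grading m) (hy : y ∈ τ.grading n)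
    (hm : m ≤ 0) (hn : n ≤ 0) : τ.proj 0 (x * y) = τ.proj 0 x * τ.proj 0 y := by
  have hxy := τ.mul_mem_grading hx hy
  rcases hm.eq_or_lt with rfl | hm
  · rw [τ.proj_same hx]
    rcases hn.eq_or_lt with rfl | hn
    · rw [τ.proj_same hy]
      exact τ.proj_same (by simpa using hxy)
    · rw [τ.proj_ne hy hn.ne, mul_zero, τ.proj_ne hxy (by omega)]
  · rw [τ.proj_ne hx hm.ne, zero_mul, τ.proj_ne hxy (by omega)]

lemma homogeneous_induction {S : Subalgebra K R} (hS : S.toSubmodule.IsHomogeneous τ.grading)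
    {p : R → Prop} (h0 : p 0) (ha : ∀ x y, p x → p y → p (x + y))
    (h : ∀ n, ∀ x ∈ S, x ∈ τ.grading n → p x) {x : R} (hx : x ∈ S) : p x := by
  classical
  rw [← DirectSum.sum_support_decompose τ.grading x]
  exact Finset.sum_induction _ p ha h0 fun n _ =>
    h n _ (hS n hx) (DirectSum.decompose τ.grading x n).2

lemma eq_smul_one_of_mem_grading_zero {S : Subalgebra K R}
    (h1 : S.toSubmodule ⊓ τ.grading 0 = 1) {x : R} (hx : x ∈ S) (h : x ∈ τ.grading 0) :
    ∃ c : K, x = c • 1 := by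
  have : x ∈ (1 : Submodule K R) := h1 ▸ ⟨hx, h⟩
  obtain ⟨c, rfl⟩ := Submodule.mem_one.1 this
  exact ⟨c, Algebra.algebraMap_eq_smul_one c⟩

lemma eq_zero_of_mem_A {n : ℤ} {x : R} (hx : x ∈ τ.A) (h : x ∈ τ.grading n) (hn : n < 0) :
    x = 0 := by
  have : x ∈ τ.A.toSubmodule ⊓ τ.grading n := ⟨hx, h⟩
  rwa [τ.A_nonneg n hn, Submodule.mem_bot] at this

lemma eq_zero_of_mem_B {n : ℤ} {x : R} (hx : x ∈ τ.B) (h : x ∈ τ.grading n) (hn : 0 < n) :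
    x = 0 := by
  have : x ∈ τ.B.toSubmodule ⊓ τ.grading n := ⟨hx, h⟩
  rwa [τ.B_nonpos n hn, Submodule.mem_bot] at this

/-- Induction along the decompositions `R = AH ⊕ AHB^{>0}` and `A = ⨁ A_n`. -/
theorem induction_on {p : R → Prop} (x : R) (h0 : p 0) (hadd : ∀ x y, p x → p y → p (x + y))
    (hAH : ∀ n, ∀ a ∈ τ.A, a ∈ τ.grading n → ∀ h ∈ τ.H, p (a * h))
    (hAHB : ∀ m, ∀ a ∈ τ.A, a ∈ τ.grading m → ∀ h ∈ τ.H, ∀ n < 0, ∀ b ∈ τ.B, b ∈ τ.grading n →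
      p (a * h * b)) : p x := by
  have key : ∀ a ∈ τ.A, ∀ h ∈ τ.H, ∀ b ∈ τ.B, p (a * h * b) := by
    intro a ha h hh b hb
    refine τ.homogeneous_induction (p := fun a => p (a * h * b)) τ.A_homogeneous (by simpa)
      (fun x y hx hy => by rw [add_mul, add_mul]; exact hadd _ _ hx hy) (fun m a ha ham => ?_) ha
    refine τ.homogeneous_induction (p := fun b => p (a * h * b)) τ.B_homogeneous (by simpa)
      (fun x y hx hy => by rw [mul_add]; exact hadd _ _ hx hy) (fun n b hb hbn => ?_) hb
    rcases lt_trichotomy n 0 with hn | rfl | hn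
    · exact hAHB m a ha ham h hh n hn b hb hbn
    · obtain ⟨c, rfl⟩ := τ.eq_smul_one_of_mem_grading_zero τ.B_zero hb hbn
      rw [mul_smul_comm, mul_one, ← mul_smul_comm]
      exact hAH m a ha ham _ (τ.H.smul_mem hh c)
    · rw [τ.eq_zero_of_mem_B hb hbn hn, mul_zero]; exact h0
  obtain ⟨e, he⟩ := τ.decomposition
  obtain ⟨y, rfl⟩ := e.surjective x
  induction y using TensorProduct.induction_on with
  | zero => rwa [e.map_zero]
  | add x y hx hy => rw [e.map_add]; exact hadd _ _ hx hy
  | tmul z b =>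
    induction z using TensorProduct.induction_on with
    | zero => rwa [TensorProduct.zero_tmul, e.map_zero]
    | add x y hx hy => rw [TensorProduct.add_tmul, e.map_add]; exact hadd _ _ hx hy
    | tmul a h => rw [he]; exact key a a.2 h h.2 b b.2

lemma H_le_BH : τ.H ≤ τ.BH := le_sup_right

lemma HToQuot_apply (h : τ.H) :
    τ.HToQuot h = Ideal.Quotient.mk τ.BHPos (⟨h, τ.H_le_BH h.2⟩ : τ.BH) := rfl

/-- Because BH = HB as subspaces, HB·HB = HH·BB = HB, so HB is already a subalgebra, and it contains
both generators. -/
lemma BH_toSubmodule_le : τ.BH.toSubmodule ≤ τ.H.toSubmodule * τ.B.toSubmodule := by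
  let S : Subalgebra K R := (τ.H.toSubmodule * τ.B.toSubmodule).toSubalgebra
    (by simpa using Submodule.mul_mem_mul (show (1 : R) ∈ τ.H.toSubmodule from τ.H.one_mem)
          (show (1 : R) ∈ τ.B.toSubmodule from τ.B.one_mem)) fun x y hx hy => by
      have h : τ.H.toSubmodule * τ.B.toSubmodule * (τ.H.toSubmodule * τ.B.toSubmodule) =
          τ.H.toSubmodule * τ.B.toSubmodule := by
        calc _ = τ.H.toSubmodule * (τ.B.toSubmodule * τ.H.toSubmodule) * τ.B.toSubmodule := by
              simp only [mul_assoc]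
          _ = (τ.H.toSubmodule * τ.H.toSubmodule) * (τ.B.toSubmodule * τ.B.toSubmodule) := by
              rw [τ.B_mul_H]; simp only [mul_assoc]
          _ = _ := by rw [τ.H.isIdempotentElem_toSubmodule, τ.B.isIdempotentElem_toSubmodule]
      exact h ▸ Submodule.mul_mem_mul hx hy
  have h1H : (1 : R) ∈ τ.H.toSubmodule := τ.H.one_mem
  have h1B : (1 : R) ∈ τ.B.toSubmodule := τ.B.one_mem
  have hS : τ.BH ≤ S := sup_le
    (fun b hb => show b ∈ τ.H.toSubmodule * τ.B.toSubmodule from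
      one_mul b ▸ Submodule.mul_mem_mul h1H hb)
    (fun h hh => show h ∈ τ.H.toSubmodule * τ.B.toSubmodule from
      mul_one h ▸ Submodule.mul_mem_mul hh h1B)
  exact fun x hx => hS hx

/-- Induction along the decomposition `BH = H ⊕ HB^{>0}`. -/
theorem BH_induction {p : R → Prop} (hadd : ∀ x y, p x → p y → p (x + y))
    (hH : ∀ h ∈ τ.H, p h)
    (hHB : ∀ h ∈ τ.H, ∀ n < 0, ∀ b ∈ τ.B, b ∈ τ.grading n → p (h * b)) {x : R}
    (hx : x ∈ τ.BH) : p x := by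
  have h0 : p 0 := hH 0 (zero_mem _)
  refine Submodule.mul_induction_on (τ.BH_toSubmodule_le hx) (fun h hh b hb => ?_) hadd
  refine τ.homogeneous_induction (p := fun b => p (h * b)) τ.B_homogeneous (by simpa)
      (fun x y hx hy => by rw [mul_add]; exact hadd _ _ hx hy) (fun n b hb hbn => ?_) hb
  rcases lt_trichotomy n 0 with hn | rfl | hn
  · exact hHB h hh n hn b hb hbn
  · obtain ⟨c, rfl⟩ := τ.eq_smul_one_of_mem_grading_zero τ.B_zero hb hbn
    rw [mul_smul_comm, mul_one]
    exact hH _ (τ.H.smul_mem hh c)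
  · rw [τ.eq_zero_of_mem_B hb hbn hn, mul_zero]; exact h0

/-- BH lives in nonpositive degrees. This is the algebraic source of the multiplicativity of the
Harish-Chandra projection. -/
theorem proj_zero_mul_of_mem_BH {x y : R} (hx : x ∈ τ.BH) (hy : y ∈ τ.BH) :
    τ.proj 0 (x * y) = τ.proj 0 x * τ.proj 0 y := by
  have hHB : ∀ h ∈ τ.H, ∀ n < 0, ∀ b ∈ τ.B, b ∈ τ.grading n → h * b ∈ τ.grading n :=
    fun h hh n _ b _ hbn => by simpa using τ.mul_mem_grading (τ.H_le hh) hbn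
  refine τ.BH_induction (p := fun x => τ.proj 0 (x * y) = τ.proj 0 x * τ.proj 0 y)
    (fun u v hu hv => by simp only [add_mul, map_add, hu, hv]) (fun h hh => ?_)
    (fun h hh n hn b hb hbn => ?_) hx
  · refine τ.BH_induction (p := fun y => τ.proj 0 (h * y) = τ.proj 0 h * τ.proj 0 y)
      (fun u v hu hv => by simp only [mul_add, map_add, hu, hv]) (fun h' hh' => ?_)
      (fun h' hh' n' hn' b' hb' hbn' => ?_) hy
    · exact τ.proj_zero_mul (τ.H_le hh) (τ.H_le hh') le_rfl le_rfl
    · exact τ.proj_zero_mul (τ.H_le hh) (hHB h' hh' n' hn' b' hb' hbn') le_rfl hn'.le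
  · refine τ.BH_induction (p := fun y => τ.proj 0 (h * b * y) = τ.proj 0 (h * b) * τ.proj 0 y)
      (fun u v hu hv => by simp only [mul_add, map_add, hu, hv]) (fun h' hh' => ?_)
      (fun h' hh' n' hn' b' hb' hbn' => ?_) hy
    · exact τ.proj_zero_mul (hHB h hh n hn b hb hbn) (τ.H_le hh') hn.le le_rfl
    · exact τ.proj_zero_mul (hHB h hh n hn b hb hbn) (hHB h' hh' n' hn' b' hb' hbn') hn.le hn'.le

section Verma

variable {W : Type*} [AddCommGroup W] [Module K W] [Module τ.H W]

/-- A homomorphism from the Verma module is given by a homomorphism of `H`-modules with values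
in the vectors annihilated by `B^{>0}`. -/
theorem exists_vermaLift [IsScalarTower K τ.H W] {X : Type*} [AddCommGroup X] [Module K X]
    [Module R X]
    [IsScalarTower K R X] (g : W →ₗ[K] X) (hH : ∀ (h : τ.H) w, (h : R) • g w = g (h • w))
    (hB : ∀ b ∈ τ.BPos, ∀ w, b • g w = 0) :
    ∃ F : τ.Verma W →ₗ[R] X, ∀ w, F (τ.vermaGen w) = g w := by
  -- Stability of g(W) under BH makes its annihilator in BH closed under right multiplication as
  -- well, hence a two-sided ideal; it contains the generators of `BHPos`.
  have hstab : ∀ s ∈ τ.BH, ∀ w, ∃ w', s • g w = g w' := fun s hs w =>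
    τ.BH_induction (p := fun s => ∃ w', s • g w = g w')
      (fun x y ⟨u, hu⟩ ⟨v, hv⟩ => ⟨u + v, by rw [add_smul, hu, hv, map_add]⟩)
      (fun h hh => ⟨_, hH ⟨h, hh⟩ w⟩)
      (fun h hh n hn b hb hbn => ⟨0, by rw [mul_smul, hB b ⟨hb, n, hn, hbn⟩, smul_zero, map_zero]⟩)
      hs
  have hann : ∀ s ∈ τ.BHPos, ∀ w, (s : R) • g w = 0 := by
    let J : TwoSidedIdeal τ.BH := TwoSidedIdeal.mk' {s | ∀ w, (s : R) • g w = 0}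
      (fun w => by simp) (fun {x y} hx hy w => by simp [add_smul, hx w, hy w])
      (fun {x} hx w => by simp [hx w])
      (fun {x y} hy w => by simp [mul_smul, hy w])
      (fun {x y} hx w => by
        obtain ⟨w', hw'⟩ := hstab y y.2 w
        simp [mul_smul, hw', hx w'])
    have hJ : TwoSidedIdeal.span {x : τ.BH | ∃ b ∈ τ.BPos, ∃ h ∈ τ.H, (x : R) = b * h} ≤ J := by
      rw [TwoSidedIdeal.span_le]
      rintro x ⟨b, hb, h, hh, hx⟩
      rw [SetLike.mem_coe, TwoSidedIdeal.mem_mk']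
      intro w
      rw [hx, mul_smul, hH ⟨h, hh⟩ w, hB b hb]
    intro s hs w
    have := hJ (TwoSidedIdeal.mem_asIdeal.1 hs)
    rw [TwoSidedIdeal.mem_mk'] at this
    exact this w
  let β₀ : τ.BH →ₗ[K] W →ₗ[K] X :=
    LinearMap.mk₂ K (fun s w => (s : R) • g w) (fun s t w => by simp [add_smul])
      (fun c s w => by simp) (fun s v w => by simp)
      (fun c s w => by rw [map_smul, smul_comm])
  let β : (τ.BH ⧸ τ.BHPos) →ₗ[K] W →ₗ[K] X :=
    (τ.BHPos.restrictScalars K).liftQ β₀ fun s hs => LinearMap.ext fun w => hann s hs w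
  have hβ : ∀ (s : τ.BH) w, β (Ideal.Quotient.mk τ.BHPos s) w = (s : R) • g w := fun s w => rfl
  have hsm : ∀ (s : τ.BH) (x : X), s • x = (s : R) • x := fun _ _ => rfl
  -- The map is first extended `BH`-linearly to the inflation of W, and then by extension of scalars
  -- to R.
  obtain ⟨F₁, hF₁⟩ := RelTensor.exists_lift (T := τ.BH) τ.HToQuot β
    (fun q h w => by
      obtain ⟨s, rfl⟩ := Ideal.Quotient.mk_surjective q
      rw [HToQuot_apply, ← map_mul, hβ, hβ, ← hH, ← mul_smul]
      rfl)
    (fun t q w => by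
      obtain ⟨s, rfl⟩ := Ideal.Quotient.mk_surjective q
      have : t • Ideal.Quotient.mk τ.BHPos s = Ideal.Quotient.mk τ.BHPos (t * s) := rfl
      rw [this, hβ, hβ, hsm]
      exact mul_smul (t : R) (s : R) (g w))
  let β₂ : R →ₗ[K] τ.Inflation W →ₗ[K] X :=
    LinearMap.mk₂ K (fun r n => r • F₁ n) (fun s t w => by simp [add_smul])
      (fun c s w => by simp) (fun s v w => by simp)
      (fun c s n => by
        have : F₁ (c • n) = c • F₁ n := by
          rw [← algebraMap_smul τ.BH c n, map_smul, hsm]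
          exact algebraMap_smul R c (F₁ n)
        rw [this, smul_comm])
  obtain ⟨F, hF⟩ := RelTensor.exists_lift (T := R) τ.BH.val.toRingHom β₂
    (fun r s n => by
      change (r * (s : R)) • F₁ n = r • F₁ (s • n)
      rw [map_smul, hsm, mul_smul])
    (fun t p n => by change (t • p) • F₁ n = t • p • F₁ n; rw [smul_eq_mul, mul_smul])
  refine ⟨F, fun w => ?_⟩
  refine (hF _ _).trans ?_
  change (1 : R) • F₁ (RelTensor.tmul K τ.BH τ.HToQuot 1 w) = g w
  rw [one_smul, hF₁]
  exact (hβ 1 w).trans (one_smul _ _)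

lemma smul_inflation_gen (s : τ.BH) (w : W) :
    s • RelTensor.tmul K τ.BH τ.HToQuot 1 w =
      RelTensor.tmul K τ.BH τ.HToQuot (Ideal.Quotient.mk τ.BHPos s) w := by
  rw [RelTensor.smul_tmul]
  congr 1
  exact congrArg (Ideal.Quotient.mk τ.BHPos) (mul_one s)

lemma smul_vermaGen (s : τ.BH) (w : W) :
    (s : R) • τ.vermaGen w = RelTensor.tmul K R τ.BH.val.toRingHom 1
      (RelTensor.tmul K τ.BH τ.HToQuot (Ideal.Quotient.mk τ.BHPos s) w) := by
  rw [vermaGen, RelTensor.smul_tmul, ← smul_inflation_gen, ← RelTensor.mul_tmul]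
  congr 1
  simp

lemma H_smul_vermaGen (h : τ.H) (w : W) : (h : R) • τ.vermaGen w = τ.vermaGen (h • w) := by
  refine (τ.smul_vermaGen ⟨h, τ.H_le_BH h.2⟩ w).trans ?_
  rw [vermaGen, ← RelTensor.mul_tmul, one_mul, HToQuot_apply]

/-- The Verma module is generated by the image of `W`. -/
lemma verma_induction {p : τ.Verma W → Prop} (x : τ.Verma W) (h0 : p 0)
    (ha : ∀ x y, p x → p y → p (x + y)) (h : ∀ (r : R) w, p (r • τ.vermaGen w)) : p x := by
  refine RelTensor.induction_on x h0 (fun r n => ?_) ha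
  refine RelTensor.induction_on (p := fun n => p (RelTensor.tmul K R τ.BH.val.toRingHom r n)) n
    (by rw [RelTensor.tmul_zero]; exact h0) (fun q w => ?_)
    (fun x y hx hy => by rw [RelTensor.tmul_add]; exact ha _ _ hx hy)
  obtain ⟨s, rfl⟩ := Ideal.Quotient.mk_surjective q
  have := h (r * s) w
  rw [mul_smul, smul_vermaGen, RelTensor.smul_tmul, smul_eq_mul, mul_one] at this
  exact this

end Verma

end TriangularDecomposition

end

/-! ### Homogeneous expansions, augmentations, and maps out of 𝓡. -/

noncomputable section

open Filter Topology

lemma TriangularDecomposition.proj_commutator {K R : Type*} [Field K] [Ring R] [Algebra K R]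
    (τ : TriangularDecomposition K R) (n : ℤ) (x : R) :
    τ.proj n (τ.del * x - x * τ.del) = n • τ.proj n x := by
  classical
  induction x using DirectSum.Decomposition.inductionOn τ.grading with
  | zero => simp
  | @homogeneous m x =>
    rw [(τ.mem_grading_iff m x).1 x.2, map_zsmul]
    by_cases h : m = n
    · subst h; rfl
    · rw [τ.proj_ne x.2 h, smul_zero, smul_zero]
  | add x y hx hy =>
    rw [map_add, smul_add, ← hx, ← hy, ← map_add]
    congr 1
    noncomm_ring

section Expansion

variable {K 𝓡 : Type*} [NontriviallyNormedField K] [NormedRing 𝓡] [NormedAlgebra K 𝓡]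
  {R : Subalgebra K 𝓡} (τ : TriangularDecomposition K R) {S : Subalgebra K R}
  (hS : S.toSubmodule.IsHomogeneous τ.grading)

instance [IsUltrametricDist 𝓡] (S : Subalgebra K 𝓡) : IsUltrametricDist S :=
  ⟨fun x y z => dist_triangle_max (x : 𝓡) y z⟩

instance [CompleteSpace 𝓡] : CompleteSpace (completionIn S) :=
  (Subalgebra.isClosed_topologicalClosure (S.map R.val)).completeSpace_coe

/-- The operator `ad ∂` on the completion of a homogeneous subalgebra, as a continuous map. -/
def adCLM : completionIn S →L[K] completionIn S where
  toLinearMap := adOnCompletion τ hS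
  cont := Continuous.subtype_mk
    (show Continuous fun x : completionIn S => (τ.del : 𝓡) * x - x * τ.del by fun_prop) _

lemma coe_adOnCompletion (x : completionIn S) :
    (adOnCompletion τ hS x : 𝓡) = (τ.del : 𝓡) * x - x * τ.del := rfl

lemma coe_mem_completionIn {a : R} (ha : a ∈ S) : (a : 𝓡) ∈ completionIn S :=
  Subalgebra.le_topologicalClosure _ ⟨a, ha, rfl⟩

lemma adCLM_apply_of_mem_grading {n : ℤ} {x : completionIn S} {a : R} (ha : a ∈ τ.grading n)
    (hx : (x : 𝓡) = a) : adCLM τ hS x = (n : K) • x := by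
  refine Subtype.ext ?_
  have h := congrArg (Subtype.val : R → 𝓡) ((τ.mem_grading_iff n a).1 ha)
  change (τ.del : 𝓡) * x - x * τ.del = (n : K) • (x : 𝓡)
  rw [hx, Int.cast_smul_eq_zsmul]
  exact h

variable {hS} in
-- The weight vectors of the completion lie in S by `hws`, and on S the eigenvalues of ad ∂ are
-- degrees. So the weights in I are integers, and the weight expansion is an expansion into
-- homogeneous elements.
theorem exists_homogeneous_expansion [CharZero K]
    (hw : HasSemisimpleWeightDecomposition (adOnCompletion τ hS))
    (hws : (weightSum (adOnCompletion τ hS)).map (completionIn S).toSubmodule.subtype =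
      (S.map R.val).toSubmodule) (x : completionIn S) :
    ∃ c : ℤ → completionIn S, (∀ n, ∃ a ∈ S, a ∈ τ.grading n ∧ (c n : 𝓡) = a) ∧ HasSum c x := by
  obtain ⟨I, hI, hdec, hss⟩ := hw
  have hmem : ∀ l, ∀ v ∈ (adOnCompletion τ hS).maxGenEigenspace l, ∃ a ∈ S, (v : 𝓡) = a := by
    intro l v hv
    have : (v : 𝓡) ∈ (S.map R.val).toSubmodule := hws ▸
      ⟨v, (le_iSup (fun l : K => (adOnCompletion τ hS).maxGenEigenspace l) l) hv, rfl⟩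
    obtain ⟨a, ha, hav⟩ := this
    exact ⟨a, ha, hav.symm⟩
  have heig : ∀ l ∈ I, ∀ v ∈ (adOnCompletion τ hS).maxGenEigenspace l, ∀ a : R, (v : 𝓡) = a →
      τ.del * a - a * τ.del = l • a := by
    intro l hl v hv a hva
    have := congrArg Subtype.val (hss l hl v hv)
    rw [coe_adOnCompletion, hva] at this
    refine Subtype.ext ((by simpa using this : (τ.del : 𝓡) * a - a * τ.del = l • (v : 𝓡)).trans ?_)
    rw [hva]; rfl
  -- A nonzero weight vector in S has a nonzero component of some degree n; applying ad ∂ multiplies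
  -- this component both by l and by n.
  have hint : ∀ l : I, ∃ n : ℤ, (n : K) = l := by
    rintro ⟨l, hl⟩
    obtain ⟨v, hv, hv0⟩ := Submodule.exists_mem_ne_zero_of_ne_bot (hI hl)
    obtain ⟨a, -, hva⟩ := hmem l v hv
    have ha0 : a ≠ 0 := by
      rintro rfl
      exact hv0 (Subtype.ext hva)
    obtain ⟨n, hn⟩ : ∃ n, τ.proj n a ≠ 0 := by
      classical
      by_contra! h
      apply ha0
      rw [← DirectSum.sum_support_decompose τ.grading a]
      exact Finset.sum_eq_zero fun n _ => h n
    refine ⟨n, ?_⟩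
    have h := τ.proj_commutator n a
    rw [heig l hl v hv a hva, map_smul, ← Int.cast_smul_eq_zsmul K n, ← sub_eq_zero, ← sub_smul,
      smul_eq_zero] at h
    exact (sub_eq_zero.1 (h.resolve_right hn)).symm
  choose N hN using hint
  have hinj : Function.Injective N := fun l l' h => Subtype.ext (by rw [← hN, ← hN, h])
  obtain ⟨c, hc, hcx⟩ := hdec x
  -- The family is reindexed by degree, with zero in the degrees that do not occur among the chosen
  -- weights.
  refine ⟨Function.extend N c 0, fun n => ?_, ?_⟩
  · by_cases hn : ∃ l, N l = n
    · obtain ⟨l, rfl⟩ := hn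
      rw [hinj.extend_apply]
      obtain ⟨a, ha, hca⟩ := hmem l _ (hc l)
      refine ⟨a, ha, ?_, hca⟩
      rw [τ.mem_grading_iff, heig l l.2 _ (hc l) a hca, ← hN, Int.cast_smul_eq_zsmul]
    · rw [Function.extend_apply' _ _ _ hn]
      exact ⟨0, zero_mem _, zero_mem _, rfl⟩
  · refine (hinj.hasSum_iff (f := Function.extend N c 0) fun n hn =>
      Function.extend_apply' _ _ _ hn).1 ?_
    rwa [Function.extend_comp hinj]

end Expansion

/-- The projection to weight 0 takes values in the line through u, so its coordinate along u is a
continuous functional. -/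
theorem exists_weightFunctional {K : Type*} [NontriviallyNormedField K] [IsUltrametricDist K]
    [CompleteSpace K] [CharZero K] {V : Type*} [NormedAddCommGroup V] [NormedSpace K V]
    [CompleteSpace V] [IsUltrametricDist V] (D : V →L[K] V) {u : V} (hu : u ≠ 0) (hDu : D u = 0)
    (hD : ∀ v, ∃ c : ℕ → V, (∀ n : ℕ, D (c n) = (n : K) • c n) ∧ HasSum c v ∧
      c 0 ∈ Submodule.span K {u}) :
    ∃ ε : V →L[K] K, ε u = 1 ∧ ∀ n : ℕ, n ≠ 0 → ∀ v, D v = (n : K) • v → ε v = 0 := by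
  obtain ⟨P, -, hP, -⟩ := exists_weightProjection D 0 (fun v => by
    obtain ⟨c, hc, hcv, -⟩ := hD v
    exact ⟨c, fun n => by rw [zero_add, hc], hcv⟩) 0
  simp only [zero_add] at hP
  have hPmem : ∀ v, P v ∈ Submodule.span K {u} := fun v => by
    obtain ⟨c, hc, hcv, hc0⟩ := hD v
    rwa [hP c v hc hcv]
  have hsingle : ∀ (n : ℕ) v, D v = (n : K) • v → P v = (Pi.single n v : ℕ → V) 0 :=
    fun n v hv => hP _ v (fun m => by
      by_cases h : m = n
      · subst h; simpa using hv
      · simp [Pi.single_eq_of_ne h]) (hasSum_pi_single n v)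
  let φ : Submodule.span K {u} →L[K] K :=
    (LinearEquiv.coord K V u hu).toLinearMap.toContinuousLinearMap
  refine ⟨φ.comp (P.codRestrict _ hPmem), ?_, fun n hn v hv => ?_⟩
  · have h := hsingle 0 u (by simpa using hDu)
    rw [Pi.single_eq_same] at h
    have : P.codRestrict _ hPmem u = ⟨u, Submodule.mem_span_singleton_self u⟩ := Subtype.ext h
    rw [ContinuousLinearMap.comp_apply, this]
    exact LinearEquiv.coord_self K V u hu
  · have h := hsingle n v hv
    rw [Pi.single_eq_of_ne hn.symm] at h
    have : P.codRestrict _ hPmem v = 0 := Subtype.ext h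
    rw [ContinuousLinearMap.comp_apply, this, map_zero]

namespace BanachTriangularDecomposition

variable {K 𝓡 : Type*} [NontriviallyNormedField K] [NormedRing 𝓡] [NormedAlgebra K 𝓡]
  (τ : BanachTriangularDecomposition K 𝓡)

/-- Indexing by ℕ instead of ℤ is the form that the interpolation in `exists_weightProjection`
requires; the discarded terms vanish because A has no negative degrees. -/
theorem exists_expansion_A [CharZero K] (x : τ.𝓐) :
    ∃ c : ℕ → τ.𝓐, (∀ n : ℕ, ∃ a ∈ τ.tri.A, a ∈ τ.tri.grading n ∧ (c n : 𝓡) = a) ∧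
      HasSum c x := by
  obtain ⟨c, hc, hx⟩ := exists_homogeneous_expansion τ.tri τ.A_weights τ.A_weightSum x
  refine ⟨fun n => c n, fun n => hc n, ?_⟩
  refine (Function.Injective.hasSum_iff (g := ((↑) : ℕ → ℤ)) Nat.cast_injective
    fun n hn => ?_).2 hx
  obtain ⟨a, ha, han, hca⟩ := hc n
  have : a = 0 := τ.tri.eq_zero_of_mem_A ha han (by
    by_contra! h
    exact hn ⟨n.toNat, Int.toNat_of_nonneg h⟩)
  exact Subtype.ext (by rw [hca, this]; rfl)

theorem exists_expansion_B [CharZero K] (x : τ.𝓑) :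
    ∃ c : ℕ → τ.𝓑, (∀ n : ℕ, ∃ b ∈ τ.tri.B, b ∈ τ.tri.grading (-n) ∧ (c n : 𝓡) = b) ∧
      HasSum c x := by
  obtain ⟨c, hc, hx⟩ := exists_homogeneous_expansion τ.tri τ.B_weights τ.B_weightSum x
  refine ⟨fun n => c (-n), fun n => hc _, ?_⟩
  refine (Function.Injective.hasSum_iff (g := fun n : ℕ => -(n : ℤ))
    (fun m n h => by simpa using h) fun n hn => ?_).2 hx
  obtain ⟨b, hb, hbn, hcb⟩ := hc n
  have : b = 0 := τ.tri.eq_zero_of_mem_B hb hbn (by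
    by_contra! h
    exact hn ⟨(-n).toNat, by simp [Int.toNat_of_nonneg (neg_nonneg.2 h)]⟩)
  exact Subtype.ext (by rw [hcb, this]; rfl)

section Augmentation

variable [IsUltrametricDist K] [CompleteSpace K] [CharZero K] [IsUltrametricDist 𝓡]
  [CompleteSpace 𝓡] [Nontrivial 𝓡]

theorem exists_augmentation_A : ∃ ε : τ.𝓐 →L[K] K, ε 1 = 1 ∧
    ∀ n : ℤ, n ≠ 0 → ∀ a ∈ τ.tri.A, a ∈ τ.tri.grading n → ∀ x : τ.𝓐, (x : 𝓡) = a → ε x = 0 := by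
  have h1 : (1 : τ.R) ∈ τ.tri.grading 0 := SetLike.one_mem_graded _
  obtain ⟨ε, h, hε⟩ := exists_weightFunctional (adCLM τ.tri τ.tri.A_homogeneous)
    (u := (1 : τ.𝓐)) one_ne_zero
    (by rw [adCLM_apply_of_mem_grading τ.tri _ h1 rfl]; simp) fun v => by
      obtain ⟨c, hc, hcv⟩ := τ.exists_expansion_A v
      refine ⟨c, fun n => ?_, hcv, ?_⟩
      · obtain ⟨a, ha, han, hca⟩ := hc n
        rw [adCLM_apply_of_mem_grading τ.tri _ han hca, Int.cast_natCast]
      · obtain ⟨a, ha, han, hca⟩ := hc 0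
        obtain ⟨k, rfl⟩ := τ.tri.eq_smul_one_of_mem_grading_zero τ.tri.A_zero ha han
        exact Submodule.mem_span_singleton.2 ⟨k, Subtype.ext hca.symm⟩
  refine ⟨ε, h, fun n hn a ha han x hx => ?_⟩
  rcases lt_or_gt_of_ne hn with hn' | hn'
  · have : x = 0 := Subtype.ext (by rw [hx, τ.tri.eq_zero_of_mem_A ha han hn']; rfl)
    rw [this, map_zero]
  · refine hε n.toNat (by omega) x ?_
    rw [adCLM_apply_of_mem_grading τ.tri _ han hx, ← Int.cast_natCast,
      Int.toNat_of_nonneg hn'.le]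

theorem exists_augmentation_B : ∃ ε : τ.𝓑 →L[K] K, ε 1 = 1 ∧
    ∀ n : ℤ, n ≠ 0 → ∀ b ∈ τ.tri.B, b ∈ τ.tri.grading n → ∀ x : τ.𝓑, (x : 𝓡) = b → ε x = 0 := by
  have h1 : (1 : τ.R) ∈ τ.tri.grading 0 := SetLike.one_mem_graded _
  -- The sign turns the nonpositive degrees of B into weights in ℕ.
  obtain ⟨ε, h, hε⟩ := exists_weightFunctional (-adCLM τ.tri τ.tri.B_homogeneous)
    (u := (1 : τ.𝓑)) one_ne_zero
    (by rw [neg_apply, adCLM_apply_of_mem_grading τ.tri _ h1 rfl]; simp)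
    fun v => by
      obtain ⟨c, hc, hcv⟩ := τ.exists_expansion_B v
      refine ⟨c, fun n => ?_, hcv, ?_⟩
      · obtain ⟨a, ha, han, hca⟩ := hc n
        rw [neg_apply, adCLM_apply_of_mem_grading τ.tri _ han hca]
        simp
      · obtain ⟨a, ha, han, hca⟩ := hc 0
        obtain ⟨k, rfl⟩ := τ.tri.eq_smul_one_of_mem_grading_zero τ.tri.B_zero ha
          (by simpa using han)
        exact Submodule.mem_span_singleton.2 ⟨k, Subtype.ext hca.symm⟩
  refine ⟨ε, h, fun n hn a ha han x hx => ?_⟩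
  rcases lt_or_gt_of_ne hn with hn' | hn'
  · refine hε (-n).toNat (by omega) x ?_
    rw [neg_apply, adCLM_apply_of_mem_grading τ.tri _ han hx,
      ← Int.cast_natCast, Int.toNat_of_nonneg (by omega)]
    simp
  · have : x = 0 := Subtype.ext (by rw [hx, τ.tri.eq_zero_of_mem_B ha han hn']; rfl)
    rw [this, map_zero]

end Augmentation

/-- The Banach space isomorphism 𝓐 ⊗̂ H ⊗̂ 𝓑 ≅ 𝓡 allows a bounded map on 𝓡 to be prescribed on
products a h b. Both ν and the inverse of the Verma isomorphism are built in this way. -/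
theorem exists_decompositionLift (ε : τ.𝓑 →L[K] K) {Z : Type*} [NormedAddCommGroup Z]
    [NormedSpace K Z] [IsUltrametricDist Z] [CompleteSpace Z] (μ : τ.𝓐 →ₗ[K] τ.tri.H →ₗ[K] Z)
    {C : ℝ} (hC : 0 ≤ C) (hμ : ∀ a h, ‖μ a h‖ ≤ C * (‖a‖ * ‖h‖)) :
    ∃ Ψ : 𝓡 →L[K] Z, ∀ (a : τ.𝓐) (h : τ.tri.H) (b : τ.𝓑),
      Ψ ((a : 𝓡) * ((h : τ.R) : 𝓡) * b) = ε b • μ a h := by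
  obtain ⟨e, he⟩ := τ.decomposition
  obtain ⟨f, hf⟩ := CompletedTensor.exists_lift (K := K) (V := τ.𝓐) (W := τ.tri.H) (Z := Z) μ hC hμ
  obtain ⟨g, hg⟩ := CompletedTensor.exists_lift
    (LinearMap.mk₂ K (fun (x : CompletedTensor K τ.𝓐 τ.tri.H) (b : τ.𝓑) => ε b • f x)
      (fun _ _ _ => by simp) (fun _ _ _ => by rw [map_smul, smul_comm]) (fun _ _ _ => by simp [add_smul])
      (fun _ _ _ => by simp [mul_smul])) (C := ‖ε‖ * ‖f‖) (by positivity) (fun x b => by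
        rw [LinearMap.mk₂_apply, norm_smul]
        calc ‖ε b‖ * ‖f x‖ ≤ (‖ε‖ * ‖b‖) * (‖f‖ * ‖x‖) := by
              gcongr
              · exact ε.le_opNorm b
              · exact f.le_opNorm x
          _ = _ := by ring)
  refine ⟨g.comp (e.symm : 𝓡 →L[K] _), fun a h b => ?_⟩
  rw [← he]
  simp [hg, hf]

end BanachTriangularDecomposition

end

/-! ### The Harish-Chandra projection and the generators of the analytic Verma module. -/

noncomputable section

open Filter Topology

namespace CompletedRelTensor

variable {K : Type*} [NontriviallyNormedField K] {T S P N : Type*}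
    [SeminormedRing T] [NormedAlgebra K T] [Ring S] [SeminormedRing P] [NormedAlgebra K P]
    [Module T P] [SMulCommClass K T P] [IsScalarTower K T P] [IsBoundedSMul T P]
    [SeminormedAddCommGroup N] [NormedSpace K N] [Module S N] {f : S →+* P}

instance : IsBoundedSMul T (CompletedRelTensor K T N f) := .of_norm_smul_le norm_smul_le'

theorem exists_tmulCLM (p : P) :
    ∃ t : N →L[K] CompletedRelTensor K T N f, ∀ n, t n = tmul K T f p n := by
  obtain ⟨t, ht⟩ := exists_tmul K T N f
  exact ⟨(t p).mkContinuous ‖p‖ fun n => by rw [ht]; exact norm_tmul_le p n, fun n => ht p n⟩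

theorem zero_tmul (n : N) : tmul K T f (0 : P) n = 0 := by
  obtain ⟨t, ht⟩ := exists_tmul K T N f
  rw [← ht, map_zero, LinearMap.zero_apply]

theorem map_smul_of_tmul {Z : Type*} [NormedAddCommGroup Z] [NormedSpace K Z]
    (g : CompletedRelTensor K T N f →L[K] Z) (ℓ : Z →L[K] Z) (t : T)
    (h : ∀ p n, g (tmul K T f (t • p) n) = ℓ (g (tmul K T f p n)))
    (x : CompletedRelTensor K T N f) : g (t • x) = ℓ (g x) := by
  refine induction_on (p := fun x => g (t • x) = ℓ (g x)) x
    (isClosed_eq (g.continuous.comp (continuous_const_smul t)) (ℓ.continuous.comp g.continuous))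
    (by simp) (fun p n => by rw [smul_tmul, h])
    (fun x y hx hy => by rw [smul_add, map_add, hx, hy, map_add, map_add])

/-- Equivariance is phrased with operators `ℓ t` instead of a `T`-module structure on `Z`, since in
the application `Z = W` carries an action of 𝓑H only through ν. -/
theorem exists_lift_map_smul {Z : Type*} [NormedAddCommGroup Z] [NormedSpace K Z]
    [IsScalarTower T P P] [IsUltrametricDist Z] [CompleteSpace Z] (f : S →+* P)
    (β : P →ₗ[K] N →ₗ[K] Z) {C : ℝ} (hC : 0 ≤ C) (hb : ∀ v w, ‖β v w‖ ≤ C * (‖v‖ * ‖w‖))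
    (h : ∀ p s n, β (p * f s) n = β p (s • n)) (ℓ : T → Z →L[K] Z)
    (hℓ : ∀ t p n, β (t • p) n = ℓ t (β p n)) :
    ∃ g : CompletedRelTensor K T N f →L[K] Z, (∀ p n, g (tmul K T f p n) = β p n) ∧
      ∀ t x, g (t • x) = ℓ t (g x) := by
  obtain ⟨g, hg⟩ := exists_lift (T := T) f β hC hb h
  exact ⟨g, hg, fun t => map_smul_of_tmul g (ℓ t) t fun p n => by rw [hg, hg, hℓ]⟩

end CompletedRelTensor

namespace BanachTriangularDecomposition

variable {K 𝓡 : Type*} [NontriviallyNormedField K] [NormedRing 𝓡] [NormedAlgebra K 𝓡]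
  (τ : BanachTriangularDecomposition K 𝓡)

section Instances

variable (W : Type*) [NormedAddCommGroup W] [NormedSpace K W] [Module τ.tri.H W]

@[reducible] def inflationNormedAddCommGroup : NormedAddCommGroup (τ.Inflation W) := inferInstance
@[reducible] def inflationNormedSpace : NormedSpace K (τ.Inflation W) := inferInstance
@[reducible] def inflationModule : Module τ.𝓑H (τ.Inflation W) := inferInstance
@[reducible] def inflationSMul : SMul τ.𝓑H (τ.Inflation W) := inferInstance
@[reducible] def vermaNormedAddCommGroup : NormedAddCommGroup (τ.Verma W) := inferInstance
@[reducible] def vermaNormedSpace : NormedSpace K (τ.Verma W) := inferInstance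
@[reducible] def vermaModule : Module 𝓡 (τ.Verma W) := inferInstance
@[reducible] def vermaSMul : SMul 𝓡 (τ.Verma W) := inferInstance
@[reducible] def quotientSMul : SMul τ.𝓑H (τ.𝓑H ⧸ τ.𝓑HPos) := inferInstance

end Instances

/-- The normed space structure whose underlying module is the one of the subalgebra `H`. -/
@[reducible] def normedSpaceH : NormedSpace K τ.tri.H where
  norm_smul_le c h := norm_smul_le c ((h : τ.R) : 𝓡)

attribute [local instance] inflationNormedAddCommGroup inflationNormedSpace inflationModule
  inflationSMul vermaNormedAddCommGroup vermaNormedSpace vermaModule vermaSMul quotientSMul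
  normedSpaceH

lemma dense_induction {p : 𝓡 → Prop} (hp : IsClosed {r | p r}) (h : ∀ r : τ.R, p r) (r : 𝓡) :
    p r :=
  (hp.closure_subset_iff.2 fun x hx => h ⟨x, hx⟩ : closure (τ.R : Set 𝓡) ⊆ {r | p r})
    (τ.dense r)

/-- The closure of BH is a subalgebra containing 𝓑 and H, hence 𝓑H. Closed conditions on 𝓑H can thus
be tested on BH, without knowing whether 𝓑H itself is closed. -/
lemma 𝓑H_induction {p : 𝓡 → Prop} (hp : IsClosed {r | p r}) (h : ∀ r ∈ τ.tri.BH, p (r : τ.R))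
    {s : 𝓡} (hs : s ∈ τ.𝓑H) : p s := by
  have hle : τ.𝓑H ≤ (τ.tri.BH.map τ.R.val).topologicalClosure := by
    refine sup_le (Subalgebra.topologicalClosure_mono
      (Subalgebra.map_mono (le_sup_left : τ.tri.B ≤ τ.tri.BH))) ?_
    exact (Subalgebra.map_mono τ.tri.H_le_BH).trans (Subalgebra.le_topologicalClosure _)
  refine (hp.closure_subset_iff.2 ?_ : closure (τ.tri.BH.map τ.R.val : Set 𝓡) ⊆ {r | p r})
    (hle hs)
  rintro _ ⟨r, hr, rfl⟩
  exact h r hr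

lemma coe_mem_𝓑H {r : τ.R} (hr : r ∈ τ.tri.BH) : (r : 𝓡) ∈ τ.𝓑H := by
  have hle : τ.tri.BH.map τ.R.val ≤ τ.𝓑H := by
    rw [TriangularDecomposition.BH, Algebra.map_sup]
    exact sup_le_sup_right (Subalgebra.le_topologicalClosure _) _
  exact hle ⟨r, hr, rfl⟩

section Projection

variable [IsUltrametricDist K] [CompleteSpace K] [CharZero K] [IsUltrametricDist 𝓡]
  [CompleteSpace 𝓡] [Nontrivial 𝓡]

/-- The Harish-Chandra projection `𝓡 → H`, which is multiplicative on `𝓑H`. -/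
theorem exists_projectionH : ∃ ν : 𝓡 →L[K] τ.tri.H, (∀ h : τ.tri.H, ν ((h : τ.R) : 𝓡) = h) ∧
    (∀ b ∈ τ.tri.BPos, ν (b : 𝓡) = 0) ∧
    ∀ s ∈ τ.𝓑H, ∀ t ∈ τ.𝓑H, ν (s * t) = ν s * ν t := by
  have := τ.tri.H_split.finiteDimensional
  have : CompleteSpace τ.tri.H := FiniteDimensional.complete K _
  obtain ⟨εA, hA1, -⟩ := τ.exists_augmentation_A
  obtain ⟨εB, hB1, hB⟩ := τ.exists_augmentation_B
  -- The map is a h b ↦ ε_A(a) ε_B(b) h.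
  obtain ⟨ν, hν⟩ := τ.exists_decompositionLift εB
    (LinearMap.mk₂ K (fun a (h : τ.tri.H) => εA a • h) (fun _ _ _ => by simp [add_smul])
      (fun _ _ _ => by simp [mul_smul]) (fun _ _ _ => by simp)
      (fun c x b => by rw [smul_comm])) (C := ‖εA‖) (norm_nonneg εA) (fun a h => by
        rw [LinearMap.mk₂_apply, ← mul_assoc]
        exact (norm_smul_le _ _).trans (by gcongr; exact εA.le_opNorm a))
  simp only [LinearMap.mk₂_apply] at hν
  have h1 : ∀ h : τ.tri.H, ν ((h : τ.R) : 𝓡) = h := fun h => by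
    have := hν 1 h 1
    simpa [hA1, hB1] using this
  have h2 : ∀ (h : τ.tri.H), ∀ b ∈ τ.tri.BPos, ν (((h : τ.R) : 𝓡) * (b : 𝓡)) = 0 := by
    rintro h b ⟨hb, n, hn, hbn⟩
    have := hν 1 h ⟨b, coe_mem_completionIn hb⟩
    rw [hB n hn.ne b hb hbn _ rfl] at this
    simpa using this
  -- On BH the analytic map is the projection to degree zero, whose multiplicativity is known;
  -- continuity in each variable separately then carries it to 𝓑H.
  have h3 : ∀ r ∈ τ.tri.BH, ((ν (r : 𝓡) : τ.tri.H) : τ.R) = τ.tri.proj 0 r := by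
    intro r hr
    refine τ.tri.BH_induction (p := fun r => ((ν (r : 𝓡) : τ.tri.H) : τ.R) = τ.tri.proj 0 r)
      (fun x y hx hy => ?_) (fun h hh => ?_) (fun h hh n hn b hb hbn => ?_) hr
    · rw [map_add, ← hx, ← hy, Subalgebra.coe_add, map_add, Subalgebra.coe_add]
    · rw [h1 ⟨h, hh⟩, τ.tri.proj_same (τ.tri.H_le hh)]
    · have := h2 ⟨h, hh⟩ b ⟨hb, n, hn, hbn⟩
      rw [Subalgebra.coe_mul, this,
        τ.tri.proj_ne (τ.tri.mul_mem_grading (τ.tri.H_le hh) hbn) (by omega)]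
      rfl
  have h4 : ∀ r ∈ τ.tri.BH, ∀ t ∈ τ.tri.BH,
      ν ((r : τ.R) * (t : τ.R) : 𝓡) = ν (r : 𝓡) * ν (t : 𝓡) := by
    intro r hr t ht
    refine Subtype.ext ?_
    rw [Subalgebra.coe_mul, h3 r hr, h3 t ht, ← τ.tri.proj_zero_mul_of_mem_BH hr ht,
      ← h3 _ (mul_mem hr ht)]
    rfl
  refine ⟨ν, h1, fun b hb => ?_, fun s hs t ht => ?_⟩
  · simpa using h2 1 b hb
  · refine τ.𝓑H_induction (p := fun s => ν (s * t) = ν s * ν t)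
      (isClosed_eq (ν.continuous.comp (continuous_id.mul continuous_const))
        (ν.continuous.mul continuous_const)) (fun r hr => ?_) hs
    exact τ.𝓑H_induction (p := fun t => ν (r * t) = ν r * ν t)
      (isClosed_eq (ν.continuous.comp (continuous_const.mul continuous_id))
        (continuous_const.mul ν.continuous)) (fun t ht => h4 r hr t ht) ht

end Projection

section Verma

variable {W : Type*} [NormedAddCommGroup W] [NormedSpace K W] [Module τ.tri.H W]

lemma coe_BPos_mem_𝓑HPos {b : τ.R} (hb : b ∈ τ.tri.BPos) :
    (⟨b, τ.coe_mem_𝓑H ((le_sup_left : τ.tri.B ≤ τ.tri.BH) hb.1)⟩ : τ.𝓑H) ∈ τ.𝓑HPos := by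
  rw [𝓑HPos, TwoSidedIdeal.mem_asIdeal]
  exact TwoSidedIdeal.subset_span ⟨b, hb, 1, τ.tri.H.one_mem, by simp⟩

lemma HToQuot_apply (h : τ.tri.H) :
    τ.HToQuot h = Ideal.Quotient.mk τ.𝓑HPos
      (⟨(h : τ.R), τ.coe_mem_𝓑H (τ.tri.H_le_BH h.2)⟩ : τ.𝓑H) := rfl

lemma smul_inflation_gen (s : τ.𝓑H) (w : W) :
    s • CompletedRelTensor.tmul K τ.𝓑H τ.HToQuot 1 w =
      CompletedRelTensor.tmul K τ.𝓑H τ.HToQuot (Ideal.Quotient.mk τ.𝓑HPos s) w := by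
  rw [CompletedRelTensor.smul_tmul]
  congr 1
  exact congrArg (Ideal.Quotient.mk τ.𝓑HPos) (mul_one s)

lemma smul_vermaGen (r : 𝓡) (s : τ.𝓑H) (w : W) :
    (r * (s : 𝓡)) • τ.vermaGen w = CompletedRelTensor.tmul K 𝓡 τ.𝓑H.val.toRingHom r
      (CompletedRelTensor.tmul K τ.𝓑H τ.HToQuot (Ideal.Quotient.mk τ.𝓑HPos s) w) := by
  rw [vermaGen, CompletedRelTensor.smul_tmul, ← smul_inflation_gen,
    ← CompletedRelTensor.mul_tmul]
  congr 1
  simp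

lemma smul_vermaGen' (r : 𝓡) (w : W) :
    r • τ.vermaGen w = CompletedRelTensor.tmul K 𝓡 τ.𝓑H.val.toRingHom r
      (CompletedRelTensor.tmul K τ.𝓑H τ.HToQuot 1 w) := by
  rw [vermaGen, CompletedRelTensor.smul_tmul, smul_eq_mul, mul_one]

lemma H_smul_vermaGen (h : τ.tri.H) (w : W) :
    ((h : τ.R) : 𝓡) • τ.vermaGen w = τ.vermaGen (h • w) := by
  have := τ.smul_vermaGen 1 ⟨(h : τ.R), τ.coe_mem_𝓑H (τ.tri.H_le_BH h.2)⟩ w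
  rw [one_mul] at this
  refine this.trans ?_
  rw [vermaGen, ← CompletedRelTensor.mul_tmul, one_mul, HToQuot_apply]

lemma BPos_smul_vermaGen {b : τ.R} (hb : b ∈ τ.tri.BPos) (w : W) :
    (b : 𝓡) • τ.vermaGen w = 0 := by
  have := τ.smul_vermaGen 1 ⟨b, τ.coe_mem_𝓑H ((le_sup_left : τ.tri.B ≤ τ.tri.BH) hb.1)⟩ w
  rw [one_mul] at this
  refine this.trans ?_
  rw [Ideal.Quotient.eq_zero_iff_mem.2 (τ.coe_BPos_mem_𝓑HPos hb), CompletedRelTensor.zero_tmul]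
  obtain ⟨t, ht⟩ := CompletedRelTensor.exists_tmulCLM (K := K) (T := 𝓡) (N := τ.Inflation W)
    (f := τ.𝓑H.val.toRingHom) 1
  rw [← ht, map_zero]

variable (W) in
/-- The linear map `w ↦ 1 ⊗ (1 ⊗ w)` to the analytic Verma module. -/
theorem exists_vermaGenCLM : ∃ g : W →L[K] τ.Verma W, ∀ w, g w = τ.vermaGen w := by
  obtain ⟨t, ht⟩ := CompletedRelTensor.exists_tmulCLM (K := K) (T := 𝓡) (N := τ.Inflation W)
    (f := τ.𝓑H.val.toRingHom) 1
  obtain ⟨u, hu⟩ := CompletedRelTensor.exists_tmulCLM (K := K) (T := τ.𝓑H) (N := W)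
    (f := τ.HToQuot) 1
  exact ⟨t.comp u, fun w => by rw [ContinuousLinearMap.comp_apply, ht, hu]; rfl⟩

theorem verma_induction {p : τ.Verma W → Prop} (x : τ.Verma W) (hp : IsClosed {x | p x})
    (h0 : p 0) (ha : ∀ x y, p x → p y → p (x + y)) (h : ∀ (r : 𝓡) (w : W), p (r • τ.vermaGen w)) :
    p x := by
  refine CompletedRelTensor.induction_on x hp h0 (fun r n => ?_) ha
  obtain ⟨t, ht⟩ := CompletedRelTensor.exists_tmulCLM (K := K) (T := 𝓡) (N := τ.Inflation W)
    (f := τ.𝓑H.val.toRingHom) r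
  rw [← ht]
  refine CompletedRelTensor.induction_on (p := fun n => p (t n)) n (hp.preimage t.continuous)
    (by rwa [map_zero]) (fun q w => ?_) (fun x y hx hy => by rw [map_add]; exact ha _ _ hx hy)
  obtain ⟨s, rfl⟩ := Ideal.Quotient.mk_surjective q
  rw [ht, ← smul_vermaGen]
  exact h _ w

end Verma

/-! ### The action of 𝓑H on W through ν. -/

section Action

variable {W : Type*} [NormedAddCommGroup W] [NormedSpace K W] [Module τ.tri.H W]
  [IsScalarTower K τ.tri.H W] [FiniteDimensional K W] [CompleteSpace K]

variable (W) in
theorem exists_actionCLM : ∃ L : τ.tri.H →L[K] W →L[K] W, ∀ h w, L h w = h • w := by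
  have := τ.tri.H_split.finiteDimensional
  let L₀ : τ.tri.H →ₗ[K] W →L[K] W :=
    (LinearMap.toContinuousLinearMap : (W →ₗ[K] W) ≃ₗ[K] (W →L[K] W)).toLinearMap.comp
      (Algebra.lsmul K K W).toLinearMap
  exact ⟨LinearMap.toContinuousLinearMap L₀, fun h w => rfl⟩

omit [IsScalarTower K τ.tri.H W] [FiniteDimensional K W] [CompleteSpace K] in
-- Multiplicativity makes the kernel of ν on 𝓑H a two-sided ideal, so only the generators bh need to
-- be tested.
lemma apply_eq_zero_of_mem_𝓑HPos {ν : 𝓡 →L[K] τ.tri.H}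
    (hB : ∀ b ∈ τ.tri.BPos, ν (b : 𝓡) = 0)
    (hν : ∀ s ∈ τ.𝓑H, ∀ t ∈ τ.𝓑H, ν (s * t) = ν s * ν t) {s : τ.𝓑H} (hs : s ∈ τ.𝓑HPos) :
    ν s = 0 := by
  let J : TwoSidedIdeal τ.𝓑H := TwoSidedIdeal.mk' {s | ν s = 0}
    (by simp) (fun {x y} hx hy => by
      rw [Set.mem_ofPred_eq] at *; rw [Subalgebra.coe_add, map_add, hx, hy, add_zero])
    (fun {x} hx => by rw [Set.mem_ofPred_eq] at *; rw [Subalgebra.coe_neg, map_neg, hx, neg_zero])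
    (fun {x y} hy => by
      rw [Set.mem_ofPred_eq] at *; rw [Subalgebra.coe_mul, hν x x.2 y y.2, hy, mul_zero])
    (fun {x y} hx => by
      rw [Set.mem_ofPred_eq] at *; rw [Subalgebra.coe_mul, hν x x.2 y y.2, hx, zero_mul])
  have hJ : TwoSidedIdeal.span
      {x : τ.𝓑H | ∃ b ∈ τ.tri.BPos, ∃ h ∈ τ.tri.H, (x : 𝓡) = b * h} ≤ J := by
    rw [TwoSidedIdeal.span_le]
    rintro x ⟨b, hb, h, hh, hx⟩
    rw [SetLike.mem_coe, TwoSidedIdeal.mem_mk', Set.mem_ofPred_eq, hx,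
      hν _ (τ.coe_mem_𝓑H ((le_sup_left : τ.tri.B ≤ τ.tri.BH) hb.1)) _
        (τ.coe_mem_𝓑H (τ.tri.H_le_BH hh)), hB b hb, zero_mul]
  have := hJ (TwoSidedIdeal.mem_asIdeal.1 hs)
  rwa [TwoSidedIdeal.mem_mk'] at this

variable (W) in
theorem exists_quotientAction {ν : 𝓡 →L[K] τ.tri.H}
    (hB : ∀ b ∈ τ.tri.BPos, ν (b : 𝓡) = 0)
    (hν : ∀ s ∈ τ.𝓑H, ∀ t ∈ τ.𝓑H, ν (s * t) = ν s * ν t) :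
    ∃ (β : (τ.𝓑H ⧸ τ.𝓑HPos) →ₗ[K] W →ₗ[K] W) (C : ℝ), 0 ≤ C ∧
      (∀ (s : τ.𝓑H) w, β (Ideal.Quotient.mk τ.𝓑HPos s) w = ν s • w) ∧
      ∀ q w, ‖β q w‖ ≤ C * (‖q‖ * ‖w‖) := by
  obtain ⟨L, hL⟩ := τ.exists_actionCLM W
  let β₀ : τ.𝓑H →ₗ[K] W →ₗ[K] W :=
    LinearMap.mk₂ K (fun s w => ν s • w)
      (fun s t w => by rw [Subalgebra.coe_add, map_add, add_smul])
      (fun c s w => by rw [Subalgebra.coe_smul, map_smul, smul_assoc])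
      (fun s v w => smul_add _ _ _)
      (fun c s w => by rw [smul_comm])
  let β : (τ.𝓑H ⧸ τ.𝓑HPos) →ₗ[K] W →ₗ[K] W :=
    (τ.𝓑HPos.restrictScalars K).liftQ β₀ fun s hs => LinearMap.ext fun w =>
      (congrArg (· • w) (τ.apply_eq_zero_of_mem_𝓑HPos hB hν hs)).trans (zero_smul _ w)
  have hβ : ∀ (s : τ.𝓑H) w, β (Ideal.Quotient.mk τ.𝓑HPos s) w = ν s • w := fun s w => rfl
  refine ⟨β, ‖L‖ * ‖ν‖, by positivity, hβ, fun q w => ?_⟩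
  have hlim : Tendsto (fun δ : ℝ => ‖L‖ * ‖ν‖ * ((‖q‖ + δ) * ‖w‖)) (𝓝[>] 0)
      (𝓝 (‖L‖ * ‖ν‖ * (‖q‖ * ‖w‖))) := by
    have hc : Continuous fun δ : ℝ => ‖L‖ * ‖ν‖ * ((‖q‖ + δ) * ‖w‖) := by fun_prop
    simpa using (hc.tendsto 0).mono_left nhdsWithin_le_nhds
  refine ge_of_tendsto hlim (eventually_of_mem self_mem_nhdsWithin fun δ hδ => ?_)
  -- The quotient norm is an infimum over lifts, so a lift of norm below ‖q‖ + δ is used and δ tends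
  -- to 0.
  obtain ⟨s, hsq, hs⟩ := Submodule.Quotient.norm_mk_lt q hδ
  have hqs : β q w = ν s • w := by rw [← hsq]; exact hβ s w
  calc ‖β q w‖ = ‖L (ν s) w‖ := by rw [hqs, hL]
    _ ≤ ‖L‖ * ‖ν s‖ * ‖w‖ := L.le_opNorm₂ _ _
    _ ≤ ‖L‖ * (‖ν‖ * ‖s‖) * ‖w‖ := by gcongr; exact ν.le_opNorm s
    _ ≤ ‖L‖ * (‖ν‖ * (‖q‖ + δ)) * ‖w‖ := by gcongr
    _ = _ := by ring

variable (W) in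
-- The action of H on W extends to 𝓑H through ν and kills 𝓑H^{>0}, so it induces a retraction of the
-- inflated module onto W. This shows that passing to the completed tensor product loses nothing of
-- W.
theorem exists_inflationProjection [IsUltrametricDist W] {ν : 𝓡 →L[K] τ.tri.H}
    (hH : ∀ h : τ.tri.H, ν ((h : τ.R) : 𝓡) = h) (hB : ∀ b ∈ τ.tri.BPos, ν (b : 𝓡) = 0)
    (hν : ∀ s ∈ τ.𝓑H, ∀ t ∈ τ.𝓑H, ν (s * t) = ν s * ν t) :
    ∃ ρ : τ.Inflation W →L[K] W,
      (∀ w, ρ (CompletedRelTensor.tmul K τ.𝓑H τ.HToQuot 1 w) = w) ∧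
      ∀ (s : τ.𝓑H) n, ρ (s • n) = ν s • ρ n := by
  have : CompleteSpace W := FiniteDimensional.complete K W
  obtain ⟨L, hL⟩ := τ.exists_actionCLM W
  obtain ⟨β, C, hC, hβ, hbound⟩ := τ.exists_quotientAction W hB hν
  have hbal : ∀ (q : τ.𝓑H ⧸ τ.𝓑HPos) (h : τ.tri.H) (w : W),
      β (q * τ.HToQuot h) w = β q (h • w) := fun q h w => by
    obtain ⟨s, rfl⟩ := Ideal.Quotient.mk_surjective q
    rw [HToQuot_apply, ← map_mul, hβ, hβ, Subalgebra.coe_mul,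
      hν _ s.2 _ (τ.coe_mem_𝓑H (τ.tri.H_le_BH h.2)), hH, mul_smul]
  have hsmul : ∀ (s : τ.𝓑H) (q : τ.𝓑H ⧸ τ.𝓑HPos) (w : W),
      β (s • q) w = L (ν s) (β q w) := fun s q w => by
    obtain ⟨t, rfl⟩ := Ideal.Quotient.mk_surjective q
    have : s • Ideal.Quotient.mk τ.𝓑HPos t = Ideal.Quotient.mk τ.𝓑HPos (s * t) := rfl
    rw [this, hβ, hβ, hL, Subalgebra.coe_mul, hν _ s.2 _ t.2, mul_smul]
  obtain ⟨ρ, hρ, hρs⟩ := CompletedRelTensor.exists_lift_map_smul (K := K) (T := τ.𝓑H)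
    (S := τ.tri.H) (P := τ.𝓑H ⧸ τ.𝓑HPos) (N := W) (Z := W) τ.HToQuot β hC hbound hbal
    (fun s => L (ν s)) hsmul
  refine ⟨ρ, fun w => ?_, fun s n => (hρs s n).trans (hL _ _)⟩
  rw [hρ, ← map_one (Ideal.Quotient.mk τ.𝓑HPos), hβ]
  have := hH 1
  simp only [Subalgebra.coe_one] at this ⊢
  rw [this, one_smul]

end Action

end BanachTriangularDecomposition

end

/-! ### The isomorphism of 𝓐 ⊗̂ W with the analytic Verma module. -/

noncomputable section

open Filter Topology

theorem smulCommClass_of_isScalarTower (K 𝓡 X : Type*) [Field K] [Ring 𝓡] [Algebra K 𝓡] [AddCommGroup X]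
    [Module K X] [Module 𝓡 X] [IsScalarTower K 𝓡 X] : SMulCommClass K 𝓡 X :=
  ⟨fun c r x => by
    rw [← algebraMap_smul 𝓡 c (r • x), ← algebraMap_smul 𝓡 c x, smul_smul, smul_smul,
      Algebra.commutes]⟩

theorem CompletedTensor.exists_smul_lift {K 𝓡 W X : Type*} [NontriviallyNormedField K]
    [NormedRing 𝓡] [NormedAlgebra K 𝓡] [NormedAddCommGroup W] [NormedSpace K W]
    [NormedAddCommGroup X] [NormedSpace K X] [IsUltrametricDist X] [CompleteSpace X] [Module 𝓡 X]
    [IsScalarTower K 𝓡 X] [IsBoundedSMul 𝓡 X] (S : Subalgebra K 𝓡) (g : W →L[K] X) :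
    ∃ F : CompletedTensor K S W →L[K] X,
      ∀ (a : S) w, F (CompletedTensor.tmul K a w) = (a : 𝓡) • g w := by
  have := smulCommClass_of_isScalarTower K 𝓡 X
  obtain ⟨F, hF⟩ := CompletedTensor.exists_lift
    (LinearMap.mk₂ K (fun (a : S) w => (a : 𝓡) • g w)
      (fun _ _ _ => by rw [Subalgebra.coe_add, add_smul])
      (fun c a w => by rw [Subalgebra.coe_smul, smul_assoc])
      (fun _ _ _ => by rw [map_add, smul_add])
      (fun c a w => by rw [map_smul, smul_comm])) (C := ‖g‖) (norm_nonneg g) (fun a w => by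
        rw [LinearMap.mk₂_apply]
        calc ‖(a : 𝓡) • g w‖ ≤ ‖(a : 𝓡)‖ * ‖g w‖ := norm_smul_le _ _
          _ ≤ ‖(a : 𝓡)‖ * (‖g‖ * ‖w‖) := by gcongr; exact g.le_opNorm w
          _ = ‖g‖ * (‖(a : 𝓡)‖ * ‖w‖) := by ring)
  exact ⟨F, hF⟩

theorem CompletedRelTensor.exists_lift_of_ringHom {K 𝓡 S N W Z : Type*}
    [NontriviallyNormedField K] [NormedRing 𝓡] [NormedAlgebra K 𝓡] [Ring S]
    [NormedAddCommGroup N] [NormedSpace K N] [Module S N] [NormedAddCommGroup W] [NormedSpace K W]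
    [NormedAddCommGroup Z] [NormedSpace K Z]
    [IsUltrametricDist Z] [CompleteSpace Z] (f : S →+* 𝓡) (ρ : N →L[K] W)
    (Φ : W →L[K] 𝓡 →L[K] Z) (h : ∀ r s n, Φ (ρ n) (r * f s) = Φ (ρ (s • n)) r) :
    ∃ G : CompletedRelTensor K 𝓡 N f →L[K] Z, ∀ r n,
      G (CompletedRelTensor.tmul K 𝓡 f r n) = Φ (ρ n) r := by
  obtain ⟨G, hG⟩ := CompletedRelTensor.exists_lift (K := K) (T := 𝓡) f
    (LinearMap.mk₂ K (fun r n => Φ (ρ n) r) (fun _ _ _ => map_add _ _ _)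
      (fun _ _ _ => map_smul _ _ _) (fun _ _ _ => by simp) (fun _ _ _ => by simp))
    (C := ‖Φ‖ * ‖ρ‖) (by positivity) (fun r n => by
      rw [LinearMap.mk₂_apply]
      calc ‖Φ (ρ n) r‖ ≤ ‖Φ‖ * ‖ρ n‖ * ‖r‖ := Φ.le_opNorm₂ _ _
        _ ≤ ‖Φ‖ * (‖ρ‖ * ‖n‖) * ‖r‖ := by gcongr; exact ρ.le_opNorm n
        _ = _ := by ring) (fun r s n => h r s n)
  exact ⟨G, hG⟩

/-- The given maps need not depend linearly on w. Keeping only those at a basis of W and extending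
linearly preserves the prescribed values, and finite dimension makes the dependence on w continuous.
-/
theorem exists_continuousLinearMap_of_forall {K V W Z I : Type*} [NontriviallyNormedField K]
    [CompleteSpace K] [NormedAddCommGroup V] [NormedSpace K V] [NormedAddCommGroup W]
    [NormedSpace K W] [FiniteDimensional K W] [NormedAddCommGroup Z] [NormedSpace K Z]
    (x : I → V) (ℓ : I → W →ₗ[K] Z) (h : ∀ w, ∃ Ψ : V →L[K] Z, ∀ i, Ψ (x i) = ℓ i w) :
    ∃ Φ : W →L[K] V →L[K] Z, ∀ w i, Φ w (x i) = ℓ i w := by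
  choose Ψ hΨ using h
  let e := Module.finBasis K W
  let Φ₀ : W →ₗ[K] V →L[K] Z := e.constr K fun j => Ψ (e j)
  refine ⟨LinearMap.toContinuousLinearMap Φ₀, fun w i => ?_⟩
  have hlin : (ContinuousLinearMap.apply K Z (x i)).toLinearMap.comp Φ₀ = ℓ i :=
    e.ext fun j => by
      have : Φ₀ (e j) = Ψ (e j) := e.constr_basis K _ j
      simp [this, hΨ]
  exact LinearMap.congr_fun hlin w

namespace BanachTriangularDecomposition

variable {K 𝓡 : Type*} [NontriviallyNormedField K] [NormedRing 𝓡] [NormedAlgebra K 𝓡]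
  (τ : BanachTriangularDecomposition K 𝓡)
  {W : Type*} [NormedAddCommGroup W] [NormedSpace K W] [Module τ.tri.H W]

attribute [local instance] inflationNormedAddCommGroup inflationNormedSpace inflationModule
  inflationSMul vermaNormedAddCommGroup vermaNormedSpace vermaModule vermaSMul quotientSMul
  normedSpaceH

lemma BH_smul_vermaGen {ν : 𝓡 →L[K] τ.tri.H} (hH : ∀ h : τ.tri.H, ν ((h : τ.R) : 𝓡) = h)
    (hB : ∀ b ∈ τ.tri.BPos, ν (b : 𝓡) = 0)
    (hν : ∀ s ∈ τ.𝓑H, ∀ t ∈ τ.𝓑H, ν (s * t) = ν s * ν t) {t : τ.R} (ht : t ∈ τ.tri.BH) (w : W) :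
    (t : 𝓡) • τ.vermaGen w = τ.vermaGen (ν t • w) := by
  obtain ⟨g, hg⟩ := τ.exists_vermaGenCLM W
  refine τ.tri.BH_induction (p := fun t : τ.R => (t : 𝓡) • τ.vermaGen w = τ.vermaGen (ν t • w))
    (fun x y hx hy => ?_) (fun h hh => ?_) (fun h hh n hn b hb hbn => ?_) ht
  · rw [Subalgebra.coe_add, add_smul, hx, hy, map_add, add_smul, ← hg, ← hg, ← hg, map_add]
  · rw [hH ⟨h, hh⟩, ← H_smul_vermaGen]
  · have hbp : b ∈ τ.tri.BPos := ⟨hb, n, hn, hbn⟩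
    have : ν ((h * b : τ.R) : 𝓡) = 0 := by
      rw [Subalgebra.coe_mul, hν _ (τ.coe_mem_𝓑H (τ.tri.H_le_BH hh)) _
        (τ.coe_mem_𝓑H ((le_sup_left : τ.tri.B ≤ τ.tri.BH) hb)), hB b hbp, mul_zero]
    rw [this, zero_smul, Subalgebra.coe_mul, mul_smul, τ.BPos_smul_vermaGen hbp, smul_zero, ← hg,
      map_zero]

/-- Induction along the dense subalgebra `A ⊗ BH → R`. -/
theorem A_mul_BH_induction {p : 𝓡 → Prop} (hp : IsClosed {r | p r}) (ha : ∀ x y, p x → p y → p (x + y))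
    (h : ∀ (a : τ.𝓐), ∀ t ∈ τ.tri.BH, p ((a : 𝓡) * ((t : τ.R) : 𝓡))) (r : 𝓡) : p r := by
  refine τ.dense_induction hp (fun r => ?_) r
  refine τ.tri.induction_on (p := fun r : τ.R => p (r : 𝓡)) r ?_ (fun x y hx hy => ha _ _ hx hy)
    (fun n a haA _ h' hh => ?_) (fun m a haA _ h' hh n hn b hb _ => ?_)
  · have := h 0 0 (zero_mem _)
    simpa using this
  · exact h ⟨a, coe_mem_completionIn haA⟩ h' (τ.tri.H_le_BH hh)
  · have := h ⟨a, coe_mem_completionIn haA⟩ (h' * b)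
      (mul_mem (τ.tri.H_le_BH hh) ((le_sup_left : τ.tri.B ≤ τ.tri.BH) hb))
    rwa [Subalgebra.coe_mul, ← mul_assoc] at this

section

variable [IsUltrametricDist K] [CompleteSpace K] [CharZero K] [IsUltrametricDist 𝓡]
  [CompleteSpace 𝓡] [Nontrivial 𝓡] [IsScalarTower K τ.tri.H W] [FiniteDimensional K W]

variable (W) in
-- These maps 𝓡 → 𝓐 ⊗̂ W are the candidate inverse of the Verma isomorphism, before balancing over
-- 𝓑H.
theorem exists_decompositionLift_tmul : ∃ (ε : τ.𝓑 →L[K] K)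
    (Φ : W →L[K] 𝓡 →L[K] CompletedTensor K τ.𝓐 W), ε 1 = 1 ∧
    (∀ b : τ.R, ∀ hb : b ∈ τ.tri.BPos, ε ⟨b, coe_mem_completionIn hb.1⟩ = 0) ∧
    ∀ w (a : τ.𝓐) (h : τ.tri.H) (b : τ.𝓑),
      Φ w ((a : 𝓡) * ((h : τ.R) : 𝓡) * b) = ε b • CompletedTensor.tmul K a (h • w) := by
  obtain ⟨L, hL⟩ := τ.exists_actionCLM W
  obtain ⟨ε, hε1, hε0⟩ := τ.exists_augmentation_B
  obtain ⟨T, hT⟩ := CompletedTensor.exists_tmul K τ.𝓐 W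
  obtain ⟨Φ, hΦ⟩ := exists_continuousLinearMap_of_forall (K := K) (V := 𝓡) (W := W)
    (Z := CompletedTensor K τ.𝓐 W) (I := τ.𝓐 × τ.tri.H × τ.𝓑)
    (fun i => (i.1 : 𝓡) * ((i.2.1 : τ.R) : 𝓡) * i.2.2)
    (fun i => ε i.2.2 • (T i.1).comp (L i.2.1).toLinearMap) (fun w => by
      let μ : τ.𝓐 →ₗ[K] τ.tri.H →ₗ[K] CompletedTensor K τ.𝓐 W := T.compl₂
        ((ContinuousLinearMap.apply K W w).toLinearMap.comp L.toLinearMap)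
      have hμ : ∀ a h, μ a h = CompletedTensor.tmul K a (L h w) := fun a h => hT _ _
      obtain ⟨Ψ, hΨ⟩ := τ.exists_decompositionLift ε μ
        (C := ‖L‖ * ‖w‖) (by positivity) (fun a h => by
          rw [hμ]
          calc _ ≤ ‖a‖ * ‖L h w‖ := CompletedTensor.norm_tmul_le a _
            _ ≤ ‖a‖ * (‖L‖ * ‖h‖ * ‖w‖) := by gcongr; exact L.le_opNorm₂ _ _
            _ = _ := by ring)
      exact ⟨Ψ, fun i => (hΨ _ _ _).trans (congrArg (ε i.2.2 • ·)
        ((hμ i.1 i.2.1).trans (hT i.1 (L i.2.1 w)).symm))⟩)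
  refine ⟨ε, Φ, hε1, fun b ⟨hb, n, hn, hbn⟩ => hε0 n hn.ne b hb hbn _ rfl, fun w a h b => ?_⟩
  rw [← hL, ← hT]
  exact hΦ w (a, h, b)

variable (W) in
-- For r = a t and s = u with t, u in BH, both sides of the balancing identity equal a ⊗ ν(t)ν(u)w.
-- Continuity in s and then in r gives the general case, so the maps factor through the tensor
-- product over 𝓑H.
theorem exists_balanced {ν : 𝓡 →L[K] τ.tri.H} (hH : ∀ h : τ.tri.H, ν ((h : τ.R) : 𝓡) = h)
    (hB : ∀ b ∈ τ.tri.BPos, ν (b : 𝓡) = 0)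
    (hν : ∀ s ∈ τ.𝓑H, ∀ t ∈ τ.𝓑H, ν (s * t) = ν s * ν t) :
    ∃ Φ : W →L[K] 𝓡 →L[K] CompletedTensor K τ.𝓐 W,
      (∀ w (a : τ.𝓐), ∀ t ∈ τ.tri.BH,
        Φ w ((a : 𝓡) * ((t : τ.R) : 𝓡)) = CompletedTensor.tmul K a (ν t • w)) ∧
      ∀ w r, ∀ s ∈ τ.𝓑H, Φ w (r * s) = Φ (ν s • w) r := by
  obtain ⟨L, hL⟩ := τ.exists_actionCLM W
  obtain ⟨T, hT⟩ := CompletedTensor.exists_tmul K τ.𝓐 W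
  obtain ⟨εB, Φ, hB1, hB0, hΦ⟩ := τ.exists_decompositionLift_tmul W
  have h1 : ∀ w (a : τ.𝓐), ∀ t ∈ τ.tri.BH,
      Φ w ((a : 𝓡) * ((t : τ.R) : 𝓡)) = CompletedTensor.tmul K a (ν t • w) := by
    intro w a t ht
    refine τ.tri.BH_induction (p := fun t : τ.R => Φ w ((a : 𝓡) * (t : 𝓡)) =
      CompletedTensor.tmul K a (ν t • w)) (fun x y hx hy => ?_) (fun h hh => ?_)
      (fun h hh n hn b hb hbn => ?_) ht
    · rw [Subalgebra.coe_add, mul_add, map_add, hx, hy, map_add, add_smul, ← hT, ← hT, ← hT,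
        map_add]
    · have := hΦ w a ⟨h, hh⟩ 1
      rw [hB1, one_smul, Subalgebra.coe_one, mul_one] at this
      rw [hH ⟨h, hh⟩]
      exact this
    · have hbp : b ∈ τ.tri.BPos := ⟨hb, n, hn, hbn⟩
      have h0 : ν ((h * b : τ.R) : 𝓡) = 0 := by
        rw [Subalgebra.coe_mul, hν _ (τ.coe_mem_𝓑H (τ.tri.H_le_BH hh)) _
          (τ.coe_mem_𝓑H ((le_sup_left : τ.tri.B ≤ τ.tri.BH) hb)), hB b hbp, mul_zero]
      have := hΦ w a ⟨h, hh⟩ ⟨b, coe_mem_completionIn hb⟩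
      rw [hB0 b hbp, zero_smul] at this
      rw [h0, zero_smul, ← hT, map_zero, Subalgebra.coe_mul, ← mul_assoc]
      exact this
  refine ⟨Φ, h1, fun w r s hs => ?_⟩
  refine τ.A_mul_BH_induction (p := fun r => Φ w (r * s) = Φ (ν s • w) r)
    (isClosed_eq ((Φ w).continuous.comp (continuous_id.mul continuous_const)) (Φ _).continuous)
    (fun x y hx hy => by rw [add_mul, map_add, hx, hy, map_add]) (fun a t ht => ?_) r
  rw [← hL]
  refine τ.𝓑H_induction (p := fun s => Φ w ((a : 𝓡) * (t : 𝓡) * s) = Φ (L (ν s) w) ((a : 𝓡) * (t : 𝓡)))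
    (isClosed_eq ((Φ w).continuous.comp (continuous_const.mul continuous_id))
      ((ContinuousLinearMap.apply K _ _).continuous.comp (Φ.continuous.comp
        ((ContinuousLinearMap.apply K _ w).continuous.comp (L.continuous.comp ν.continuous)))))
    (fun u hu => ?_) hs
  have := h1 w a (t * u) (mul_mem ht hu)
  rw [Subalgebra.coe_mul, ← mul_assoc] at this
  rw [this, h1 _ a t ht, hL, hν _ (τ.coe_mem_𝓑H ht) _ (τ.coe_mem_𝓑H hu), mul_smul]

variable (W) in
/-- The analytic Verma module is `𝓐 ⊗̂ W`. -/
theorem exists_vermaEquiv [IsUltrametricDist W] :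
    ∃ e : CompletedTensor K τ.𝓐 W ≃L[K] τ.Verma W,
      ∀ (a : τ.𝓐) (w : W), e (CompletedTensor.tmul K a w) = (a : 𝓡) • τ.vermaGen w := by
  obtain ⟨ν, hH, hB, hν⟩ := τ.exists_projectionH
  obtain ⟨ρ, hρ1, hρ⟩ := τ.exists_inflationProjection W hH hB hν
  obtain ⟨Φ, hΦ, hbal⟩ := τ.exists_balanced W hH hB hν
  obtain ⟨g, hg⟩ := τ.exists_vermaGenCLM W
  obtain ⟨F, hF⟩ := CompletedTensor.exists_smul_lift (X := τ.Verma W) τ.𝓐 g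
  obtain ⟨G, hG⟩ := CompletedRelTensor.exists_lift_of_ringHom (N := τ.Inflation W)
    τ.𝓑H.val.toRingHom ρ Φ (fun r s n => (hbal _ r s s.2).trans (by rw [hρ]))
  have hG' : ∀ (r : 𝓡) (w : W), G (r • τ.vermaGen w) = Φ w r := fun r w => by
    rw [smul_vermaGen', hG, hρ1]
  have hone : ν (1 : 𝓡) = 1 := hH 1
  have hGF : ∀ y, G (F y) = y := fun y => by
    have : G.comp F = ContinuousLinearMap.id K _ := CompletedTensor.hom_ext fun a w => by
      have := hΦ w a 1 (one_mem _)
      rw [Subalgebra.coe_one, mul_one, hone, one_smul] at this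
      rw [ContinuousLinearMap.comp_apply, hF, hg, hG', this]
      rfl
    exact congrArg (fun f => f y) this
  -- By density it is enough to treat r = a t applied to a generator, with t in BH acting on the
  -- generator through ν.
  have hFG : ∀ x, F (G x) = x := fun x => by
    refine τ.verma_induction (p := fun x => F (G x) = x) x
      (isClosed_eq (F.continuous.comp G.continuous) continuous_id) (by rw [map_zero, map_zero])
      (fun x y hx hy => by rw [map_add, map_add, hx, hy]) (fun r w => ?_)
    rw [hG']
    refine τ.A_mul_BH_induction (p := fun r => F (Φ w r) = r • τ.vermaGen w)
      (isClosed_eq (F.continuous.comp (Φ w).continuous) (continuous_id.smul continuous_const))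
      (fun x y hx hy => by rw [map_add, map_add, hx, hy, add_smul]) (fun a t ht => ?_) r
    rw [hΦ w a t ht, hF, mul_smul, hg, τ.BH_smul_vermaGen hH hB hν ht]
  exact ⟨ContinuousLinearEquiv.equivOfInverse F G hGF hFG, fun a w => (hF a w).trans (by rw [hg])⟩

end

end BanachTriangularDecomposition

end

/-! ### Weights and closed submodules of the analytic Verma module. -/

noncomputable section

open Filter Topology

namespace BanachTriangularDecomposition

variable {K 𝓡 : Type*} [NontriviallyNormedField K] [NormedRing 𝓡] [NormedAlgebra K 𝓡]
  (τ : BanachTriangularDecomposition K 𝓡)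
  {W : Type*} [NormedAddCommGroup W] [NormedSpace K W] [Module τ.tri.H W]
  {X : Type*} [NormedAddCommGroup X] [NormedSpace K X] [Module 𝓡 X]

/-- A linear map from an `H`-module `W` to a Banach `𝓡`-module `X` which exhibits `X` as the
analytic Verma module `𝓐 ⊗̂ W`. -/
structure IsVermaGenerator (g : W →L[K] X) : Prop where
  H_smul : ∀ (h : τ.tri.H) w, ((h : τ.R) : 𝓡) • g w = g (h • w)
  BPos_smul : ∀ b ∈ τ.tri.BPos, ∀ w, (b : 𝓡) • g w = 0
  exists_equiv : ∃ e : CompletedTensor K τ.𝓐 W ≃L[K] X,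
    ∀ (a : τ.𝓐) (w : W), e (CompletedTensor.tmul K a w) = (a : 𝓡) • g w

/-- The homogeneous component of degree `n` of a Verma module. -/
def vermaComponent (g : W →L[K] X) (n : ℤ) : Submodule K X :=
  Submodule.span K {x | ∃ a ∈ τ.tri.A, a ∈ τ.tri.grading n ∧ ∃ w, (a : 𝓡) • g w = x}

variable {τ} {g : W →L[K] X}

omit [Module τ.tri.H W] in
lemma mem_vermaComponent {n : ℤ} {a : τ.R} (ha : a ∈ τ.tri.A) (han : a ∈ τ.tri.grading n) (w : W) :
    (a : 𝓡) • g w ∈ τ.vermaComponent g n :=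
  Submodule.subset_span ⟨a, ha, han, w, rfl⟩

namespace IsVermaGenerator

variable [IsUltrametricDist K] [CompleteSpace K] [CharZero K] [IsUltrametricDist 𝓡]
  [CompleteSpace 𝓡] [Nontrivial 𝓡] [IsScalarTower K τ.tri.H W]
  [IsUltrametricDist X] [CompleteSpace X] [IsScalarTower K 𝓡 X] [IsBoundedSMul 𝓡 X]

set_option linter.unusedSectionVars false

/-- A basis of the finite-dimensional W turns 𝓐 ⊗̂ W into finitely many copies of 𝓐; the κ i are the
continuous coordinates. -/
theorem exists_coordinates [FiniteDimensional K W] (hg : τ.IsVermaGenerator g) :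
    ∃ (d : ℕ) (e : Module.Basis (Fin d) K W) (κ : Fin d → X →L[K] τ.𝓐),
      (∀ x, ∑ i, (κ i x : 𝓡) • g (e i) = x) ∧
      ∀ i (a : τ.𝓐) w, κ i ((a : 𝓡) • g w) = e.repr w i • a := by
  obtain ⟨F, hF⟩ := hg.exists_equiv
  have hcomm := smulCommClass_of_isScalarTower K 𝓡 X
  let e := Module.finBasis K W
  have key : ∀ i, ∃ t : CompletedTensor K τ.𝓐 W →L[K] τ.𝓐,
      ∀ (a : τ.𝓐) w, t (CompletedTensor.tmul K a w) = e.repr w i • a := fun i => by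
    let q : W →L[K] K := LinearMap.toContinuousLinearMap (e.coord i)
    obtain ⟨t, ht⟩ := CompletedTensor.exists_lift (K := K) (V := τ.𝓐) (W := W) (Z := τ.𝓐)
      (LinearMap.mk₂ K (fun a w => q w • a) (fun _ _ _ => smul_add _ _ _)
        (fun c a w => smul_comm _ _ _) (fun a v w => by rw [map_add, add_smul])
        (fun c a w => by rw [map_smul, smul_assoc])) (C := ‖q‖) (norm_nonneg _) (fun a w => by
          rw [LinearMap.mk₂_apply, norm_smul]
          calc ‖q w‖ * ‖a‖ ≤ ‖q‖ * ‖w‖ * ‖a‖ := by gcongr; exact q.le_opNorm w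
            _ = _ := by ring)
    exact ⟨t, ht⟩
  choose t ht using key
  refine ⟨_, e, fun i => (t i).comp F.symm.toContinuousLinearMap, fun x => ?_, fun i a w => ?_⟩
  · obtain ⟨y, rfl⟩ := F.surjective x
    simp only [ContinuousLinearMap.comp_apply, ContinuousLinearEquiv.coe_coe,
      ContinuousLinearEquiv.symm_apply_apply]
    refine CompletedTensor.induction_on (p := fun y => ∑ i, (t i y : 𝓡) • g (e i) = F y) y
      (isClosed_eq (continuous_finsetSum _ fun i _ =>
        (continuous_subtype_val.comp (t i).continuous).smul continuous_const) F.continuous)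
      (by simp) (fun a w => ?_) (fun x y hx hy => ?_)
    · rw [hF]
      conv_rhs => rw [← e.sum_repr w, map_sum, Finset.smul_sum]
      refine Finset.sum_congr rfl fun i _ => ?_
      rw [ht, Subalgebra.coe_smul, smul_assoc, map_smul, smul_comm]
    · rw [map_add, ← hx, ← hy, ← Finset.sum_add_distrib]
      refine Finset.sum_congr rfl fun i _ => ?_
      rw [map_add, Subalgebra.coe_add, add_smul]
  · rw [ContinuousLinearMap.comp_apply, ← hF]
    exact (congrArg (t i) (F.symm_apply_apply _)).trans (ht i a w)

theorem injective [FiniteDimensional K W] (hg : τ.IsVermaGenerator g) : Function.Injective g := by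
  obtain ⟨d, e, κ, -, hκ⟩ := hg.exists_coordinates
  refine (injective_iff_map_eq_zero g).2 fun w hw => ?_
  refine e.repr.map_eq_zero_iff.1 (Finsupp.ext fun i => ?_)
  have := hκ i 1 w
  rw [hw, smul_zero, map_zero] at this
  exact ((smul_eq_zero.1 this.symm).resolve_right one_ne_zero)

/-- In degree zero, a term ah has a scalar, since A_0 = K, and a term ahb with b of negative degree
kills g(W). -/
theorem smul_mem_range_of_mem_grading_zero (hg : τ.IsVermaGenerator g) {r : τ.R}
    (hr : r ∈ τ.tri.grading 0) (w : W) : (r : 𝓡) • g w ∈ Set.range g := by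
  -- The terms of the triangular expansion of r need not have degree zero; inserting the projection
  -- removes those that do not.
  have key : ((τ.tri.proj 0 r : τ.R) : 𝓡) • g w ∈ Set.range g := by
    refine τ.tri.induction_on (p := fun r => ((τ.tri.proj 0 r : τ.R) : 𝓡) • g w ∈ Set.range g) r
      ⟨0, by simp⟩ ?_ (fun n a ha han h hh => ?_) (fun m a ha ham h hh n hn b hb hbn => ?_)
    · rintro x y ⟨u, hu⟩ ⟨v, hv⟩
      exact ⟨u + v, by rw [map_add, map_add, Subalgebra.coe_add, add_smul, hu, hv]⟩
    · have hah : a * h ∈ τ.tri.grading n := by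
        simpa using τ.tri.mul_mem_grading han (τ.tri.H_le hh)
      rcases eq_or_ne n 0 with rfl | hn
      · obtain ⟨c, rfl⟩ := τ.tri.eq_smul_one_of_mem_grading_zero τ.tri.A_zero ha han
        refine ⟨c • ((⟨h, hh⟩ : τ.tri.H) • w), ?_⟩
        rw [τ.tri.proj_same hah, smul_mul_assoc, one_mul, Subalgebra.coe_smul, smul_assoc,
          map_smul, ← hg.H_smul]
      · exact ⟨0, by rw [τ.tri.proj_ne hah hn]; simp⟩
    · have hahb : a * h * b ∈ τ.tri.grading (m + n) := by
        simpa using τ.tri.mul_mem_grading (τ.tri.mul_mem_grading ham (τ.tri.H_le hh)) hbn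
      rcases eq_or_ne (m + n) 0 with h0 | h0
      · rw [h0] at hahb
        refine ⟨0, ?_⟩
        rw [τ.tri.proj_same hahb, Subalgebra.coe_mul, mul_smul,
          hg.BPos_smul b ⟨hb, n, hn, hbn⟩, smul_zero, map_zero]
      · exact ⟨0, by rw [τ.tri.proj_ne hahb h0]; simp⟩
  rwa [τ.tri.proj_same hr] at key

/-- The element ∂ has degree zero, so it preserves g(W), and it commutes with H because H has degree
zero. Schur's lemma for the split algebra H applies. -/
theorem exists_weight [FiniteDimensional K W] [IsSimpleModule τ.tri.H W]
    (hg : τ.IsVermaGenerator g) : ∃ l : K, ∀ w, τ.del • g w = l • g w := by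
  have hcomm := smulCommClass_of_isScalarTower K 𝓡 X
  choose δ hδ using hg.smul_mem_range_of_mem_grading_zero τ.tri.del_mem
  obtain ⟨c, hc⟩ := τ.tri.H_split.exists_eq_smul (W := W)
    { toFun := δ
      map_add' := fun v w => hg.injective (by simp only [map_add, hδ, smul_add])
      map_smul' := fun h w => hg.injective (by
        rw [hδ, RingHom.id_apply, ← hg.H_smul, ← hg.H_smul, hδ, smul_smul, smul_smul]
        congr 1
        have := (τ.tri.mem_grading_iff 0 _).1 (τ.tri.H_le h.2)
        rw [zero_smul, sub_eq_zero] at this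
        exact congrArg (fun x : τ.R => (x : 𝓡)) this) }
  refine ⟨c, fun w => ?_⟩
  rw [← map_smul g c w, ← hc]
  exact (hδ w).symm

theorem del_smul {l : K} (hl : ∀ w, τ.del • g w = l • g w) {n : ℤ} {x : X}
    (hx : x ∈ τ.vermaComponent g n) : τ.del • x = (l + n) • x := by
  have hcomm := smulCommClass_of_isScalarTower K 𝓡 X
  induction hx using Submodule.span_induction with
  | mem x hx =>
    obtain ⟨a, ha, han, w, rfl⟩ := hx
    have h1 : τ.del * (a : 𝓡) = a * τ.del + (n : K) • (a : 𝓡) := by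
      have := (τ.tri.mem_grading_iff n a).1 han
      rw [sub_eq_iff_eq_add, add_comm] at this
      have := congrArg (fun x : τ.R => (x : 𝓡)) this
      simpa [del, ← Int.cast_smul_eq_zsmul K] using this
    rw [smul_smul, h1, add_smul, mul_smul, hl, smul_comm, add_smul, smul_assoc]
  | zero => simp
  | add x y _ _ hx hy => rw [smul_add, hx, hy, smul_add]
  | smul c x _ hx => rw [smul_comm, hx, smul_comm]

/-- The coordinates in 𝓐 are expanded into homogeneous elements, and the finitely many series are
added degree by degree. -/
theorem exists_expansion [FiniteDimensional K W] (hg : τ.IsVermaGenerator g) (x : X) :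
    ∃ c : ℕ → X, (∀ n : ℕ, c n ∈ τ.vermaComponent g n) ∧ HasSum c x := by
  obtain ⟨d, e, κ, hκ, -⟩ := hg.exists_coordinates
  choose c hc hcx using fun i => τ.exists_expansion_A (κ i x)
  refine ⟨fun n => ∑ i, (c i n : 𝓡) • g (e i), fun n => sum_mem fun i _ => ?_, ?_⟩
  · obtain ⟨a, ha, han, hca⟩ := hc i n
    rw [hca]
    exact mem_vermaComponent ha han _
  · conv => arg 2; rw [← hκ x]
    refine hasSum_sum fun i _ => ?_
    have h1 : HasSum (fun n => (c i n : 𝓡)) (κ i x : 𝓡) :=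
      (hcx i).map τ.𝓐.subtype continuous_subtype_val
    exact h1.map ((smulAddHom 𝓡 X).flip (g (e i))) (continuous_id.smul continuous_const)

theorem mem_range_of_mem_vermaComponent_zero {x : X} (hx : x ∈ τ.vermaComponent g 0) :
    ∃ w, g w = x := by
  induction hx using Submodule.span_induction with
  | mem x hx =>
    obtain ⟨a, ha, han, w, rfl⟩ := hx
    obtain ⟨c, rfl⟩ := τ.tri.eq_smul_one_of_mem_grading_zero τ.tri.A_zero ha han
    exact ⟨c • w, by simp⟩
  | zero => exact ⟨0, map_zero g⟩
  | add x y _ _ hx hy =>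
    obtain ⟨⟨u, rfl⟩, v, rfl⟩ := And.intro hx hy
    exact ⟨u + v, map_add g u v⟩
  | smul c x _ hx =>
    obtain ⟨u, rfl⟩ := hx
    exact ⟨c • u, map_smul g c u⟩

/-- The projections to the weight spaces of a Verma module. -/
theorem exists_projections [FiniteDimensional K W] (hg : τ.IsVermaGenerator g) {l : K}
    (hl : ∀ w, τ.del • g w = l • g w) :
    ∃ P : ℕ → X →L[K] X, (∀ x, HasSum (fun m => P m x) x) ∧
      (∀ (m : ℕ) x, P m x ∈ τ.vermaComponent g m) ∧
      (∀ (m n : ℕ), ∀ x ∈ τ.vermaComponent g n, P m x = if n = m then x else 0) ∧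
      (∀ (m : ℕ) x, P m (τ.del • x) = (l + m) • P m x) ∧
      ∀ (m : ℕ) (N : Submodule 𝓡 X), IsClosed (N : Set X) → ∀ x ∈ N, P m x ∈ N := by
  have hcomm := smulCommClass_of_isScalarTower K 𝓡 X
  let D : X →L[K] X := LinearMap.mkContinuous (Algebra.lsmul K K X τ.del) ‖τ.del‖
    fun x => norm_smul_le _ _
  have hDa : ∀ x, D x = τ.del • x := fun x => rfl
  have hDc : ∀ (n : ℕ), ∀ x ∈ τ.vermaComponent g n, D x = (l + n) • x := fun n x hx =>
    (del_smul hl hx).trans (by rw [Int.cast_natCast])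
  have hD : ∀ x, ∃ c : ℕ → X, (∀ n : ℕ, D (c n) = (l + n) • c n) ∧ HasSum c x := fun x => by
    obtain ⟨c, hc, hcx⟩ := hg.exists_expansion x
    exact ⟨c, fun n => hDc n _ (hc n), hcx⟩
  choose P f hP hPf using exists_weightProjection D l hD
  refine ⟨P, fun x => ?_, fun m x => ?_, fun m n x hx => ?_, fun m x => ?_, fun m N hN x hx => ?_⟩
  · obtain ⟨c, hc, hcx⟩ := hD x
    simpa only [hP _ c x hc hcx] using hcx
  · obtain ⟨c, hc, hcx⟩ := hg.exists_expansion x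
    rw [hP m c x (fun n => hDc n _ (hc n)) hcx]
    exact hc m
  · rw [hP m (Pi.single n x) x (fun k => ?_) (hasSum_pi_single n x), Pi.single_apply]
    · simp only [eq_comm]
    · rcases eq_or_ne k n with rfl | h
      · simpa using hDc _ _ hx
      · simp [Pi.single_eq_of_ne h]
  · obtain ⟨c, hc, hcx⟩ := hD x
    rw [hP m c x hc hcx, ← hc, ← hDa]
    exact hP m (fun n => D (c n)) (D x) (fun n => by rw [hc, map_smul, hc]) (hcx.mapL D)
  -- The projection is a limit of polynomials in ∂ applied to x, each of which stays in N.
  · exact hN.mem_of_tendsto (hPf m x) (Eventually.of_forall fun k =>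
      aeval_apply_mem D (N := N.restrictScalars K) (fun v hv => N.smul_mem τ.del hv) (f m k) hx)

section Simple

variable [IsSimpleModule τ.tri.H W]

/-- A continuous section of the orbit map of a nonzero highest weight vector. -/
theorem exists_section [FiniteDimensional K W] (hg : τ.IsVermaGenerator g) {w₀ : W} (hw : w₀ ≠ 0) :
    ∃ σ : X →L[K] 𝓡, (∀ x, σ x • g w₀ = x) ∧
      ∀ a ∈ τ.tri.A, ∀ w, σ ((a : 𝓡) • g w) ∈ τ.R := by
  obtain ⟨d, e, κ, hκ, hκ'⟩ := hg.exists_coordinates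
  have hsurj := IsSimpleModule.toSpanSingleton_surjective τ.tri.H hw
  choose h hh using fun i => hsurj (e i)
  simp only [LinearMap.toSpanSingleton_apply] at hh
  -- With e_i = h_i w₀, a vector Σ κ_i(x) g(e_i) is the translate of g w₀ by Σ κ_i(x) h_i.
  let σ : X →L[K] 𝓡 := ∑ i, ((ContinuousLinearMap.mul K 𝓡).flip ((h i : τ.R) : 𝓡)).comp
    ((τ.𝓐.toSubmodule.subtypeL).comp (κ i))
  have hσ : ∀ x, σ x = ∑ i, (κ i x : 𝓡) * ((h i : τ.R) : 𝓡) := fun x => by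
    simp only [σ, sum_apply]
    rfl
  refine ⟨σ, fun x => ?_, fun a ha w => ?_⟩
  · rw [hσ, Finset.sum_smul]
    conv_rhs => rw [← hκ x]
    exact Finset.sum_congr rfl fun i _ => by rw [mul_smul, hg.H_smul, hh]
  · rw [hσ]
    refine sum_mem fun i _ => mul_mem ?_ (h i : τ.R).2
    have := hκ' i ⟨a, coe_mem_completionIn ha⟩ w
    rw [show κ i ((a : 𝓡) • g w) = _ from this]
    exact τ.R.smul_mem a.2 _

/-- N is the preimage under the section σ of the left ideal {r : r g(w₀) ∈ N}, which is closed
because 𝓡 is noetherian. -/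
theorem isClosed_submodule [FiniteDimensional K W] (hg : τ.IsVermaGenerator g)
    (N : Submodule 𝓡 X) : IsClosed (N : Set X) := by
  have : Nontrivial W := IsSimpleModule.nontrivial τ.tri.H W
  obtain ⟨w₀, hw⟩ := exists_ne (0 : W)
  obtain ⟨σ, hσ, -⟩ := hg.exists_section hw
  have : IsNoetherianRing 𝓡 := τ.noetherian.1
  have hc := Ideal.isClosed_of_noetherian_banachAlgebra K
    (N.comap (LinearMap.toSpanSingleton 𝓡 X (g w₀)))
  have : (N : Set X) = σ ⁻¹' (N.comap (LinearMap.toSpanSingleton 𝓡 X (g w₀)) : Set 𝓡) := by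
    ext x
    simp [hσ]
  rw [this]
  exact hc.preimage σ.continuous

theorem eq_top_of_mem [FiniteDimensional K W] (hg : τ.IsVermaGenerator g) {N : Submodule 𝓡 X}
    {w₀ : W} (hw : w₀ ≠ 0) (h : g w₀ ∈ N) : N = ⊤ := by
  obtain ⟨σ, hσ, -⟩ := hg.exists_section hw
  exact eq_top_iff.2 fun x _ => hσ x ▸ N.smul_mem _ h

end Simple

end IsVermaGenerator

end BanachTriangularDecomposition

end

/-! ### Maximal submodules of the algebraic and analytic Verma modules. -/

noncomputable section

open Filter Topology

theorem aeval_smul_of_smul_eq {K R X : Type*} [Field K] [Ring R] [Algebra K R] [AddCommGroup X]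
    [Module K X] [Module R X] [IsScalarTower K R X] {d : R} {μ : K} {x : X} (h : d • x = μ • x)
    (f : Polynomial K) : Polynomial.aeval d f • x = f.eval μ • x := by
  have hcomm : SMulCommClass K R X := smulCommClass_of_isScalarTower ..
  induction f using Polynomial.induction_on' with
  | add p q hp hq => rw [map_add, add_smul, hp, hq, Polynomial.eval_add, add_smul]
  | monomial n a =>
    have : ∀ n : ℕ, d ^ n • x = μ ^ n • x := fun n => by
      induction n with
      | zero => simp
      | succ n ih => rw [pow_succ, mul_smul, h, smul_comm, ih, smul_smul, pow_succ']
    rw [Polynomial.aeval_monomial, mul_smul, this, Polynomial.eval_monomial, algebraMap_smul,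
      smul_smul]

namespace BanachTriangularDecomposition

variable {K 𝓡 : Type*} [NontriviallyNormedField K] [NormedRing 𝓡] [NormedAlgebra K 𝓡]
  (τ : BanachTriangularDecomposition K 𝓡)
  {W : Type*} [NormedAddCommGroup W] [NormedSpace K W] [Module τ.tri.H W]
  {X : Type*} [NormedAddCommGroup X] [NormedSpace K X] [Module 𝓡 X]
  {Δ : Type*} [AddCommGroup Δ] [Module K Δ] [Module τ.R Δ]

/-- A linear map from an `H`-module `W` to an `R`-module generated by its image on which `H` acts
on this image through `W` and the elements of `B^{>0}` act as zero. -/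
structure IsHighestWeight (γ : W →ₗ[K] Δ) : Prop where
  H_smul : ∀ (h : τ.tri.H) w, (h : τ.R) • γ w = γ (h • w)
  BPos_smul : ∀ b ∈ τ.tri.BPos, ∀ w, b • γ w = 0
  span_range : Submodule.span τ.R (Set.range γ) = ⊤

/-- The vectors all of whose translates are annihilated by the endomorphism `P`. -/
def kernelSubmodule (P : X →L[K] X) : Submodule 𝓡 X where
  carrier := {x | ∀ r : 𝓡, P (r • x) = 0}
  zero_mem' := by simp
  add_mem' := fun {x y} hx hy r => by rw [smul_add, map_add, hx, hy, add_zero]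
  smul_mem' := fun c x hx r => by rw [smul_smul]; exact hx _

variable {τ} {g : W →L[K] X} {γ : W →ₗ[K] Δ}

/-- In a translate by ahb, factors of B of negative degree kill γ(W) and factors of H move into W,
so translates by homogeneous elements of A generate additively. -/
theorem IsHighestWeight.induction_on (hγ : τ.IsHighestWeight γ) {p : Δ → Prop} (y : Δ) (h0 : p 0)
    (hadd : ∀ x y, p x → p y → p (x + y))
    (h : ∀ n, ∀ a ∈ τ.tri.A, a ∈ τ.tri.grading n → ∀ w, p (a • γ w)) : p y := by
  have key : ∀ (r : τ.R) w, p (r • γ w) := fun r w => by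
    refine τ.tri.induction_on (p := fun r => p (r • γ w)) r (by rwa [zero_smul])
      (fun x y hx hy => by rw [add_smul]; exact hadd _ _ hx hy) (fun n a ha han h' hh => ?_)
      (fun m a ha ham h' hh n hn b hb hbn => ?_)
    · rw [mul_smul, hγ.H_smul ⟨h', hh⟩]
      exact h n a ha han _
    · rwa [mul_smul, hγ.BPos_smul b ⟨hb, n, hn, hbn⟩, smul_zero]
  have hy : y ∈ Submodule.span τ.R (Set.range γ) := hγ.span_range ▸ Submodule.mem_top
  induction hy using Submodule.closure_induction with
  | zero => exact h0
  | add x y _ _ hx hy => exact hadd _ _ hx hy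
  | smul_mem r x hx =>
    obtain ⟨w, rfl⟩ := hx
    exact key r w

theorem IsHighestWeight.eq_top_of_mem (hγ : τ.IsHighestWeight γ) [IsSimpleModule τ.tri.H W]
    {N : Submodule τ.R Δ} {w₀ : W} (hw : w₀ ≠ 0) (h : γ w₀ ∈ N) : N = ⊤ := by
  rw [eq_top_iff, ← hγ.span_range, Submodule.span_le]
  rintro _ ⟨w, rfl⟩
  obtain ⟨h', rfl⟩ := IsSimpleModule.toSpanSingleton_surjective τ.tri.H hw w
  rw [LinearMap.toSpanSingleton_apply, ← hγ.H_smul]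
  exact N.smul_mem _ h

namespace IsVermaGenerator

variable [IsUltrametricDist K] [CompleteSpace K] [CharZero K] [IsUltrametricDist 𝓡]
  [CompleteSpace 𝓡] [Nontrivial 𝓡] [IsScalarTower K τ.tri.H W]
  [IsUltrametricDist X] [CompleteSpace X] [IsScalarTower K 𝓡 X] [IsBoundedSMul 𝓡 X]
  [FiniteDimensional K W] [IsScalarTower K τ.R Δ]

set_option linter.unusedSectionVars false

lemma apply_mem_vermaComponent_zero (w : W) : g w ∈ τ.vermaComponent g 0 := by
  have := mem_vermaComponent (g := g) (one_mem τ.tri.A)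
    (SetLike.one_mem_graded τ.tri.grading) w
  simpa using this

/-- The algebraic Verma module embeds in the analytic one. -/
theorem injective_of_isHighestWeight (hg : τ.IsVermaGenerator g) (hγ : τ.IsHighestWeight γ)
    (ι : Δ →ₗ[τ.R] X) (hι : ∀ w, ι (γ w) = g w) : Function.Injective ι := by
  have hcomm := smulCommClass_of_isScalarTower K τ.R Δ
  obtain ⟨d, e, κ, hκ, hκ'⟩ := hg.exists_coordinates
  -- No uniqueness is needed here: the coordinates κ i of the image in X recover the a i.
  have key : ∀ y : Δ, ∃ a : Fin d → τ.R, (∀ i, a i ∈ τ.tri.A) ∧ y = ∑ i, a i • γ (e i) := by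
    intro y
    refine hγ.induction_on (p := fun y : Δ =>
      ∃ a : Fin d → τ.R, (∀ i, a i ∈ τ.tri.A) ∧ y = ∑ i, a i • γ (e i)) y
      ⟨0, fun i => zero_mem _, by simp⟩ ?_ (fun n a ha _ w => ?_)
    · rintro x y ⟨a, ha, rfl⟩ ⟨b, hb, rfl⟩
      exact ⟨a + b, fun i => add_mem (ha i) (hb i), by
        simp [add_smul, Finset.sum_add_distrib]⟩
    · refine ⟨fun i => e.repr w i • a, fun i => τ.tri.A.smul_mem ha _, ?_⟩
      conv_lhs => rw [← e.sum_repr w, map_sum, Finset.smul_sum]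
      exact Finset.sum_congr rfl fun i _ => by rw [map_smul, smul_comm, smul_assoc]
  refine (injective_iff_map_eq_zero ι).2 fun y hy => ?_
  obtain ⟨a, ha, rfl⟩ := key y
  refine Finset.sum_eq_zero fun i _ => ?_
  have h1 : ∑ j, (a j : 𝓡) • g (e j) = 0 := by
    rw [← hy, map_sum]
    exact Finset.sum_congr rfl fun j _ => by rw [map_smul, hι]; rfl
  have h2 := congrArg (κ i) h1
  rw [map_sum, map_zero, Finset.sum_eq_single i (fun j _ hj => ?_) (by simp)] at h2
  · have := hκ' i ⟨a i, coe_mem_completionIn (ha i)⟩ (e i)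
    rw [h2] at this
    simp only [Module.Basis.repr_self, Finsupp.single_eq_same, one_smul] at this
    have h3 : a i = 0 := Subtype.ext (congrArg Subtype.val this).symm
    rw [h3, zero_smul]
  · have := hκ' i ⟨a j, coe_mem_completionIn (ha j)⟩ (e j)
    rw [Module.Basis.repr_self, Finsupp.single_eq_of_ne hj.symm, zero_smul] at this
    exact this

section Maximal

variable [IsSimpleModule τ.tri.H W] {P : ℕ → X →L[K] X}

theorem kernelSubmodule_ne_top (hg : τ.IsVermaGenerator g)
    (hPc : ∀ (m n : ℕ), ∀ x ∈ τ.vermaComponent g n, P m x = if n = m then x else 0) :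
    kernelSubmodule (𝓡 := 𝓡) (P 0) ≠ ⊤ := fun h => by
  have : Nontrivial W := IsSimpleModule.nontrivial τ.tri.H W
  obtain ⟨w, hw⟩ := exists_ne (0 : W)
  have h1 : g w ∈ kernelSubmodule (𝓡 := 𝓡) (P 0) := h ▸ Submodule.mem_top
  have h2 := h1 1
  rw [one_smul, hPc 0 0 (g w) (apply_mem_vermaComponent_zero w), if_pos rfl] at h2
  exact hw (hg.injective (h2.trans (map_zero g).symm))

/-- N is closed, hence stable under P 0. If some translate of x had a nonzero degree-zero component,
N would contain a nonzero g w, which generates X. -/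
theorem le_kernelSubmodule (hg : τ.IsVermaGenerator g)
    (hPm : ∀ (m : ℕ) x, P m x ∈ τ.vermaComponent g m)
    (hPN : ∀ (m : ℕ) (N : Submodule 𝓡 X), IsClosed (N : Set X) → ∀ x ∈ N, P m x ∈ N)
    {N : Submodule 𝓡 X} (hN : N ≠ ⊤) : N ≤ kernelSubmodule (P 0) := fun x hx r => by
  obtain ⟨w, hw⟩ := mem_range_of_mem_vermaComponent_zero (hPm 0 (r • x))
  by_cases h0 : w = 0
  · rw [← hw, h0, map_zero]
  · exact absurd (hg.eq_top_of_mem h0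
      (hw ▸ hPN 0 N (hg.isClosed_submodule N) _ (N.smul_mem r hx))) hN

theorem comap_kernelSubmodule_ne_top (hg : τ.IsVermaGenerator g)
    (hPc : ∀ (m n : ℕ), ∀ x ∈ τ.vermaComponent g n, P m x = if n = m then x else 0)
    (ι : Δ →ₗ[τ.R] X) (hι : ∀ w, ι (γ w) = g w) :
    ((kernelSubmodule (𝓡 := 𝓡) (P 0)).restrictScalars τ.R).comap ι ≠ ⊤ := fun h => by
  have : Nontrivial W := IsSimpleModule.nontrivial τ.tri.H W
  obtain ⟨w, hw⟩ := exists_ne (0 : W)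
  have h1 : γ w ∈ ((kernelSubmodule (𝓡 := 𝓡) (P 0)).restrictScalars τ.R).comap ι :=
    h ▸ Submodule.mem_top
  have h2 : g w ∈ kernelSubmodule (𝓡 := 𝓡) (P 0) := hι w ▸ h1
  exact hg.kernelSubmodule_ne_top hPc (hg.eq_top_of_mem hw h2)

/-- A vector of Δ involves finitely many degrees, so the interpolation polynomials in ∂
approximating P 0 are exact on it from some index on. -/
theorem exists_smul_eq_projection {l : K} (hl : ∀ w, τ.del • g w = l • g w)
    (hPc : ∀ (m n : ℕ), ∀ x ∈ τ.vermaComponent g n, P m x = if n = m then x else 0)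
    (hγ : τ.IsHighestWeight γ) (ι : Δ →ₗ[τ.R] X) (hι : ∀ w, ι (γ w) = g w) (y : Δ) :
    ∃ r : τ.R, ι (r • y) = P 0 (ι y) := by
  choose f hf1 hf0 _ using fun k => exists_integerValued_polynomial (K := K) 0 k
  let q : ℕ → τ.R := fun k => Polynomial.aeval τ.tri.del
    ((f k).comp (Polynomial.X - Polynomial.C l))
  suffices h : ∃ k₀, ∀ k ≥ k₀, ι (q k • y) = P 0 (ι y) from
    let ⟨k₀, hk⟩ := h; ⟨q k₀, hk k₀ le_rfl⟩
  -- Asking for all k ≥ k₀ makes the condition additive. On degree n the index k₀ = n suffices,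
  -- since the k-th polynomial takes the value 1 at 0 and vanishes at 1, …, k.
  refine hγ.induction_on (p := fun y => ∃ k₀, ∀ k ≥ k₀, ι (q k • y) = P 0 (ι y)) y
    ⟨0, by simp⟩ ?_ (fun n a ha han w => ?_)
  · rintro x y ⟨i, hi⟩ ⟨j, hj⟩
    refine ⟨max i j, fun k hk => ?_⟩
    rw [smul_add, map_add, map_add, map_add, hi k ((le_max_left _ _).trans hk),
      hj k ((le_max_right _ _).trans hk)]
  · rcases lt_or_ge n 0 with hn | hn
    · exact ⟨0, by simp [τ.tri.eq_zero_of_mem_A ha han hn]⟩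
    lift n to ℕ using hn
    have hx := mem_vermaComponent (g := g) ha han w
    have hιx : ι (a • γ w) = (a : 𝓡) • g w := by rw [map_smul, hι]; rfl
    refine ⟨n, fun k hk => ?_⟩
    have hdel : τ.tri.del • ι (a • γ w) = (l + n) • ι (a • γ w) := by
      rw [hιx]
      exact (del_smul hl hx).trans (by rw [Int.cast_natCast])
    rw [map_smul, aeval_smul_of_smul_eq hdel, hιx, hPc 0 n _ hx]
    simp only [Polynomial.eval_comp, Polynomial.eval_sub, Polynomial.eval_X, Polynomial.eval_C,
      add_sub_cancel_left]
    split_ifs with h0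
    · rw [h0, hf1, one_smul]
    · rw [hf0 k n (by omega) h0, zero_smul]

/-- The topological argument is replaced by an algebraic one: on each vector P 0 is realized by an
element of R, so closedness of N is not needed. -/
theorem le_comap_kernelSubmodule (hg : τ.IsVermaGenerator g) {l : K}
    (hl : ∀ w, τ.del • g w = l • g w) (hPm : ∀ (m : ℕ) x, P m x ∈ τ.vermaComponent g m)
    (hPc : ∀ (m n : ℕ), ∀ x ∈ τ.vermaComponent g n, P m x = if n = m then x else 0)
    (hγ : τ.IsHighestWeight γ) (ι : Δ →ₗ[τ.R] X) (hι : ∀ w, ι (γ w) = g w)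
    {N : Submodule τ.R Δ} (hN : N ≠ ⊤) :
    N ≤ ((kernelSubmodule (𝓡 := 𝓡) (P 0)).restrictScalars τ.R).comap ι := fun y hy => by
  -- The kernel submodule tests translates by all of 𝓡, whereas N is stable only under R; density
  -- bridges the gap.
  refine fun r => τ.dense_induction (p := fun r => P 0 (r • ι y) = 0)
    (isClosed_eq ((P 0).continuous.comp (continuous_id.smul continuous_const)) continuous_const)
    (fun r => ?_) r
  have hr : (r : 𝓡) • ι y = ι (r • y) := by rw [map_smul]; rfl
  rw [hr]
  obtain ⟨q, hq⟩ := exists_smul_eq_projection hl hPc hγ ι hι (r • y)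
  obtain ⟨w, hw⟩ := mem_range_of_mem_vermaComponent_zero (hPm 0 (ι (r • y)))
  by_cases h0 : w = 0
  · rw [← hw, h0, map_zero]
  · refine absurd (hγ.eq_top_of_mem (N := N) h0 ?_) hN
    -- Injectivity of ι pulls the identity in X back to Δ, which puts the nonzero highest weight
    -- vector γ w in N.
    have : γ w = q • r • y := hg.injective_of_isHighestWeight hγ ι hι (by rw [hι, hw, hq])
    exact this ▸ N.smul_mem _ (N.smul_mem _ hy)

end Maximal

end IsVermaGenerator

end BanachTriangularDecomposition

end

/-! ### Base change and weight vectors of the simple quotients. -/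

noncomputable section

open Filter Topology

namespace BanachTriangularDecomposition.IsVermaGenerator

variable {K 𝓡 : Type*} [NontriviallyNormedField K] [NormedRing 𝓡] [NormedAlgebra K 𝓡]
  {τ : BanachTriangularDecomposition K 𝓡}
  {W : Type*} [NormedAddCommGroup W] [NormedSpace K W] [Module τ.tri.H W]
  {X : Type*} [NormedAddCommGroup X] [NormedSpace K X] [Module 𝓡 X]
  {Δ : Type*} [AddCommGroup Δ] [Module K Δ] [Module τ.R Δ]
  {g : W →L[K] X} {γ : W →ₗ[K] Δ}
  [IsUltrametricDist K] [CompleteSpace K] [CharZero K] [IsUltrametricDist 𝓡]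
  [CompleteSpace 𝓡] [Nontrivial 𝓡] [IsScalarTower K τ.tri.H W]
  [IsUltrametricDist X] [CompleteSpace X] [IsScalarTower K 𝓡 X] [IsBoundedSMul 𝓡 X]
  [FiniteDimensional K W] [IsScalarTower K τ.R Δ] [IsSimpleModule τ.tri.H W]
  {P : ℕ → X →L[K] X} {ι : Δ →ₗ[τ.R] X} {M : Submodule τ.R Δ} {N : Submodule 𝓡 X}

set_option linter.unusedSectionVars false

/-- The map induced by `ι` on quotients. -/
theorem exists_quotientMap (hMN : ∀ y, y ∈ M ↔ ι y ∈ N) :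
    ∃ j : (Δ ⧸ M) →ₗ[τ.R] (X ⧸ N), (∀ y, j (Submodule.Quotient.mk y) = Submodule.Quotient.mk (ι y)) ∧
      Function.Injective j := by
  let j₀ : Δ →ₗ[τ.R] (X ⧸ N) := (N.mkQ.restrictScalars τ.R).comp ι
  have hker : ∀ y, y ∈ M ↔ j₀ y = 0 := fun y =>
    (hMN y).trans (Submodule.Quotient.mk_eq_zero N (x := ι y)).symm
  refine ⟨M.liftQ j₀ fun y hy => (hker y).1 hy, fun y => rfl, ?_⟩
  refine (injective_iff_map_eq_zero _).2 fun q hq => ?_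
  obtain ⟨y, rfl⟩ := Submodule.Quotient.mk_surjective M q
  exact (Submodule.Quotient.mk_eq_zero M).2 ((hker y).2 hq)

theorem exists_quotientLift (j : (Δ ⧸ M) →ₗ[τ.R] (X ⧸ N)) :
    ∃ F : RelTensor K 𝓡 (Δ ⧸ M) τ.R.val.toRingHom →ₗ[𝓡] (X ⧸ N),
      ∀ r n, F (RelTensor.tmul K 𝓡 τ.R.val.toRingHom r n) = r • j n := by
  have hcomm := smulCommClass_of_isScalarTower K 𝓡 (X ⧸ N)
  have hj : ∀ (c : K) n, j (c • n) = c • j n := fun c n => by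
    rw [← algebraMap_smul τ.R c n, map_smul, ← algebraMap_smul τ.R c (j n)]
  obtain ⟨F, hF⟩ := RelTensor.exists_lift (K := K) (T := 𝓡) τ.R.val.toRingHom
    (LinearMap.mk₂ K (fun (r : 𝓡) (n : Δ ⧸ M) => r • j n) (fun _ _ _ => add_smul _ _ _)
      (fun _ _ _ => smul_assoc _ _ _) (fun _ _ _ => by rw [map_add, smul_add])
      (fun c r n => by rw [hj, smul_comm]))
    (fun p s n => by
      rw [LinearMap.mk₂_apply, LinearMap.mk₂_apply, map_smul, mul_smul]
      rfl)
    (fun t p n => by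
      rw [LinearMap.mk₂_apply, LinearMap.mk₂_apply, smul_eq_mul, mul_smul])
  exact ⟨F, hF⟩

theorem smul_tmul_one (s : τ.R) (n : Δ ⧸ M) :
    (s : 𝓡) • RelTensor.tmul K 𝓡 τ.R.val.toRingHom 1 n =
      RelTensor.tmul K 𝓡 τ.R.val.toRingHom 1 (s • n) := by
  rw [RelTensor.smul_tmul, smul_eq_mul, mul_one, ← RelTensor.mul_tmul, one_mul]
  rfl

/-- The annihilator of a highest weight vector modulo `N` is generated, as a closed left ideal, by
its intersection with the dense subalgebra. -/
theorem mem_ideal_of_smul_mem (hg : τ.IsVermaGenerator g) (hγ : τ.IsHighestWeight γ)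
    (hι : ∀ w, ι (γ w) = g w)
    (hPs : ∀ x, HasSum (fun m => P m x) x) (hPm : ∀ (m : ℕ) x, P m x ∈ τ.vermaComponent g m)
    (hPN : ∀ (m : ℕ) (N : Submodule 𝓡 X), IsClosed (N : Set X) → ∀ x ∈ N, P m x ∈ N)
    {w₀ : W} (hw : w₀ ≠ 0) (I : Ideal 𝓡) (hJ : ∀ s : τ.R, (s : 𝓡) • g w₀ ∈ N → (s : 𝓡) ∈ I)
    {r : 𝓡} (hr : r • g w₀ ∈ N) : r ∈ I := by
  obtain ⟨σ, hσ, hσR⟩ := hg.exists_section hw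
  have : IsNoetherianRing 𝓡 := τ.noetherian.1
  have hIc : IsClosed (I : Set 𝓡) := Ideal.isClosed_of_noetherian_banachAlgebra K I
  have hσc : ∀ n : ℤ, ∀ x ∈ τ.vermaComponent g n, σ x ∈ τ.R := fun n x hx => by
    induction hx using Submodule.span_induction with
    | mem x hx =>
      obtain ⟨a, ha, -, w, rfl⟩ := hx
      exact hσR a ha w
    | zero => rw [map_zero]; exact zero_mem _
    | add x y _ _ hx hy => rw [map_add]; exact add_mem hx hy
    | smul c x _ hx => rw [map_smul]; exact τ.R.smul_mem hx c
  -- σ x is the limit of finite sums of the σ (P m x). Each of these lies in R and carries g w₀ into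
  -- N, so the closed ideal I contains the limit.
  have h1 : ∀ x ∈ N, σ x ∈ I := fun x hx => by
    refine hIc.mem_of_tendsto ((hPs x).mapL σ) (Eventually.of_forall fun t => sum_mem fun m _ => ?_)
    refine hJ ⟨σ (P m x), hσc m _ (hPm m x)⟩ ?_
    rw [hσ]
    exact hPN m N (hg.isClosed_submodule N) x hx
  -- The difference annihilates g w₀, and for s in R it lies in R. With `h1` this splits r as (r -
  -- σ(r g w₀)) + σ(r g w₀).
  have h2 : ∀ s : 𝓡, s - σ (s • g w₀) ∈ I := fun s => by
    refine τ.dense_induction (p := fun s => s - σ (s • g w₀) ∈ I)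
      (hIc.preimage (continuous_id.sub (σ.continuous.comp (continuous_id.smul continuous_const))))
      (fun s => ?_) s
    have hsR : σ ((s : 𝓡) • g w₀) ∈ τ.R := by
      have : (s : 𝓡) • g w₀ = ι (s • γ w₀) := by rw [map_smul, hι]; rfl
      rw [this]
      refine hγ.induction_on (p := fun y => σ (ι y) ∈ τ.R) (s • γ w₀)
        (by simp) (fun x y hx hy => by rw [map_add, map_add]; exact add_mem hx hy)
        (fun n a ha _ w => ?_)
      rw [map_smul, hι]
      exact hσR a ha w
    refine hJ (s - ⟨_, hsR⟩) ?_
    rw [Subalgebra.coe_sub, sub_smul, hσ, sub_self]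
    exact zero_mem _
  have := add_mem (h2 r) (h1 _ hr)
  rwa [sub_add_cancel] at this

/-- The annihilator of 1 ⊗ [γ w₀] is a left ideal containing every s in R with s g(w₀) ∈ N, because
such s already kills the class of γ w₀ in Δ/M. Hence it contains the corresponding elements of 𝓡. -/
theorem smul_tmul_eq_zero (hg : τ.IsVermaGenerator g) (hγ : τ.IsHighestWeight γ)
    (hι : ∀ w, ι (γ w) = g w) (hMN : ∀ y, y ∈ M ↔ ι y ∈ N)
    (hPs : ∀ x, HasSum (fun m => P m x) x) (hPm : ∀ (m : ℕ) x, P m x ∈ τ.vermaComponent g m)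
    (hPN : ∀ (m : ℕ) (N : Submodule 𝓡 X), IsClosed (N : Set X) → ∀ x ∈ N, P m x ∈ N)
    {w₀ : W} (hw : w₀ ≠ 0) {r : 𝓡} (hr : r • g w₀ ∈ N) :
    r • RelTensor.tmul K 𝓡 τ.R.val.toRingHom 1 (Submodule.Quotient.mk (γ w₀) : Δ ⧸ M) = 0 := by
  refine hg.mem_ideal_of_smul_mem hγ hι hPs hPm hPN hw
    (LinearMap.ker (LinearMap.toSpanSingleton 𝓡 _ (RelTensor.tmul K 𝓡 τ.R.val.toRingHom 1
      (Submodule.Quotient.mk (γ w₀) : Δ ⧸ M)))) (fun s hs => ?_) hr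
  have h0 : s • γ w₀ ∈ M := (hMN _).2 (by rw [map_smul, hι]; exact hs)
  have h1 : s • (Submodule.Quotient.mk (γ w₀) : Δ ⧸ M) = 0 :=
    (Submodule.Quotient.mk_eq_zero M).2 h0
  have h2 := smul_tmul_one (K := K) (M := M) s (Submodule.Quotient.mk (γ w₀))
  rw [h1, RelTensor.tmul_zero] at h2
  exact h2

/-- Both sides are cyclic on the class of w₀, so injectivity is the comparison of annihilators in
`smul_tmul_eq_zero`. -/
theorem exists_quotientEquiv (hg : τ.IsVermaGenerator g) (hγ : τ.IsHighestWeight γ)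
    (hι : ∀ w, ι (γ w) = g w) (hMN : ∀ y, y ∈ M ↔ ι y ∈ N)
    (hPs : ∀ x, HasSum (fun m => P m x) x) (hPm : ∀ (m : ℕ) x, P m x ∈ τ.vermaComponent g m)
    (hPN : ∀ (m : ℕ) (N : Submodule 𝓡 X), IsClosed (N : Set X) → ∀ x ∈ N, P m x ∈ N)
    (j : (Δ ⧸ M) →ₗ[τ.R] (X ⧸ N))
    (hj : ∀ y, j (Submodule.Quotient.mk y) = Submodule.Quotient.mk (ι y)) :
    ∃ e : RelTensor K 𝓡 (Δ ⧸ M) τ.R.val.toRingHom ≃ₗ[𝓡] (X ⧸ N),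
      ∀ n, e (RelTensor.tmul K 𝓡 τ.R.val.toRingHom 1 n) = j n := by
  have : Nontrivial W := IsSimpleModule.nontrivial τ.tri.H W
  obtain ⟨w₀, hw⟩ := exists_ne (0 : W)
  obtain ⟨σ, hσ, -⟩ := hg.exists_section hw
  obtain ⟨F, hF⟩ := exists_quotientLift (K := K) j
  let u := RelTensor.tmul K 𝓡 τ.R.val.toRingHom 1 (Submodule.Quotient.mk (γ w₀) : Δ ⧸ M)
  have hFu : ∀ r : 𝓡, F (r • u) = Submodule.Quotient.mk (r • g w₀) := fun r => by
    rw [map_smul, hF, one_smul, hj, hι]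
    rfl
  have hcyc : ∀ z : RelTensor K 𝓡 (Δ ⧸ M) τ.R.val.toRingHom, ∃ r : 𝓡, z = r • u := fun z => by
    have hγu : ∀ y : Δ, ∃ s : τ.R, RelTensor.tmul K 𝓡 τ.R.val.toRingHom 1
        (Submodule.Quotient.mk y : Δ ⧸ M) = (s : 𝓡) • u := fun y => by
      have hy : y ∈ Submodule.span τ.R {γ w₀} :=
        hγ.eq_top_of_mem hw (Submodule.mem_span_singleton_self (γ w₀)) ▸ Submodule.mem_top
      obtain ⟨s, rfl⟩ := Submodule.mem_span_singleton.1 hy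
      exact ⟨s, by rw [smul_tmul_one]; rfl⟩
    refine RelTensor.induction_on (p := fun z => ∃ r : 𝓡, z = r • u) z
      ⟨0, (zero_smul 𝓡 u).symm⟩ (fun r n => ?_) ?_
    · obtain ⟨y, rfl⟩ := Submodule.Quotient.mk_surjective M n
      obtain ⟨s, hs⟩ := hγu y
      refine ⟨r * s, ?_⟩
      rw [mul_smul, ← hs, RelTensor.smul_tmul, smul_eq_mul, mul_one]
    · rintro _ _ ⟨r, rfl⟩ ⟨s, rfl⟩
      exact ⟨r + s, (add_smul r s u).symm⟩
  refine ⟨LinearEquiv.ofBijective F ⟨(injective_iff_map_eq_zero F).2 fun z hz => ?_, fun q => ?_⟩,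
    fun n => (hF 1 n).trans (one_smul _ _)⟩
  · obtain ⟨r, rfl⟩ := hcyc z
    rw [hFu, Submodule.Quotient.mk_eq_zero] at hz
    exact hg.smul_tmul_eq_zero hγ hι hMN hPs hPm hPN hw hz
  · obtain ⟨x, rfl⟩ := Submodule.Quotient.mk_surjective N q
    exact ⟨σ x • u, by rw [hFu, hσ]⟩

/-- The classes of a·γ w are eigenvectors. Conversely, if (∂ - μ)^k x ∈ N, then applying P m forces
every component of x outside weight μ into N. As N is closed, x is congruent to the single component
of weight μ, which is in the image of ι, or to 0. -/
theorem range_quotientMap (hg : τ.IsVermaGenerator g) (hγ : τ.IsHighestWeight γ)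
    (hι : ∀ w, ι (γ w) = g w) {l : K} (hl : ∀ w, τ.del • g w = l • g w)
    (hPs : ∀ x, HasSum (fun m => P m x) x) (hPm : ∀ (m : ℕ) x, P m x ∈ τ.vermaComponent g m)
    (hPd : ∀ (m : ℕ) x, P m (τ.del • x) = (l + m) • P m x)
    (hPN : ∀ (m : ℕ) (N : Submodule 𝓡 X), IsClosed (N : Set X) → ∀ x ∈ N, P m x ∈ N)
    (j : (Δ ⧸ M) →ₗ[τ.R] (X ⧸ N))
    (hj : ∀ y, j (Submodule.Quotient.mk y) = Submodule.Quotient.mk (ι y)) :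
    Set.range j = (moduleWeightSum K (X ⧸ N) τ.del : Set (X ⧸ N)) := by
  have hcomm := smulCommClass_of_isScalarTower K τ.R Δ
  have hcommX := smulCommClass_of_isScalarTower K 𝓡 X
  refine Set.Subset.antisymm ?_ ?_
  · rintro _ ⟨q, rfl⟩
    obtain ⟨y, rfl⟩ := Submodule.Quotient.mk_surjective M q
    rw [hj]
    refine hγ.induction_on
      (p := fun y => (Submodule.Quotient.mk (ι y) : X ⧸ N) ∈ moduleWeightSum K (X ⧸ N) τ.del) y
      (by simp) (fun x y hx hy => by
        rw [map_add, Submodule.Quotient.mk_add]; exact add_mem hx hy) (fun n a ha han w => ?_)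
    refine Submodule.mem_iSup_of_mem (l + n) ?_
    refine (Module.End.genEigenspace _ (l + n)).monotone (le_top : (1 : ℕ∞) ≤ ⊤) ?_
    rw [← Module.End.eigenspace, Module.End.mem_eigenspace_iff, map_smul, hι]
    have := del_smul hl (mem_vermaComponent (g := g) ha han w)
    exact congrArg Submodule.Quotient.mk this
  · have hrange : ∀ n : ℤ, ∀ x ∈ τ.vermaComponent g n, ∃ y, ι y = x := fun n x hx => by
      induction hx using Submodule.span_induction with
      | mem x hx =>
        obtain ⟨a, ha, -, w, rfl⟩ := hx
        exact ⟨a • γ w, by rw [map_smul, hι]; rfl⟩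
      | zero => exact ⟨0, map_zero ι⟩
      | add x y _ _ hx hy =>
        obtain ⟨⟨u, rfl⟩, v, rfl⟩ := And.intro hx hy
        exact ⟨u + v, map_add ι u v⟩
      | smul c x _ hx =>
        obtain ⟨u, rfl⟩ := hx
        exact ⟨algebraMap K τ.R c • u, by rw [map_smul, algebraMap_smul]⟩
    have hjc : ∀ (c : K) n, j (c • n) = c • j n := fun c n => by
      rw [← algebraMap_smul τ.R c n, map_smul, ← algebraMap_smul τ.R c (j n)]
    let S : Submodule K (X ⧸ N) :=
      { carrier := Set.range j
        zero_mem' := ⟨0, map_zero j⟩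
        add_mem' := by rintro _ _ ⟨a, rfl⟩ ⟨b, rfl⟩; exact ⟨a + b, map_add j a b⟩
        smul_mem' := by rintro c _ ⟨a, rfl⟩; exact ⟨c • a, hjc c a⟩ }
    suffices h : moduleWeightSum K (X ⧸ N) τ.del ≤ S from h
    refine iSup_le fun μ q hq => ?_
    obtain ⟨k, hk⟩ := Module.End.mem_maxGenEigenspace _ _ _ |>.1 hq
    obtain ⟨x, rfl⟩ := Submodule.Quotient.mk_surjective N q
    -- The power of ∂ - μ is followed on a representative in X, where P m turns it into a power of
    -- the scalar l + m - μ.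
    have hpow : ∀ k : ℕ, ∃ x' : X, (((Algebra.lsmul K K (X ⧸ N) τ.del) - μ • 1) ^ k)
        (Submodule.Quotient.mk x) = Submodule.Quotient.mk x' ∧
        ∀ m : ℕ, P m x' = (l + m - μ) ^ k • P m x := fun k => by
      induction k with
      | zero => exact ⟨x, rfl, fun m => by simp⟩
      | succ k ih =>
        obtain ⟨x', hx', hP'⟩ := ih
        refine ⟨τ.del • x' - μ • x', ?_, fun m => ?_⟩
        · rw [pow_succ', Module.End.mul_apply, hx']
          rfl
        · rw [map_sub, hPd, map_smul, ← sub_smul, hP', smul_smul, pow_succ']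
    obtain ⟨x', hx', hP'⟩ := hpow k
    rw [hk] at hx'
    have hx'N : x' ∈ N := (Submodule.Quotient.mk_eq_zero N).1 hx'.symm
    have hNc := hg.isClosed_submodule N
    have hmem : ∀ m : ℕ, l + m ≠ μ → P m x ∈ N := fun m hm => by
      have h1 := hPN m N hNc x' hx'N
      rw [hP'] at h1
      have h2 := N.smul_of_tower_mem ((l + m - μ) ^ k)⁻¹ h1
      rwa [smul_smul, inv_mul_cancel₀ (pow_ne_zero k (sub_ne_zero.2 hm)), one_smul] at h2
    by_cases hex : ∃ m : ℕ, l + m = μ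
    · obtain ⟨m, hm⟩ := hex
      -- All components but the m-th lie in N, because m is the only index of weight μ in
      -- characteristic zero; closedness absorbs their infinite sum.
      have hsub : x - P m x ∈ N := by
        have hs : HasSum (fun n => if n = m then 0 else P n x) (x - P m x) := by
          have hd := (hPs x).sub (hasSum_ite_eq m (P m x))
          have he : (fun n => P n x - if n = m then P m x else 0) =
              fun n => if n = m then 0 else P n x := funext fun n => by
            by_cases h : n = m
            · rw [if_pos h, if_pos h, h, sub_self]
            · rw [if_neg h, if_neg h, sub_zero]
          exact he ▸ hd
        refine hNc.mem_of_tendsto hs (Eventually.of_forall fun t => sum_mem fun n _ => ?_)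
        split_ifs with h
        · exact zero_mem _
        · exact hmem n fun hn => h (by
            have := hn.trans hm.symm
            exact_mod_cast add_left_cancel this)
      obtain ⟨y, hy⟩ := hrange m _ (hPm m x)
      refine ⟨Submodule.Quotient.mk y, ?_⟩
      rw [hj, hy]
      exact ((Submodule.Quotient.eq N).2 hsub).symm
    · have hxN : x ∈ N := hNc.mem_of_tendsto (hPs x)
        (Eventually.of_forall fun t => sum_mem fun n _ => hmem n fun hn => hex ⟨n, hn⟩)
      rw [(Submodule.Quotient.mk_eq_zero N).2 hxN]
      exact S.zero_mem

end BanachTriangularDecomposition.IsVermaGenerator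

end

/-! ### Assembly for the actual Verma modules. -/

noncomputable section

open Filter Topology

namespace BanachTriangularDecomposition

variable {K 𝓡 : Type*} [NontriviallyNormedField K] [NormedRing 𝓡] [NormedAlgebra K 𝓡]
  {τ : BanachTriangularDecomposition K 𝓡}
  {W : Type*} [NormedAddCommGroup W] [NormedSpace K W] [Module τ.tri.H W]
  {X : Type*} [NormedAddCommGroup X] [NormedSpace K X] [Module 𝓡 X]
  {Δ : Type*} [AddCommGroup Δ] [Module K Δ] [Module τ.R Δ]
  {g : W →L[K] X} {γ : W →ₗ[K] Δ}

/-- The maximal submodule of Δ is the preimage of the one of X, which is why the induced map of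
quotients is injective. -/
theorem IsVermaGenerator.exists_simpleQuotients [IsUltrametricDist K] [CompleteSpace K] [CharZero K]
    [IsUltrametricDist 𝓡] [CompleteSpace 𝓡] [Nontrivial 𝓡] [IsScalarTower K τ.tri.H W]
    [IsUltrametricDist X] [CompleteSpace X] [IsScalarTower K 𝓡 X] [IsBoundedSMul 𝓡 X]
    [FiniteDimensional K W] [IsScalarTower K τ.R Δ] [IsSimpleModule τ.tri.H W]
    (hg : τ.IsVermaGenerator g) (hγ : τ.IsHighestWeight γ)
    (ι : Δ →ₗ[τ.R] X) (hι : ∀ w, ι (γ w) = g w) {u : W → Δ} (hu : ∀ w, γ w = u w)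
    {v : W → X} (hv : ∀ w, g w = v w) :
    (∃! M : Submodule τ.R Δ, IsCoatom M) ∧ (∃! N : Submodule 𝓡 X, IsCoatom N) ∧
    (∃! N : Submodule 𝓡 X, IsSimpleModule 𝓡 (X ⧸ N)) ∧
    ∀ (M : Submodule τ.R Δ) (N : Submodule 𝓡 X), IsCoatom M → IsCoatom N →
      ∃ e : RelTensor K 𝓡 (Δ ⧸ M) τ.R.val.toRingHom ≃ₗ[𝓡] (X ⧸ N),
        (∀ w : W, e (RelTensor.tmul K 𝓡 τ.R.val.toRingHom 1 (Submodule.Quotient.mk (u w))) =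
          Submodule.Quotient.mk (v w)) ∧
        Function.Injective
          (fun x : Δ ⧸ M => e (RelTensor.tmul K 𝓡 τ.R.val.toRingHom 1 x)) ∧
        Set.range (fun x : Δ ⧸ M => e (RelTensor.tmul K 𝓡 τ.R.val.toRingHom 1 x)) =
          (moduleWeightSum K (X ⧸ N) τ.del : Set (X ⧸ N)) := by
  obtain ⟨l, hl⟩ := hg.exists_weight
  obtain ⟨P, hPs, hPm, hPc, hPd, hPN⟩ := hg.exists_projections hl
  let N₀ : Submodule 𝓡 X := kernelSubmodule (P 0)
  let M₀ : Submodule τ.R Δ := (N₀.restrictScalars τ.R).comap ι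
  have hMN : ∀ y, y ∈ M₀ ↔ ι y ∈ N₀ := fun y => Iff.rfl
  obtain ⟨j, hj, hjinj⟩ := IsVermaGenerator.exists_quotientMap hMN
  obtain ⟨e, he⟩ := hg.exists_quotientEquiv hγ hι hMN hPs hPm hPN j hj
  have hej : (fun x : Δ ⧸ M₀ => e (RelTensor.tmul K 𝓡 τ.R.val.toRingHom 1 x)) = j := funext he
  have hM₀ : ∀ M, IsCoatom M ↔ M = M₀ :=
    Submodule.isCoatom_iff_eq (hg.comap_kernelSubmodule_ne_top hPc ι hι)
      fun M hM => hg.le_comap_kernelSubmodule hl hPm hPc hγ ι hι hM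
  have hN₀ : ∀ N, IsCoatom N ↔ N = N₀ :=
    Submodule.isCoatom_iff_eq (hg.kernelSubmodule_ne_top hPc)
      fun N hN => hg.le_kernelSubmodule hPm hPN hN
  refine ⟨⟨M₀, (hM₀ _).2 rfl, fun M => (hM₀ M).1⟩, ⟨N₀, (hN₀ _).2 rfl, fun N => (hN₀ N).1⟩,
    ⟨N₀, isSimpleModule_iff_isCoatom.2 ((hN₀ _).2 rfl), fun N hN =>
      (hN₀ N).1 (isSimpleModule_iff_isCoatom.1 hN)⟩, fun M N hM hN => ?_⟩
  obtain rfl := (hM₀ M).1 hM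
  obtain rfl := (hN₀ N).1 hN
  refine ⟨e, fun w => by rw [he, ← hu, hj, hι, hv], ?_, ?_⟩
  · rw [hej]; exact hjinj
  · rw [hej]; exact hg.range_quotientMap hγ hι hl hPs hPm hPd hPN j hj

end BanachTriangularDecomposition

theorem TriangularDecomposition.exists_vermaGenLinearMap {K R : Type*} [Field K] [Ring R]
    [Algebra K R] (τ : TriangularDecomposition K R) (W : Type*) [AddCommGroup W] [Module K W]
    [Module τ.H W] : ∃ γ : W →ₗ[K] τ.Verma W, ∀ w, γ w = τ.vermaGen w :=
  ⟨{ toFun := τ.vermaGen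
     map_add' := fun v w => by
       rw [vermaGen, RelTensor.tmul_add, RelTensor.tmul_add]; rfl
     map_smul' := fun c w => by
       rw [vermaGen, RelTensor.tmul_smul']
       exact RelTensor.tmul_smul' c 1 (RelTensor.tmul K τ.BH τ.HToQuot 1 w) }, fun _ => rfl⟩

theorem TriangularDecomposition.BPos_smul_vermaGen {K R : Type*} [Field K] [Ring R]
    [Algebra K R] (τ : TriangularDecomposition K R) {W : Type*} [AddCommGroup W] [Module K W]
    [Module τ.H W] {b : R} (hb : b ∈ τ.BPos) (w : W) : b • τ.vermaGen w = 0 := by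
  have h1 : (⟨b, (le_sup_left : τ.B ≤ τ.BH) hb.1⟩ : τ.BH) ∈ τ.BHPos := by
    rw [BHPos, TwoSidedIdeal.mem_asIdeal]
    exact TwoSidedIdeal.subset_span ⟨b, hb, 1, τ.H.one_mem, (mul_one b).symm⟩
  have h2 := τ.smul_vermaGen ⟨b, (le_sup_left : τ.B ≤ τ.BH) hb.1⟩ w
  rw [Ideal.Quotient.eq_zero_iff_mem.2 h1] at h2
  refine h2.trans ?_
  have h3 : RelTensor.tmul K τ.BH τ.HToQuot (0 : τ.BH ⧸ τ.BHPos) w = 0 :=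
    congrArg Submodule.Quotient.mk (TensorProduct.zero_tmul _ w)
  rw [h3, RelTensor.tmul_zero]

namespace BanachTriangularDecomposition

variable {K 𝓡 : Type*} [NontriviallyNormedField K] [NormedRing 𝓡] [NormedAlgebra K 𝓡]
  (τ : BanachTriangularDecomposition K 𝓡)
  {W : Type*} [NormedAddCommGroup W] [NormedSpace K W] [Module τ.tri.H W]

theorem isHighestWeight_vermaGen [IsScalarTower K τ.tri.H W] {γ : W →ₗ[K] τ.tri.Verma W}
    (hγ : ∀ w, γ w = τ.tri.vermaGen w) : τ.IsHighestWeight γ where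
  H_smul h w := by rw [hγ, hγ]; exact τ.tri.H_smul_vermaGen h w
  BPos_smul b hb w := by
    rw [hγ]
    exact τ.tri.BPos_smul_vermaGen hb w
  span_range := eq_top_iff.2 fun x _ => by
    refine τ.tri.verma_induction (p := fun x => x ∈ Submodule.span τ.R (Set.range γ)) x
      (zero_mem _) (fun _ _ => add_mem) fun r w => ?_
    rw [← hγ]
    exact Submodule.smul_mem _ _ (Submodule.subset_span ⟨w, rfl⟩)

omit [NormedSpace K W] in
theorem nontrivial_of_isSimpleModule [IsSimpleModule τ.tri.H W] : Nontrivial 𝓡 := by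
  by_contra h
  rw [not_nontrivial_iff_subsingleton] at h
  have := Module.subsingleton τ.tri.H W
  exact not_subsingleton_iff_nontrivial.2 (IsSimpleModule.nontrivial τ.tri.H W) this

section

variable [IsUltrametricDist K] [CompleteSpace K] [CharZero K] [IsUltrametricDist 𝓡]
  [CompleteSpace 𝓡] [Nontrivial 𝓡] [IsScalarTower K τ.tri.H W] [FiniteDimensional K W]
  [IsUltrametricDist W]

theorem isVermaGenerator_vermaGen {g : W →L[K] τ.Verma W} (hg : ∀ w, g w = τ.vermaGen w) :
    τ.IsVermaGenerator g where
  H_smul h w := by rw [hg, hg, τ.H_smul_vermaGen]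
  BPos_smul b hb w := by rw [hg, τ.BPos_smul_vermaGen hb]
  exists_equiv := by
    obtain ⟨e, he⟩ := τ.exists_vermaEquiv W
    exact ⟨e, fun a w => by rw [he, hg]⟩

variable (W) in
/-- The algebraic Verma module maps to the analytic one. -/
theorem exists_vermaEmbedding : ∃ (g : W →L[K] τ.Verma W) (γ : W →ₗ[K] τ.tri.Verma W)
    (ι : τ.tri.Verma W →ₗ[τ.R] τ.Verma W), τ.IsVermaGenerator g ∧ τ.IsHighestWeight γ ∧
      (∀ w, ι (γ w) = g w) ∧ (∀ w, γ w = τ.tri.vermaGen w) ∧ ∀ w, g w = τ.vermaGen w := by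
  obtain ⟨g, hg⟩ := τ.exists_vermaGenCLM W
  obtain ⟨γ, hγ⟩ := τ.tri.exists_vermaGenLinearMap W
  have hgen : τ.IsVermaGenerator g := τ.isVermaGenerator_vermaGen hg
  obtain ⟨ι, hι⟩ := TriangularDecomposition.exists_vermaLift (K := K) (R := τ.R) (W := W)
    (X := τ.Verma W) τ.tri g.toLinearMap hgen.H_smul hgen.BPos_smul
  exact ⟨g, γ, ι, hgen, τ.isHighestWeight_vermaGen hγ,
    fun w => (congrArg ι (hγ w)).trans (hι w), hγ, hg⟩

end

end BanachTriangularDecomposition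

end

set_option maxHeartbeats 1000000 in
theorem mainTheorem9 (p : ℕ) [Fact p.Prime]
    {K : Type*} [NontriviallyNormedField K] [IsUltrametricDist K] [CompleteSpace K]
    [NormedAlgebra ℚ_[p] K]
    (hK : IsDiscreteValuationRing (NormedField.valuation (K := K)).integer)
    {𝓡 : Type*} [NormedRing 𝓡] [NormedAlgebra K 𝓡] [IsUltrametricDist 𝓡] [CompleteSpace 𝓡]
    (τ : BanachTriangularDecomposition K 𝓡)
    (h𝓐 : IsTwoSidedNoetherian τ.𝓐) (h𝓑 : IsTwoSidedNoetherian τ.𝓑)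
    {W : Type*} [NormedAddCommGroup W] [NormedSpace K W] [IsUltrametricDist W]
    [Module τ.tri.H W] [IsScalarTower K τ.tri.H W] [IsSimpleModule τ.tri.H W] :
    (∃ e : CompletedTensor K τ.𝓐 W ≃L[K] τ.Verma W,
      ∀ (a : τ.𝓐) (w : W), e (CompletedTensor.tmul K a w) = (a : 𝓡) • τ.vermaGen w) ∧
    (∃! M : Submodule τ.R (τ.tri.Verma W), IsCoatom M) ∧
    (∃! N : Submodule 𝓡 (τ.Verma W), IsCoatom N) ∧
    (∃! N : Submodule 𝓡 (τ.Verma W), IsSimpleModule 𝓡 (τ.Verma W ⧸ N)) ∧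
    ∀ (M : Submodule τ.R (τ.tri.Verma W)) (N : Submodule 𝓡 (τ.Verma W)),
      IsCoatom M → IsCoatom N →
      ∃ e : RelTensor K 𝓡 (τ.tri.Verma W ⧸ M) τ.R.val.toRingHom ≃ₗ[𝓡] (τ.Verma W ⧸ N),
        (∀ w : W, e (RelTensor.tmul K 𝓡 τ.R.val.toRingHom 1
            (Submodule.Quotient.mk (τ.tri.vermaGen w))) =
          Submodule.Quotient.mk (τ.vermaGen w)) ∧
        Function.Injective (fun x : τ.tri.Verma W ⧸ M =>
          e (RelTensor.tmul K 𝓡 τ.R.val.toRingHom 1 x)) ∧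
        Set.range (fun x : τ.tri.Verma W ⧸ M =>
          e (RelTensor.tmul K 𝓡 τ.R.val.toRingHom 1 x)) =
            (moduleWeightSum K (τ.Verma W ⧸ N) τ.del : Set (τ.Verma W ⧸ N)) := by
  -- Characteristic zero provides the factorial denominators of the interpolation and separates the
  -- weights l + n.
  have : CharZero K := charZero_of_injective_algebraMap (algebraMap ℚ_[p] K).injective
  have : FiniteDimensional K W := τ.tri.H_split.finiteDimensional_of_isSimpleModule
  have : Nontrivial 𝓡 := τ.nontrivial_of_isSimpleModule (W := W)
  exact ⟨τ.exists_vermaEquiv W,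
    let ⟨_, _, ι, hg, hγ, hι, hu, hv⟩ := τ.exists_vermaEmbedding W
    hg.exists_simpleQuotients hγ ι hι hu hv⟩
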